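/- **Setting.** Equip $\mathbb R^2$ with the $\ell^1$ norm $|\cdot|$ and letters $x,y$ for its two coordinates. Let $\gamma:[0,1]\to\mathbb R^2$ be $C^1$ with $|\dot\gamma_u|=L>0$ for all $u\in[0,1]$, and let $X=\{C(w)\}_w$, $C(w)=\int_{0<u_1<\dots<u_m<1}d\gamma^{i_1}_{u_1}\cdots d\gamma^{i_m}_{u_m}$ for $w=e_{i_1}\cdots e_{i_m}$, be its signature. Put $\omega(h)=\sup_{|s-t|<h}|\dot\gamma_s-\dot\gamma_t|$, $\delta_k=\omega(1/k)$, $\varepsilon_k=\sqrt{\delta_k/L}+\sqrt{1/k}$ and $\eta_k=\omega(3\varepsilon_k)$. Let $n$ denote an integer with $|n-k^2\log k|<1$. For a word $w=e_{i_1}\cdots e_{i_{k-1}}$ and $\ell\in\{0,\dots,n\}^k$ let $\mathcal S(w,\ell)$ be the sum of $C(w')$ over all words $w'=w_1e_{i_1}w_2e_{i_2}\cdots e_{i_{k-1}}w_k$ in which the block $w_j$ has exactly $2\ell_j$ letters $x$ and $2n-2\ell_j$ letters $y$. For $a\in\{x,y\}$ and $1\le i\le k$ let $\mathcal S_{i,a}(w,\ell)$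 be the same sum except that the block $w_i$ has one more letter $a$. These quantities are defined for any formal series $X$ in place of the signature. **Procedure** (input: a series $X$, integers $k,n$, a tolerance $\theta$). 1. Choose any $\rho_1,\dots,\rho_k\in[0,1]$ such that for every $j$ $$\Big(\sum_w\sum_{\ell:\,|\ell_j/n-\rho_j|<\theta}|\mathcal S(w,\ell)|\Big)\Big/\Big(\sum_w\sum_\ell|\mathcal S(w,\ell)|\Big)>\tfrac12 .$$ 2. Let $w^*=e_{i_1}\cdots e_{i_{k-1}}$ with $e_{i_j}=x$ if $\rho_j\ge\frac12$ and $e_{i_j}=y$ otherwise. Let $a_x^{(j)}=1$ if $\sum_\ell\mathcal S(w^*,\ell)\big/\sum_\ell\mathcal S_{j,x}(w^*,\ell)\ge0$ (with value $0$ for a zero denominator) and $a_x^{(j)}=-1$ otherwise; $a_y^{(j)}$ likewise with $\mathcal S_{j,y}$. 3. With $|X^1|=|C(x)|+|C(y)|$, let $$\tilde L=|X^1|\Big/\frac1k\Big(\big|\sum_ja_x^{(j)}\rho_j\big|+\big|\sum_ja_y^{(j)}(1-\rho_j)\big|\Big)\qquad\text{if }|X^1|\ne0 .$$ If $|X^1|=0$,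 let $Y=X\otimes\exp\big(a_x^{(k)}\rho_k\,x+a_y^{(k)}(1-\rho_k)\,y\big)$ (a segment of length $1$ is appended), apply steps 1, 2 and the last formula to $Y$ with the same $k,n,\theta$, and let $\tilde L$ be the resulting length minus $1$. **Theorem.** (a) $\eta_k\to0$ as $k\to\infty$. (b) For every $\kappa>0$ (for instance $\kappa=2$) there is $C>0$, depending only on $\gamma$ and $\kappa$, such that for all sufficiently large $k$, all $n$ as above, and every output $\rho_j,a_x^{(j)},a_y^{(j)},\tilde L$ of the procedure for the signature $X$ of $\gamma$ with tolerance $\theta=\kappa\eta_k$, one has $\tilde L>0$ and $$\sup_{1\le j\le k}\ \sup_{u\in[\frac{j-1}k,\frac jk]}\Big|\tilde L\big(a_x^{(j)}\rho_j,\,a_y^{(j)}(1-\rho_j)\big)-\dot\gamma_u\Big|<C\eta_k .$$ Moreover the concatenation $\tilde\gamma$, started at $\gamma_0$ and parametrized at uniform speed on $[0,1]$, of the $k$ segments $\frac{\tilde L}k\big(a_x^{(j)}\rho_j\,x+a_y^{(j)}(1-\rho_j)\,y\big)$ has speed $\tilde L$ and satisfies $\|\tilde\gamma-\gamma\|_{C^1}<C\eta_k$,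 that is, $\sup|\tilde\gamma-\gamma|+\sup|\dot{\tilde\gamma}-\dot\gamma|<C\eta_k$, with one-sided derivatives of $\tilde\gamma$ at the break points. (c) Suppose that $\gamma$ is not a straight line. For every $\kappa\ge2/L$, for all large $k$ and all $n$ as above, directions $\rho_j$ as in step 1 exist for $X$ and $\theta=\kappa\eta_k$. There is $\kappa_0$, depending on $\gamma$, such that for every $\kappa\ge\kappa_0$, for all large $k$ and all $n$ as above, every choice of directions for $X$ with $\theta=\kappa\eta_k$ can be completed to an output of the procedure. (d) For any series $X$ and any $k\ge1$, $n$, $\theta$, the outputs of the procedure depend only on the coefficients of $X$ at words of length at most $2nk+k$. -/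

import Mathlib

open Set Filter Topology MeasureTheory

namespace SigInv

noncomputable section

/-! ### Paths in the plane with the `ℓ¹` norm -/

/-- `ℝ²` with the `ℓ¹` norm; coordinate `0` is `x`, coordinate `1` is `y`. -/
abbrev Plane : Type := PiLp 1 (fun _ : Fin 2 => ℝ)

/-- The velocity of a path on `[0,1]` (one-sided at the two end points). -/
def velocity (γ : ℝ → Plane) (u : ℝ) : Plane := derivWithin γ (Icc 0 1) u

/-- Modulus of continuity of the velocity: the supremum of the `ℓ¹` distance of the velocities at
`s, t ∈ [0,1]`, `|s - t| < h`. -/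
def modulus (γ : ℝ → Plane) (h : ℝ) : ℝ :=
  sSup {d : ℝ | ∃ s ∈ Icc (0 : ℝ) 1, ∃ t ∈ Icc (0 : ℝ) 1,
    |s - t| < h ∧ d = ‖velocity γ s - velocity γ t‖}

/-- `ε_k = √(δ_k / L) + √(1 / k)`, where `δ_k` is the modulus of continuity at scale `1 / k`. -/
def eps (γ : ℝ → Plane) (L : ℝ) (k : ℕ) : ℝ :=
  √(modulus γ (1 / (k : ℝ)) / L) + √(1 / (k : ℝ))

/-- `η_k`: the oscillation of the velocity over times at distance less than `3 ε_k`. -/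
def eta (γ : ℝ → Plane) (L : ℝ) (k : ℕ) : ℝ := modulus γ (3 * eps γ L k)

/-! ### Signatures -/

/-- A word in the letters `x = 0`, `y = 1`. -/
abbrev Word : Type := List (Fin 2)

/-- A formal series in two non-commuting letters, given by its coefficients. -/
abbrev Series : Type := Word → ℝ

/-- The coefficient of the signature at a word `w`: the integral of
`dγ^{w_1}_{u_1} ⋯ dγ^{w_n}_{u_n}` over `0 < u_1 < ⋯ < u_n < 1`. -/
def signature (γ : ℝ → Plane) : Series := fun w =>
  ∫ u in {u : Fin w.length → ℝ | StrictMono u ∧ ∀ i, u i ∈ Ioo (0 : ℝ) 1},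
    ∏ i, velocity γ (u i) (w.get i)

/-- The product of two series in the tensor algebra. -/
def tensorMul (A B : Series) : Series := fun w =>
  ∑ i ∈ Finset.range (w.length + 1), A (w.take i) * B (w.drop i)

/-- The tensor exponential of a vector: at level `m` it is `b^{⊗ m} / m!`. -/
def tensorExp (b : Plane) : Series := fun w =>
  (w.map fun i => b i).prod / (w.length.factorial : ℝ)

/-- The `ℓ¹` norm of the first level of a series. -/
def levelOneNorm (X : Series) : ℝ := |X [0]| + |X [1]|

/-! ### Symmetrized signatures -/

/-- The word `b_1 e_1 b_2 e_2 ⋯ e_{k-1} b_k` with blocks `b_j` and separating letters `e_j`. -/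
def assemble {k : ℕ} (b : Fin k → Word) (e : Fin (k - 1) → Fin 2) : Word :=
  (List.ofFn fun j : Fin k =>
    b j ++ (if h : (j : ℕ) < k - 1 then [e ⟨j, h⟩] else [])).flatten

/-- All words `b_1 e_1 b_2 ⋯ e_{k-1} b_k` whose block `b_j` contains each letter `i` exactly
`c j i` times. -/
def blockWords {k : ℕ} (c : Fin k → Fin 2 → ℕ) (e : Fin (k - 1) → Fin 2) : Set Word :=
  {w | ∃ b : Fin k → Word, (∀ j i, (b j).count i = c j i) ∧ w = assemble b e}

/-- There are finitely many such words, so that the sums below are honest finite sums. -/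
theorem blockWords_finite {k : ℕ} (c : Fin k → Fin 2 → ℕ) (e : Fin (k - 1) → Fin 2) :
    (blockWords c e).Finite := by
  have hlen : ∀ l : Word, l.length = l.count 0 + l.count 1 := by
    intro l
    induction l with
    | nil => simp
    | cons a l ih => fin_cases a <;> simp [ih] <;> omega
  have hfin : {b : Fin k → Word | ∀ j i, (b j).count i = c j i}.Finite := by
    refine (Set.Finite.pi' (fun j => List.finite_length_eq (Fin 2) (c j 0 + c j 1))).subset ?_
    intro b hb j
    simp only [Set.mem_ofPred_eq]
    rw [hlen, hb, hb]
  refine (hfin.image (fun b => assemble b e)).subset ?_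
  rintro w ⟨b, hb, rfl⟩
  exact ⟨b, hb, rfl⟩

/-- The sum of the coefficients of a series over all the words of `blockWords c e`. -/
def blockSum {k : ℕ} (X : Series) (c : Fin k → Fin 2 → ℕ) (e : Fin (k - 1) → Fin 2) : ℝ :=
  ∑ᶠ w ∈ blockWords c e, X w

/-- Block `j` contains `2 ℓ_j` letters `x` and `2 n - 2 ℓ_j` letters `y`. -/
def evenCount {k n : ℕ} (l : Fin k → Fin (n + 1)) (j : Fin k) : Fin 2 → ℕ :=
  ![2 * (l j : ℕ), 2 * n - 2 * (l j : ℕ)]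

/-- The symmetrized signature `S^{2n}_k(w, ℓ)`. -/
def symSig {k n : ℕ} (X : Series) (w : Fin (k - 1) → Fin 2) (l : Fin k → Fin (n + 1)) : ℝ :=
  blockSum X (evenCount l) w

/-- The symmetrized signature `S^{2n}_{k,i,a}(w, ℓ)`: as `symSig`, but block `i` contains one
additional letter `a`. -/
def symSigExtra {k n : ℕ} (X : Series) (i : Fin k) (a : Fin 2) (w : Fin (k - 1) → Fin 2)
    (l : Fin k → Fin (n + 1)) : ℝ :=
  blockSum X (fun j m => evenCount l j m + if j = i ∧ m = a then 1 else 0) w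

/-! ### The reconstruction procedure -/

/-- Step 1 (unsigned directions): for each block `j`, the indices with `|ℓ_j / n - ρ_j| < θ` carry
more than half of the total mass of the symmetrized signatures. -/
def IsDirections {k : ℕ} (X : Series) (n : ℕ) (θ : ℝ) (ρ : Fin k → ℝ) : Prop :=
  ∀ j, ρ j ∈ Icc (0 : ℝ) 1 ∧
    1 / 2 < (∑ w : Fin (k - 1) → Fin 2, ∑ l : Fin k → Fin (n + 1) with
          |((l j : ℕ) : ℝ) / (n : ℝ) - ρ j| < θ, |symSig X w l|) /
        (∑ w : Fin (k - 1) → Fin 2, ∑ l : Fin k → Fin (n + 1), |symSig X w l|)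

/-- The word of separating letters chosen from the directions. -/
def chosenWord {k : ℕ} (ρ : Fin k → ℝ) : Fin (k - 1) → Fin 2 := fun j =>
  if 1 / 2 ≤ ρ ⟨j, lt_of_lt_of_le j.isLt (Nat.sub_le k 1)⟩ then 0 else 1

/-- Step 2 (signs): the sign of coordinate `a` of piece `i`. A vanishing denominator gives `1`. -/
def sgn {k : ℕ} (X : Series) (n : ℕ) (ρ : Fin k → ℝ) (i : Fin k) (a : Fin 2) : ℝ :=
  if 0 ≤ (∑ l : Fin k → Fin (n + 1), symSig X (chosenWord ρ) l) /
      (∑ l : Fin k → Fin (n + 1), symSigExtra X i a (chosenWord ρ) l) then 1 else -1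

/-- The signed direction `(a_x ρ_j, a_y (1 - ρ_j))` of piece `j`. -/
def direction {k : ℕ} (X : Series) (n : ℕ) (ρ : Fin k → ℝ) (j : Fin k) : Plane :=
  WithLp.toLp 1 ![sgn X n ρ j 0 * ρ j, sgn X n ρ j 1 * (1 - ρ j)]

/-- Step 3 (length), for a series with nonzero first level. -/
def scaledLength {k : ℕ} (X : Series) (n : ℕ) (ρ : Fin k → ℝ) : ℝ :=
  levelOneNorm X /
    ((|∑ j, sgn X n ρ j 0 * ρ j| + |∑ j, sgn X n ρ j 1 * (1 - ρ j)|) / (k : ℝ))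

/-- The series `X ⊗ exp(β)`, where `β` is the signed direction of the last piece, a segment of
length one. (The value for `k = 0` is irrelevant.) -/
def extended {k : ℕ} (X : Series) (n : ℕ) (ρ : Fin k → ℝ) : Series :=
  if h : 0 < k then
    tensorMul X (tensorExp (direction X n ρ ⟨k - 1, Nat.sub_lt h Nat.one_pos⟩))
  else X

/-- The lengths produced by the procedure. If the first level of `X` vanishes, a segment of length
one is appended, the procedure is run again on the extended series, and the length of the segment
is removed again. -/
def IsLength {k : ℕ} (X : Series) (n : ℕ) (θ : ℝ) (ρ : Fin k → ℝ) (Lt : ℝ) : Prop :=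
  (levelOneNorm X ≠ 0 ∧ Lt = scaledLength X n ρ) ∨
  (levelOneNorm X = 0 ∧ ∃ ρ' : Fin k → ℝ, IsDirections (extended X n ρ) n θ ρ' ∧
    Lt = scaledLength (extended X n ρ) n ρ' - 1)

/-- The procedure, run on `X` with `k` blocks of half-length `n` and tolerance `θ`, may return the
directions `ρ` (with the signs `sgn X n ρ`) and the length `Lt`. -/
def IsReconstruction {k : ℕ} (X : Series) (n : ℕ) (θ : ℝ) (ρ : Fin k → ℝ) (Lt : ℝ) : Prop :=
  IsDirections X n θ ρ ∧ IsLength X n θ ρ Lt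

/-! ### The reconstructed path -/

/-- The time interval of piece `j` (pieces are numbered from `0`). -/
def piece {k : ℕ} (j : Fin k) : Set ℝ :=
  Icc (((j : ℕ) : ℝ) / (k : ℝ)) ((((j : ℕ) : ℝ) + 1) / (k : ℝ))

/-- The continuous piecewise linear path on `[0,1]` that starts at `p` and has velocity `v j` on
piece `j`; that is, the concatenation of the segments `(1 / k) v j`. -/
def polygonal {k : ℕ} (p : Plane) (v : Fin k → Plane) (u : ℝ) : Plane :=
  p + ∑ j : Fin k, (max 0 (min (u - ((j : ℕ) : ℝ) / (k : ℝ)) (1 / (k : ℝ)))) • v j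

end

end SigInv

open SigInv

/-! Summing the signature over all orderings inside the blocks turns iterated integrals into powers.
Let t_1 < … < t_{k-1} be the times of the separating letters and Δ_j the increment of the path
between consecutive ones. Then S(w, ℓ) is the integral over the simplex of the product of the
velocity coordinates chosen by w at the t_j, times the product over j of (Δ_j^x)^{2ℓ_j}
(Δ_j^y)^{2n-2ℓ_j} / ((2ℓ_j)! (2n-2ℓ_j)!) (`blockSum_iterInt`). The exponents are even, so the block
factors are nonnegative and only the separators carry signs. Summed over ℓ, the block factors are
even binomial sums. They equal ∏ |Δ_j|^{2n} / (2n)! up to a factor 2 per block, and ℓ_j / n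
concentrates at |Δ_j^x| / |Δ_j| (`le_sum_mon`, `sum_tail_mon_le`).

Next, the times concentrate at the uniform grid. Since |Δ_j| is at most L times the time gap, the
weight is bounded by a power of the product of the gaps, which is largest for equal gaps. By AM-GM
and Pinsker's inequality, a knot displaced by ε costs exp(-4nkε²) (`prod_steps_le`). In a box of
radius k^{-3} around the grid the loss is only exp(-8n/k - 4n ∑ x_j), where x_j bounds the relative
oscillation of the velocity on block j. So the weight off the window of radius ε is negligible once
kε² ≥ ∑ x_j + 1 (`window_grid`), and ε_k is defined to ensure this. On the window the velocity seen
by a block varies by at most η_k.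

There is also no cancellation on the window. If each separator selects a coordinate of the velocity
that is not small, its sign is constant there and its size at least L/8. The symmetrized sums of
such a word are then bounded below by the full weight up to a factor 16^k. As n ≈ k² log k, the
weight off the window and the binomial tails at scale η_k beat this factor; the latter uses η_k ≥
c/√k, which holds unless the velocity is constant (`exists_le_eta`, `eventually_negligible`). Hence
more than half of the mass sits at indices with ℓ_j / n within O(η_k) of |γ̇^x| / L. Any ρ_j found
in step 1 also captures more than half of the mass, so the two index sets meet
(`exists_common_index`).

An additional letter a in block i contributes the factor Δ_i^a up to a positive denominator, so the
quotient in step 2 has the sign of Δ_i^a. If that coordinate of the velocity is O(η_k), the sign may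
be wrong but is then harmless (`Regime.direction_close`). The length follows by comparing the
average direction with the total displacement (`abs_scaledLength_sub_le`). For a closed path, the
appended segment leaves γ with a jump of only O(η_k), felt by a bounded number of blocks, so the
same estimates hold for the extended path (`window_extField`). If the velocity is constant, the
tolerance is zero, step 1 has no solution, and the accuracy claim is vacuous. -/

namespace SigInv

noncomputable section

section

/-! ### Integration over simplices -/

/-- The open simplex `s < u_0 < ⋯ < u_{m-1} < T`. -/
def simplex (m : ℕ) (s T : ℝ) : Set (Fin m → ℝ) :=
  {u | StrictMono u ∧ ∀ i, u i ∈ Ioo s T}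

theorem measurableSet_simplex (m : ℕ) (s T : ℝ) : MeasurableSet (simplex m s T) := by
  have h : simplex m s T =
      (⋂ i, ⋂ j, ⋂ (_ : i < j), {u : Fin m → ℝ | u i < u j}) ∩ ⋂ i, {u | u i ∈ Ioo s T} := by
    ext u
    simp [simplex, StrictMono]
  rw [h]
  refine MeasurableSet.inter ?_ ?_
  · exact MeasurableSet.iInter fun i => MeasurableSet.iInter fun j => MeasurableSet.iInter fun _ =>
      measurableSet_lt (measurable_pi_apply i) (measurable_pi_apply j)
  · exact MeasurableSet.iInter fun i => measurable_pi_apply i measurableSet_Ioo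

theorem simplex_subset_Icc (m : ℕ) (s T : ℝ) :
    simplex m s T ⊆ Icc (fun _ => s) (fun _ => T) :=
  fun _ hu => ⟨fun i => (hu.2 i).1.le, fun i => (hu.2 i).2.le⟩

theorem volume_simplex_lt_top (m : ℕ) (s T : ℝ) : volume (simplex m s T) < ⊤ :=
  (measure_mono (simplex_subset_Icc m s T)).trans_lt isCompact_Icc.measure_lt_top

theorem volume_real_simplex_le (m : ℕ) {T : ℝ} (hT : 0 ≤ T) :
    volume.real (simplex m 0 T) ≤ T ^ m := by
  refine (measureReal_mono (simplex_subset_Icc m 0 T) isCompact_Icc.measure_lt_top.ne).trans ?_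
  rw [Measure.real, Real.volume_Icc_pi, ENNReal.toReal_prod]
  simp [ENNReal.toReal_ofReal hT]

theorem integrableOn_simplex {m : ℕ} {s T : ℝ} {F : (Fin m → ℝ) → ℝ} {C : ℝ}
    (hF : Measurable F) (hC : ∀ u ∈ simplex m s T, |F u| ≤ C) :
    IntegrableOn F (simplex m s T) := by
  refine Measure.integrableOn_of_bounded (M := C) (volume_simplex_lt_top m s T).ne
    hF.aestronglyMeasurable ?_
  filter_upwards [ae_restrict_mem (measurableSet_simplex m s T)] with u hu
  exact hC u hu

theorem cons_mem_simplex {m : ℕ} {s T t : ℝ} {u : Fin m → ℝ} :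
    (Fin.cons t u : Fin (m + 1) → ℝ) ∈ simplex (m + 1) s T ↔
      t ∈ Ioo s T ∧ u ∈ simplex m t T := by
  constructor
  · rintro ⟨h1, h2⟩
    refine ⟨by simpa using h2 0, ?_, ?_⟩
    · intro i j hij
      simpa using h1 (Fin.succ_lt_succ_iff.2 hij)
    · intro i
      refine ⟨by simpa using h1 (Fin.succ_pos i), by simpa using (h2 i.succ).2⟩
  · rintro ⟨ht, h1, h2⟩
    refine ⟨?_, ?_⟩
    · intro i j hij
      induction j using Fin.cases with
      | zero => exact absurd hij (Fin.not_lt_zero i)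
      | succ j =>
        induction i using Fin.cases with
        | zero => simpa using (h2 j).1
        | succ i => simpa using h1 (Fin.succ_lt_succ_iff.1 hij)
    · intro i
      induction i using Fin.cases with
      | zero => simpa using ht
      | succ i => simpa using ⟨ht.1.trans (h2 i).1, (h2 i).2⟩

/-- Fubini with the smallest time split off. It matches the recursion that defines `iterInt`, where
the first letter carries the earliest time. -/
theorem setIntegral_simplex_succ {m : ℕ} {s T : ℝ} {F : (Fin (m + 1) → ℝ) → ℝ}
    (hF : IntegrableOn F (simplex (m + 1) s T)) :
    ∫ u in simplex (m + 1) s T, F u =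
      ∫ t in Ioo s T, ∫ u in simplex m t T, F (Fin.cons t u) := by
  have hmp := (volume_preserving_piFinSuccAbove (fun _ : Fin (m + 1) => ℝ) 0).symm
  set e := (MeasurableEquiv.piFinSuccAbove (fun _ : Fin (m + 1) => ℝ) 0).symm with he
  have hecons : ∀ p : ℝ × (Fin m → ℝ), e p = Fin.cons p.1 p.2 := by
    intro p
    simp only [he, MeasurableEquiv.piFinSuccAbove_symm_apply]
    exact Fin.insertNth_zero' p.1 p.2
  rw [← integral_indicator (measurableSet_simplex _ _ _)]
  have hint := (integrable_indicator_iff (measurableSet_simplex (m + 1) s T)).2 hF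
  rw [← hmp.integral_comp' (g := (simplex (m + 1) s T).indicator F)]
  rw [← hmp.integrable_comp_emb e.measurableEmbedding] at hint
  rw [Measure.volume_eq_prod, integral_prod (fun x => (simplex (m + 1) s T).indicator F (e x)) hint,
    ← integral_indicator measurableSet_Ioo]
  congr 1
  ext t
  by_cases ht : t ∈ Ioo s T
  · rw [indicator_of_mem ht, ← integral_indicator (measurableSet_simplex _ _ _)]
    congr 1
    ext u
    by_cases hu : u ∈ simplex m t T
    · rw [indicator_of_mem hu, hecons, indicator_of_mem (cons_mem_simplex.2 ⟨ht, hu⟩)]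
    · rw [indicator_of_notMem hu, hecons, indicator_of_notMem]
      exact fun h => hu (cons_mem_simplex.1 h).2
  · rw [indicator_of_notMem ht]
    refine integral_eq_zero_of_ae (Eventually.of_forall fun u => ?_)
    simp only [hecons, Pi.zero_apply]
    exact indicator_of_notMem (fun h => ht (cons_mem_simplex.1 h).1) _

theorem simplex_zero (s T : ℝ) : simplex 0 s T = univ := by
  ext u
  simp [simplex, Subsingleton.strictMono]

theorem setIntegral_simplex_zero (s T : ℝ) (F : (Fin 0 → ℝ) → ℝ) :
    ∫ u in simplex 0 s T, F u = F Fin.elim0 := by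
  rw [simplex_zero, setIntegral_univ, integral_unique]
  simp only [Measure.real, volume_pi, Measure.pi_univ, Finset.univ_eq_empty, Finset.prod_empty,
    ENNReal.toReal_one, one_smul]
  exact congrArg F (Subsingleton.elim _ _)

end

section

/-! ### Paths of constant speed and their iterated integrals -/

theorem plane_norm (p : Plane) : ‖p‖ = |p 0| + |p 1| := by
  rw [PiLp.norm_eq_of_nat 1 (by simp)]
  simp [Fin.sum_univ_two]

theorem abs_coord_le (p : Plane) (a : Fin 2) : |p a| ≤ ‖p‖ := by
  rw [plane_norm]
  fin_cases a
  · simp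
  · simp

/-- A velocity field of constant speed `Λ`, continuous away from a countable set. -/
structure ConstSpeed (v : ℝ → Plane) (Λ : ℝ) : Prop where
  meas : ∀ a, Measurable fun u => v u a
  cont : ∃ S : Set ℝ, S.Countable ∧ ∀ u ∉ S, ContinuousAt v u
  speed : ∀ u, ‖v u‖ = Λ
  pos : 0 < Λ

/-- The iterated integral along a word over `s < u_1 < ⋯ < T`. -/
def iterInt (v : ℝ → Plane) (T : ℝ) : Word → ℝ → ℝ
  | [], _ => 1
  | a :: w, s => ∫ u in Ioo s T, v u a * iterInt v T w u

variable {v : ℝ → Plane} {Λ : ℝ}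

theorem ConstSpeed.abs_le (hv : ConstSpeed v Λ) (u : ℝ) (a : Fin 2) : |v u a| ≤ Λ :=
  (abs_coord_le _ _).trans (hv.speed u).le

theorem ConstSpeed.intervalIntegrable (hv : ConstSpeed v Λ) (a : Fin 2) (s t : ℝ) :
    IntervalIntegrable (fun u => v u a) volume s t := by
  refine (intervalIntegrable_const (c := Λ)).mono_fun (hv.meas a).aestronglyMeasurable ?_
  refine Eventually.of_forall fun u => ?_
  simpa [abs_of_pos hv.pos] using hv.abs_le u a

theorem continuous_setIntegral_Ioo {f : ℝ → ℝ} (hf : ∀ s t, IntervalIntegrable f volume s t)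
    (T : ℝ) : Continuous fun s => ∫ u in Ioo s T, f u := by
  have h : (fun s => ∫ u in Ioo s T, f u) = fun s => ∫ u in (min s T)..T, f u := by
    ext s
    rw [intervalIntegral.integral_of_le (min_le_right s T), integral_Ioc_eq_integral_Ioo]
    rcases le_total s T with h | h
    · rw [min_eq_left h]
    · rw [min_eq_right h, Ioo_eq_empty (not_lt.2 h), Ioo_self]
  rw [h]
  have h2 : (fun s => ∫ u in (min s T)..T, f u) = fun s => -∫ u in T..(min s T), f u := by
    ext s
    rw [intervalIntegral.integral_symm]
  rw [h2]
  exact ((intervalIntegral.continuous_primitive hf T).comp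
    (continuous_id.min continuous_const)).neg

theorem ConstSpeed.intervalIntegrable_mul (hv : ConstSpeed v Λ) (a : Fin 2) {f : ℝ → ℝ}
    (hf : Continuous f) (s t : ℝ) : IntervalIntegrable (fun u => v u a * f u) volume s t :=
  (hv.intervalIntegrable a s t).mul_continuousOn hf.continuousOn

theorem continuous_iterInt (hv : ConstSpeed v Λ) (T : ℝ) (w : Word) :
    Continuous (iterInt v T w) := by
  induction w with
  | nil => exact continuous_const
  | cons a w ih => exact continuous_setIntegral_Ioo (fun s t => hv.intervalIntegrable_mul a ih s t) T

theorem iterInt_eq_setIntegral (hv : ConstSpeed v Λ) (T : ℝ) (w : Word) (s : ℝ) :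
    iterInt v T w s = ∫ u in simplex w.length s T, ∏ i, v (u i) (w.get i) := by
  induction w generalizing s with
  | nil => exact ((setIntegral_simplex_zero s T _).trans (by simp [iterInt])).symm
  | cons a w ih =>
    have hint : IntegrableOn (fun u : Fin (w.length + 1) → ℝ => ∏ i, v (u i) ((a :: w).get i))
        (simplex (w.length + 1) s T) := by
      refine integrableOn_simplex (C := ∏ _i : Fin (w.length + 1), Λ) ?_ ?_
      · exact Finset.measurable_prod _ fun i _ => (hv.meas _).comp (measurable_pi_apply i)
      · intro u _
        rw [Finset.abs_prod]
        exact Finset.prod_le_prod (fun _ _ => abs_nonneg _) fun i _ => hv.abs_le _ _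
    refine Eq.trans ?_ (setIntegral_simplex_succ hint).symm
    simp only [iterInt]
    refine setIntegral_congr_fun measurableSet_Ioo fun t _ => ?_
    simp only [Fin.prod_univ_succ, Fin.cons_zero, Fin.cons_succ, List.get_cons_zero,
      List.get_cons_succ', integral_const_mul, ih]

theorem iterInt_congr {v v' : ℝ → Plane} {T s : ℝ} (h : ∀ u ∈ Ioo s T, v u = v' u) (w : Word) :
    iterInt v T w s = iterInt v' T w s := by
  induction w generalizing s with
  | nil => rfl
  | cons a w ih =>
    simp only [iterInt]
    refine setIntegral_congr_fun measurableSet_Ioo fun t ht => ?_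
    rw [h t ht, ih fun u hu => h u ⟨ht.1.trans hu.1, hu.2⟩]

/-- Chen's identity. -/
theorem iterInt_chen (hv : ConstSpeed v Λ) {s r T : ℝ} (hsr : s ≤ r) (hrT : r ≤ T) (w : Word) :
    iterInt v T w s = ∑ i ∈ Finset.range (w.length + 1),
      iterInt v r (w.take i) s * iterInt v T (w.drop i) r := by
  induction w generalizing s with
  | nil => simp [iterInt]
  | cons a w ih =>
    have hI : ∀ s t, IntervalIntegrable (fun u => v u a * iterInt v T w u) volume s t :=
      fun s t => hv.intervalIntegrable_mul a (continuous_iterInt hv T w) s t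
    have e1 : ∀ {s t : ℝ}, s ≤ t → ∀ f : ℝ → ℝ, ∫ u in Ioo s t, f u = ∫ u in s..t, f u := by
      intro s t hst f
      rw [intervalIntegral.integral_of_le hst, integral_Ioc_eq_integral_Ioo]
    rw [List.length_cons, Finset.sum_range_succ']
    simp only [List.take_succ_cons, List.drop_succ_cons, List.take_zero, List.drop_zero]
    have hsplit : iterInt v T (a :: w) s =
        (∫ u in Ioo s r, v u a * iterInt v T w u) + iterInt v T (a :: w) r := by
      simp only [iterInt]
      rw [e1 (hsr.trans hrT), e1 hsr, e1 hrT,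
        intervalIntegral.integral_add_adjacent_intervals (hI _ _) (hI _ _)]
    rw [hsplit]
    have : ∫ u in Ioo s r, v u a * iterInt v T w u =
        ∑ i ∈ Finset.range (w.length + 1),
          iterInt v r (a :: w.take i) s * iterInt v T (w.drop i) r := by
      simp only [iterInt]
      simp_rw [← integral_mul_const]
      rw [← integral_finsetSum]
      · refine setIntegral_congr_fun measurableSet_Ioo fun t ht => ?_
        rw [ih ht.2.le, Finset.mul_sum]
        exact Finset.sum_congr rfl fun i _ => by ring
      · intro i _
        have := (hv.intervalIntegrable_mul a (continuous_iterInt hv r (w.take i)) s r).mul_const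
          (iterInt v T (w.drop i) r)
        exact ((intervalIntegrable_iff_integrableOn_Ioo_of_le hsr).1 this)
    rw [this]
    simp [iterInt]

/-- For a constant velocity only the volume of the simplex, (T - s)^m / m!, remains. This is what
turns an appended segment into a tensor exponential. -/
theorem iterInt_const {b : Plane} {T s : ℝ} (hs : s ≤ T) (hv : ∀ u ∈ Ioo s T, v u = b)
    (w : Word) : iterInt v T w s =
      (w.map fun i => b i).prod * ((T - s) ^ w.length / (w.length.factorial : ℝ)) := by
  induction w generalizing s with
  | nil => simp [iterInt]
  | cons a w ih =>
    simp only [iterInt, List.map_cons, List.prod_cons, List.length_cons]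
    have h1 : ∫ u in Ioo s T, v u a * iterInt v T w u =
        ∫ u in s..T, (b a * (w.map fun i => b i).prod / (w.length.factorial : ℝ)) *
          (T - u) ^ w.length := by
      rw [intervalIntegral.integral_of_le hs, integral_Ioc_eq_integral_Ioo]
      refine setIntegral_congr_fun measurableSet_Ioo fun t ht => ?_
      simp only
      rw [hv t ht, ih ht.2.le fun u hu => hv u ⟨ht.1.trans hu.1, hu.2⟩]
      ring
    rw [h1, intervalIntegral.integral_const_mul,
      intervalIntegral.integral_comp_sub_left (fun x => x ^ w.length), integral_pow]
    rw [Nat.factorial_succ]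
    have : (w.length.factorial : ℝ) ≠ 0 := by positivity
    push_cast
    field_simp
    simp

end

section

/-! ### Sums over block words -/

theorem assemble_one (b : Fin 1 → Word) (e : Fin (1 - 1) → Fin 2) : assemble b e = b 0 := by
  simp [assemble]

theorem assemble_succ {m : ℕ} (b : Fin (m + 2) → Word) (e : Fin (m + 1) → Fin 2) :
    assemble (k := m + 2) b e =
      b 0 ++ e 0 :: assemble (k := m + 1) (fun j => b j.succ) (fun j : Fin m => e j.succ) := by
  unfold assemble
  rw [List.ofFn_succ, List.flatten_cons]
  simp only [Fin.val_zero, Nat.add_one_sub_one, Nat.zero_lt_succ, List.append_assoc,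
    Fin.val_succ, Nat.add_lt_add_iff_right]
  rfl

/-- Remove one letter `a` from the first block. -/
def decHead {m : ℕ} (c : Fin (m + 1) → Fin 2 → ℕ) (a : Fin 2) : Fin (m + 1) → Fin 2 → ℕ :=
  Fin.cons (Function.update (c 0) a (c 0 a - 1)) fun j => c j.succ

theorem assemble_cons_head {m : ℕ} (b : Fin (m + 1) → Word) (e : Fin m → Fin 2) (a : Fin 2) :
    assemble (k := m + 1) (Fin.cons (a :: b 0) fun j => b j.succ) e =
      a :: assemble (k := m + 1) b e := by
  cases m with
  | zero => simp [assemble_one]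
  | succ m => simp [assemble_succ]

theorem eq_nil_of_count {l : Word} (h : ∀ i, l.count i = 0) : l = [] :=
  List.eq_nil_iff_forall_not_mem.2 fun i => List.count_eq_zero.1 (h i)

theorem blockWords_one_of_zero {c : Fin 1 → Fin 2 → ℕ} (h : c 0 = 0) (e : Fin 0 → Fin 2) :
    blockWords (k := 1) c e = {[]} := by
  ext w
  constructor
  · rintro ⟨b, hb, rfl⟩
    rw [assemble_one, mem_singleton_iff]
    exact eq_nil_of_count fun i => by rw [hb, h, Pi.zero_apply]
  · rintro rfl
    refine ⟨fun _ => [], fun j i => ?_, by simp [assemble_one]⟩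
    rw [Subsingleton.elim j 0, h]
    rfl

theorem blockWords_succ_of_zero {m : ℕ} {c : Fin (m + 2) → Fin 2 → ℕ} (h : c 0 = 0)
    (e : Fin (m + 1) → Fin 2) :
    blockWords (k := m + 2) c e = List.cons (e 0) ''
      blockWords (k := m + 1) (fun j => c j.succ) (fun j : Fin m => e j.succ) := by
  ext w
  constructor
  · rintro ⟨b, hb, rfl⟩
    refine ⟨_, ⟨fun j => b j.succ, fun j i => hb _ _, rfl⟩, ?_⟩
    rw [assemble_succ, eq_nil_of_count (l := b 0) fun i => by rw [hb, h, Pi.zero_apply],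
      List.nil_append]
  · rintro ⟨_, ⟨b, hb, rfl⟩, rfl⟩
    refine ⟨Fin.cons [] b, fun j i => ?_, ?_⟩
    · induction j using Fin.cases with
      | zero => simp [h]
      | succ j => simp [hb]
    · rw [assemble_succ]
      simp

theorem blockWords_of_ne_zero {m : ℕ} {c : Fin (m + 1) → Fin 2 → ℕ} (h : c 0 ≠ 0)
    (e : Fin m → Fin 2) :
    blockWords (k := m + 1) c e =
      ⋃ a ∈ {a | 0 < c 0 a}, List.cons a '' blockWords (k := m + 1) (decHead c a) e := by
  ext w
  simp only [mem_iUnion, mem_ofPred_eq, exists_prop]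
  constructor
  · rintro ⟨b, hb, rfl⟩
    cases hb0 : b 0 with
    | nil =>
      refine absurd ?_ h
      ext i
      rw [← hb, hb0]
      rfl
    | cons a l =>
      refine ⟨a, ?_, _, ⟨Fin.cons l fun j => b j.succ, fun j i => ?_, rfl⟩, ?_⟩
      · rw [← hb, hb0]
        simp
      · induction j using Fin.cases with
        | zero =>
          have := hb 0 i
          rw [hb0, List.count_cons] at this
          by_cases hi : i = a
          · subst hi
            simp [decHead] at this ⊢
            omega
          · simp [decHead, hi, Ne.symm hi] at this ⊢
            omega
        | succ j => simp [decHead, hb]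
      · rw [← assemble_cons_head]
        congr 1
        ext1 j
        induction j using Fin.cases with
        | zero => simp [hb0]
        | succ j => simp
  · rintro ⟨a, ha, _, ⟨b, hb, rfl⟩, rfl⟩
    refine ⟨Fin.cons (a :: b 0) fun j => b j.succ, fun j i => ?_, (assemble_cons_head b e a).symm⟩
    induction j using Fin.cases with
    | zero =>
      have := hb 0 i
      by_cases hi : i = a
      · subst hi
        simp [decHead] at this ⊢
        omega
      · simp [decHead, hi, Ne.symm hi] at this ⊢
        omega
    | succ j => simpa [decHead] using hb j.succ i

/-- Sorting the words by their first letter gives a recursion on the size of the first block. It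
works with the set of words itself, so uniqueness of the decomposition into blocks is never needed:
words with different first letters are distinct, and prepending a letter is injective. -/
theorem blockSum_of_ne_zero {m : ℕ} {c : Fin (m + 1) → Fin 2 → ℕ} (h : c 0 ≠ 0)
    (e : Fin m → Fin 2) (X : Series) :
    blockSum (k := m + 1) X c e = ∑ a, if 0 < c 0 a then
      blockSum (k := m + 1) (fun w => X (a :: w)) (decHead c a) e else 0 := by
  unfold blockSum
  rw [blockWords_of_ne_zero h, finsum_mem_biUnion]
  · have hS : (∑ᶠ a ∈ {a | 0 < c 0 a}, ∑ᶠ w ∈ List.cons a ''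
        blockWords (k := m + 1) (decHead c a) e, X w) = ∑ᶠ a, if 0 < c 0 a then
        ∑ᶠ w ∈ blockWords (k := m + 1) (decHead c a) e, X (a :: w) else 0 := by
      refine finsum_congr fun a => ?_
      by_cases ha : 0 < c 0 a
      · simp only [mem_ofPred_eq, ha, finsum_true, if_true]
        exact finsum_mem_image (List.cons_injective.injOn)
      · simp [ha]
    rw [hS, finsum_eq_sum_of_fintype]
  · intro a _ b _ hab
    refine Set.disjoint_left.2 ?_
    rintro _ ⟨w, _, rfl⟩ ⟨w', _, h'⟩
    exact hab (List.cons.inj h').1.symm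
  · exact Set.toFinite _
  · exact fun a _ => (blockWords_finite _ _).image _

theorem blockSum_one_of_zero {c : Fin 1 → Fin 2 → ℕ} (h : c 0 = 0) (e : Fin 0 → Fin 2)
    (X : Series) : blockSum (k := 1) X c e = X [] := by
  rw [blockSum, blockWords_one_of_zero h, finsum_mem_singleton]

theorem blockSum_succ_of_zero {m : ℕ} {c : Fin (m + 2) → Fin 2 → ℕ} (h : c 0 = 0)
    (e : Fin (m + 1) → Fin 2) (X : Series) :
    blockSum (k := m + 2) X c e = blockSum (k := m + 1) (fun w => X (e 0 :: w))
      (fun j => c j.succ) (fun j : Fin m => e j.succ) := by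
  rw [blockSum, blockWords_succ_of_zero h, finsum_mem_image (List.cons_injective.injOn)]
  rfl

variable {v : ℝ → Plane} {Λ : ℝ}

theorem continuous_blockSum_iterInt (hv : ConstSpeed v Λ) (T : ℝ) {k : ℕ}
    (c : Fin k → Fin 2 → ℕ) (e : Fin (k - 1) → Fin 2) :
    Continuous fun s => blockSum (fun w => iterInt v T w s) c e := by
  simp only [blockSum, finsum_mem_eq_finite_toFinset_sum _ (blockWords_finite c e)]
  exact continuous_finsetSum _ fun w _ => continuous_iterInt hv T w

theorem blockSum_iterInt_cons (hv : ConstSpeed v Λ) (T s : ℝ) (a : Fin 2) {k : ℕ}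
    (c : Fin k → Fin 2 → ℕ) (e : Fin (k - 1) → Fin 2) :
    blockSum (fun w => iterInt v T (a :: w) s) c e =
      ∫ u in Ioo s T, v u a * blockSum (fun w => iterInt v T w u) c e := by
  simp only [blockSum, finsum_mem_eq_finite_toFinset_sum _ (blockWords_finite c e), iterInt,
    Finset.mul_sum]
  rw [integral_finsetSum]
  intro w _
  rcases le_total s T with hs | hs
  · exact (intervalIntegrable_iff_integrableOn_Ioo_of_le hs).1
      (hv.intervalIntegrable_mul a (continuous_iterInt hv T w) s T)
  · rw [Ioo_eq_empty (not_lt.2 hs)]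
    simp

/-! ### The integral formula for symmetrized signatures -/

/-- The displacement over `[s, t]`. -/
def disp (v : ℝ → Plane) (s t : ℝ) (a : Fin 2) : ℝ := ∫ u in s..t, v u a

/-- The monomial `d_0 ^ c_0 / c_0! * d_1 ^ c_1 / c_1!`. -/
def mon (c : Fin 2 → ℕ) (d : Fin 2 → ℝ) : ℝ :=
  d 0 ^ c 0 / (c 0).factorial * (d 1 ^ c 1 / (c 1).factorial)

theorem disp_eq (hv : ConstSpeed v Λ) (s t : ℝ) (a : Fin 2) :
    disp v s t a = (∫ u in (0 : ℝ)..t, v u a) - ∫ u in (0 : ℝ)..s, v u a :=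
  (intervalIntegral.integral_interval_sub_left (hv.intervalIntegrable a _ _)
    (hv.intervalIntegrable a _ _)).symm

theorem continuous_disp (hv : ConstSpeed v Λ) (a : Fin 2) :
    Continuous fun p : ℝ × ℝ => disp v p.1 p.2 a := by
  simp only [disp_eq hv]
  have h := intervalIntegral.continuous_primitive (fun s t => hv.intervalIntegrable a s t) 0
  exact (h.comp continuous_snd).sub (h.comp continuous_fst)

theorem continuous_mon_disp (hv : ConstSpeed v Λ) (c : Fin 2 → ℕ) :
    Continuous fun p : ℝ × ℝ => mon c (disp v p.1 p.2) := by
  unfold mon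
  have := continuous_disp hv
  have h0 := this 0
  have h1 := this 1
  fun_prop

theorem hasDerivAt_pow_div_factorial {f : ℝ → ℝ} {f' x : ℝ} (hf : HasDerivAt f f' x) (p : ℕ) :
    HasDerivAt (fun u => f u ^ p / (p.factorial : ℝ))
      (if 0 < p then f x ^ (p - 1) / ((p - 1).factorial : ℝ) * f' else 0) x := by
  cases p with
  | zero => simpa using hasDerivAt_const x (1 : ℝ)
  | succ p =>
    refine ((hf.pow (p + 1)).div_const ((p + 1).factorial : ℝ)).congr_deriv ?_
    rw [if_pos p.succ_pos, Nat.add_sub_cancel, Nat.factorial_succ, Nat.cast_mul]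
    have : (p.factorial : ℝ) ≠ 0 := by positivity
    field_simp

/-- Fundamental theorem of calculus in the left end point: differentiating lowers one exponent and
produces a factor -v^a. Block sums satisfy the same recursion, which is how a sum over all orderings
of a block becomes a product of powers. -/
theorem mon_disp_eq (hv : ConstSpeed v Λ) {c : Fin 2 → ℕ} (hc : c ≠ 0) {s t : ℝ} (hst : s ≤ t) :
    mon c (disp v s t) = ∑ a, if 0 < c a then
      ∫ u in Ioo s t, v u a * mon (Function.update c a (c a - 1)) (disp v u t) else 0 := by
  obtain ⟨S, hS, hcont⟩ := hv.cont
  have hI : ∀ (a : Fin 2) (c' : Fin 2 → ℕ),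
      IntervalIntegrable (fun u => v u a * mon c' (disp v u t)) volume s t := fun a c' =>
    hv.intervalIntegrable_mul a ((continuous_mon_disp hv c').comp
      (continuous_id.prodMk continuous_const)) s t
  set g : ℝ → ℝ := fun u => -∑ a, if 0 < c a then
      v u a * mon (Function.update c a (c a - 1)) (disp v u t) else 0 with hg
  have hgI : IntervalIntegrable g volume s t := by
    refine IntervalIntegrable.neg ?_
    simp only [Fin.sum_univ_two]
    refine IntervalIntegrable.add ?_ ?_
    · split_ifs
      · exact hI _ _
      · simp
    · split_ifs
      · exact hI _ _
      · simp
  have hder : ∀ u ∉ S, HasDerivAt (fun u => mon c (disp v u t)) (g u) u := by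
    intro u hu
    have hd : ∀ a, HasDerivAt (fun u => disp v u t a) (-(v u a)) u := by
      intro a
      have hca : ContinuousAt (fun u => v u a) u :=
        ((PiLp.continuous_apply 1 _ a).continuousAt).comp (hcont u hu)
      exact intervalIntegral.integral_hasDerivAt_left (hv.intervalIntegrable a u t)
        (hv.meas a).stronglyMeasurable.stronglyMeasurableAtFilter hca
    have := (hasDerivAt_pow_div_factorial (hd 0) (c 0)).mul
      (hasDerivAt_pow_div_factorial (hd 1) (c 1))
    refine this.congr_deriv ?_
    simp only [hg, Fin.sum_univ_two, mon]
    split_ifs <;> simp <;> ring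
  have hftc := integral_eq_of_hasDerivAt_off_countable_of_le
    (fun u => mon c (disp v u t)) g hst hS
    ((continuous_mon_disp hv c).comp (continuous_id.prodMk continuous_const)).continuousOn
    (fun u hu => hder u hu.2) hgI
  -- The boundary term is a monomial in the zero displacement; it vanishes because some exponent is
  -- positive.
  have hend : mon c (disp v t t) = 0 := by
    have h0 : disp v t t = 0 := by
      ext a
      simp [disp]
    rw [h0, mon]
    by_contra hne
    refine hc ?_
    ext a
    fin_cases a <;> simp_all
  simp only [hend, zero_sub] at hftc
  rw [← neg_eq_iff_eq_neg] at hftc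
  rw [← hftc, ← intervalIntegral.integral_neg]
  simp only [hg, neg_neg, Fin.sum_univ_two]
  rw [intervalIntegral.integral_add]
  · congr 1
    · split_ifs
      · rw [intervalIntegral.integral_of_le hst, integral_Ioc_eq_integral_Ioo]
      · simp
    · split_ifs
      · rw [intervalIntegral.integral_of_le hst, integral_Ioc_eq_integral_Ioo]
      · simp
  · split_ifs
    · exact hI _ _
    · simp
  · split_ifs
    · exact hI _ _
    · simp

/-- Fubini on the triangle s < u < t < T. It moves the separating time t outside the integral over
the first time u of the block; the integrability clause allows the two letters to be summed under
the integral. -/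
theorem setIntegral_triangle_swap (hv : ConstSpeed v Λ) (a b : Fin 2) {K : ℝ → ℝ → ℝ}
    (hK : Continuous (Function.uncurry K)) (s T : ℝ) :
    IntegrableOn (fun t => v t b * ∫ u in Ioo s t, v u a * K u t) (Ioo s T) ∧
    ∫ u in Ioo s T, v u a * ∫ t in Ioo u T, v t b * K u t =
      ∫ t in Ioo s T, v t b * ∫ u in Ioo s t, v u a * K u t := by
  set H : ℝ → ℝ → ℝ := fun u t =>
    {p : ℝ × ℝ | s < p.1 ∧ p.1 < p.2 ∧ p.2 < T}.indicator
      (fun p => v p.1 a * (v p.2 b * K p.1 p.2)) (u, t) with hH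
  have hmeasS : MeasurableSet {p : ℝ × ℝ | s < p.1 ∧ p.1 < p.2 ∧ p.2 < T} := by
    refine (measurableSet_lt measurable_const measurable_fst).inter
      ((measurableSet_lt measurable_fst measurable_snd).inter
        (measurableSet_lt measurable_snd measurable_const))
  have hint : Integrable (Function.uncurry H) (volume.prod volume) := by
    have : Function.uncurry H = {p : ℝ × ℝ | s < p.1 ∧ p.1 < p.2 ∧ p.2 < T}.indicator
      (fun p => v p.1 a * (v p.2 b * K p.1 p.2)) := rfl
    rw [this, integrable_indicator_iff hmeasS]
    have hsub : {p : ℝ × ℝ | s < p.1 ∧ p.1 < p.2 ∧ p.2 < T} ⊆ Icc s T ×ˢ Icc s T := by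
      rintro ⟨x, y⟩ ⟨h1, h2, h3⟩
      simp only at h1 h2 h3
      exact ⟨⟨h1.le, (h2.trans h3).le⟩, ⟨(h1.trans h2).le, h3.le⟩⟩
    have hcpt : IsCompact (Icc s T ×ˢ Icc s T) := isCompact_Icc.prod isCompact_Icc
    obtain ⟨C, hC⟩ := hcpt.exists_bound_of_continuousOn hK.continuousOn
    refine Measure.integrableOn_of_bounded (M := Λ * (Λ * C)) ?_ ?_ ?_
    · rw [← Measure.volume_eq_prod]
      exact ((measure_mono hsub).trans_lt hcpt.measure_lt_top).ne
    · refine Measurable.aestronglyMeasurable ?_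
      exact ((hv.meas a).comp measurable_fst).mul
        (((hv.meas b).comp measurable_snd).mul hK.measurable)
    · filter_upwards [ae_restrict_mem hmeasS] with p hp
      have := hC p (hsub hp)
      rw [norm_mul, norm_mul]
      refine mul_le_mul (hv.abs_le _ _) ?_ (by positivity) hv.pos.le
      exact mul_le_mul (hv.abs_le _ _) this (norm_nonneg _) hv.pos.le
  have h1 : ∫ u in Ioo s T, v u a * ∫ t in Ioo u T, v t b * K u t = ∫ u, ∫ t, H u t := by
    rw [← integral_indicator measurableSet_Ioo]
    congr 1
    ext u
    by_cases hu : u ∈ Ioo s T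
    · rw [indicator_of_mem hu, ← integral_const_mul, ← integral_indicator measurableSet_Ioo]
      congr 1
      ext t
      by_cases ht : t ∈ Ioo u T
      · rw [indicator_of_mem ht, hH]
        simp [hu.1, ht.1, ht.2]
      · rw [indicator_of_notMem ht, hH]
        refine (indicator_of_notMem ?_ _).symm
        exact fun h => ht h.2
    · rw [indicator_of_notMem hu]
      refine (integral_eq_zero_of_ae (Eventually.of_forall fun t => ?_)).symm
      exact indicator_of_notMem (fun h => hu ⟨h.1, h.2.1.trans h.2.2⟩) _
  have h2 : (Ioo s T).indicator (fun t => v t b * ∫ u in Ioo s t, v u a * K u t) =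
      fun t => ∫ u, H u t := by
    ext t
    by_cases ht : t ∈ Ioo s T
    · rw [indicator_of_mem ht, ← integral_const_mul, ← integral_indicator measurableSet_Ioo]
      congr 1
      ext u
      by_cases hu : u ∈ Ioo s t
      · rw [indicator_of_mem hu, hH]
        simp [hu.1, hu.2, ht.2]
        ring
      · rw [indicator_of_notMem hu, hH]
        refine (indicator_of_notMem ?_ _).symm
        exact fun h => hu ⟨h.1, h.2.1⟩
    · rw [indicator_of_notMem ht]
      refine (integral_eq_zero_of_ae (Eventually.of_forall fun u => ?_)).symm
      exact indicator_of_notMem (fun h => ht ⟨h.1.trans h.2.1, h.2.2⟩) _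
  constructor
  · rw [← integrable_indicator_iff measurableSet_Ioo, h2]
    exact hint.integral_prod_right
  · rw [h1, ← integral_indicator (f := fun t => v t b * ∫ u in Ioo s t, v u a * K u t)
      measurableSet_Ioo, h2]
    exact integral_integral_swap hint

end

/-! ### Block sums as integrals over the separating times -/

section

variable {v : ℝ → Plane} {Λ : ℝ}

theorem mon_zero (d : Fin 2 → ℝ) : mon 0 d = 1 := by
  simp [mon]

theorem decHead_zero {m : ℕ} (c : Fin (m + 1) → Fin 2 → ℕ) (a : Fin 2) :
    decHead c a 0 = Function.update (c 0) a (c 0 a - 1) := by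
  simp [decHead]

theorem decHead_count_lt {m : ℕ} {c : Fin (m + 1) → Fin 2 → ℕ} {a : Fin 2} (h : 0 < c 0 a) :
    decHead c a 0 0 + decHead c a 0 1 < c 0 0 + c 0 1 := by
  rw [decHead_zero]
  fin_cases a <;> simp at h ⊢ <;> omega

/-- Block sums and monomials obey the same recursion in the number of letters. With a single block
there is no separating time, and only the total displacement matters. -/
theorem blockSum_iterInt_one (hv : ConstSpeed v Λ) {T s : ℝ} (hs : s ≤ T)
    (c : Fin 1 → Fin 2 → ℕ) (e : Fin 0 → Fin 2) :
    blockSum (k := 1) (fun w => iterInt v T w s) c e = mon (c 0) (disp v s T) := by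
  induction hN : c 0 0 + c 0 1 using Nat.strong_induction_on generalizing c s with
  | _ N ih =>
    by_cases hc : c 0 = 0
    · rw [blockSum_one_of_zero hc, hc, mon_zero, iterInt]
    · rw [blockSum_of_ne_zero hc, mon_disp_eq hv hc hs]
      refine Finset.sum_congr rfl fun a _ => ?_
      by_cases ha : 0 < c 0 a
      · rw [if_pos ha, if_pos ha]
        refine (blockSum_iterInt_cons hv T s a (k := 1) (decHead c a) e).trans ?_
        refine setIntegral_congr_fun measurableSet_Ioo fun u hu => ?_
        simp only
        rw [ih _ (hN ▸ decHead_count_lt ha) hu.2.le _ rfl, decHead_zero]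
      · rw [if_neg ha, if_neg ha]

/-- Induction on the size of the first block: once it is empty, the next letter is the separator;
otherwise its first letter is peeled off and the order of integration exchanged. -/
theorem blockSum_iterInt_succ (hv : ConstSpeed v Λ) {T s : ℝ} {m : ℕ}
    (c : Fin (m + 2) → Fin 2 → ℕ) (e : Fin (m + 1) → Fin 2) :
    blockSum (k := m + 2) (fun w => iterInt v T w s) c e =
      ∫ t in Ioo s T, v t (e 0) * (mon (c 0) (disp v s t) *
        blockSum (k := m + 1) (fun w => iterInt v T w t) (fun j => c j.succ)
          (fun j : Fin m => e j.succ)) := by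
  induction hN : c 0 0 + c 0 1 using Nat.strong_induction_on generalizing c s with
  | _ N ih =>
    by_cases hc : c 0 = 0
    · rw [blockSum_succ_of_zero hc, hc]
      simp only [mon_zero, one_mul]
      exact blockSum_iterInt_cons hv T s (e 0) (k := m + 1) _ _
    · set R : ℝ → ℝ := fun t => blockSum (k := m + 1) (fun w => iterInt v T w t)
        (fun j => c j.succ) (fun j : Fin m => e j.succ) with hR
      have hRc : Continuous R := continuous_blockSum_iterInt hv T (k := m + 1) _ _
      have hK : ∀ c' : Fin 2 → ℕ, Continuous (Function.uncurry fun u t =>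
          mon c' (disp v u t) * R t) := fun c' =>
        (continuous_mon_disp hv c').mul (hRc.comp continuous_snd)
      have hsw := fun (a : Fin 2) (c' : Fin 2 → ℕ) =>
        setIntegral_triangle_swap hv a (e 0) (hK c') s T
      rw [blockSum_of_ne_zero hc]
      have hL : ∀ a, (if 0 < c 0 a then
          blockSum (k := m + 2) (fun w => iterInt v T (a :: w) s) (decHead c a) e else 0) =
          ∫ t in Ioo s T, if 0 < c 0 a then v t (e 0) * ∫ u in Ioo s t, v u a *
            (mon (Function.update (c 0) a (c 0 a - 1)) (disp v u t) * R t) else 0 := by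
        intro a
        by_cases ha : 0 < c 0 a
        · simp only [if_pos ha]
          rw [← (hsw a _).2]
          refine (blockSum_iterInt_cons hv T s a (k := m + 2) (decHead c a) e).trans ?_
          refine setIntegral_congr_fun measurableSet_Ioo fun u hu => ?_
          simp only
          rw [ih _ (hN ▸ decHead_count_lt ha) _ rfl, decHead_zero]
          simp only [hR, decHead, Fin.cons_succ]
        · simp [if_neg ha]
      simp only [hL]
      rw [← integral_finsetSum]
      · refine setIntegral_congr_fun measurableSet_Ioo fun t ht => ?_
        rw [mon_disp_eq hv hc ht.1.le, Finset.sum_mul, Finset.mul_sum]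
        refine Finset.sum_congr rfl fun a _ => ?_
        split_ifs
        · rw [← integral_mul_const]
          simp only [mul_assoc, hR]
        · simp
      · intro a _
        by_cases ha : 0 < c 0 a
        · simp only [if_pos ha]
          exact (hsw a _).1
        · simp [if_neg ha]

/-- The displacement of block `j` for the knots `s < t_0 < ⋯ < t_{m-1} < T`. -/
def incr (v : ℝ → Plane) {m : ℕ} (s T : ℝ) (t : Fin m → ℝ) (j : Fin (m + 1)) : Fin 2 → ℝ :=
  disp v ((Fin.cons s t : Fin (m + 1) → ℝ) j) ((Fin.snoc t T : Fin (m + 1) → ℝ) j)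

theorem measurable_cons_apply {m : ℕ} (s : ℝ) (j : Fin (m + 1)) :
    Measurable fun t : Fin m → ℝ => (Fin.cons s t : Fin (m + 1) → ℝ) j := by
  induction j using Fin.cases with
  | zero => simp
  | succ j => simpa using measurable_pi_apply j

theorem measurable_snoc_apply {m : ℕ} (T : ℝ) (j : Fin (m + 1)) :
    Measurable fun t : Fin m → ℝ => (Fin.snoc t T : Fin (m + 1) → ℝ) j := by
  induction j using Fin.lastCases with
  | last => simp
  | cast j => simpa using measurable_pi_apply j

theorem measurable_incr (hv : ConstSpeed v Λ) {m : ℕ} (s T : ℝ) (j : Fin (m + 1)) (a : Fin 2) :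
    Measurable fun t : Fin m → ℝ => incr v s T t j a :=
  (continuous_disp hv a).measurable.comp
    ((measurable_cons_apply s j).prodMk (measurable_snoc_apply T j))

theorem measurable_mon_incr (hv : ConstSpeed v Λ) {m : ℕ} (s T : ℝ) (j : Fin (m + 1))
    (c : Fin 2 → ℕ) : Measurable fun t : Fin m → ℝ => mon c (incr v s T t j) := by
  have h0 := measurable_incr hv s T j 0
  have h1 := measurable_incr hv s T j 1
  exact ((h0.pow_const _).div_const _).mul ((h1.pow_const _).div_const _)

theorem knots_mem {m : ℕ} {s T : ℝ} (hs : s ≤ T) {t : Fin m → ℝ} (ht : t ∈ simplex m s T)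
    (j : Fin (m + 1)) : s ≤ (Fin.cons s t : Fin (m + 1) → ℝ) j ∧
      (Fin.cons s t : Fin (m + 1) → ℝ) j ≤ (Fin.snoc t T : Fin (m + 1) → ℝ) j ∧
      (Fin.snoc t T : Fin (m + 1) → ℝ) j ≤ T := by
  refine ⟨?_, ?_, ?_⟩
  · induction j using Fin.cases with
    | zero => simp
    | succ j => simpa using (ht.2 j).1.le
  · induction j using Fin.cases with
    | zero =>
      cases m with
      | zero => simpa [Fin.snoc] using hs
      | succ m =>
        have : (0 : Fin (m + 2)) = Fin.castSucc 0 := rfl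
        rw [this, Fin.snoc_castSucc]
        simpa using (ht.2 0).1.le
    | succ j =>
      rw [Fin.cons_succ]
      cases m with
      | zero => exact j.elim0
      | succ m =>
        induction j using Fin.lastCases with
        | last => simpa using (ht.2 _).2.le
        | cast j =>
          rw [Fin.succ_castSucc, Fin.snoc_castSucc]
          exact (ht.1 j.castSucc_lt_succ).le
  · induction j using Fin.lastCases with
    | last => simp
    | cast j => simpa using (ht.2 j).2.le

theorem exists_mon_incr_bound (hv : ConstSpeed v Λ) {m : ℕ} {s T : ℝ} (hs : s ≤ T)
    (c : Fin 2 → ℕ) : ∃ C, 0 ≤ C ∧ ∀ t ∈ simplex m s T, ∀ j, |mon c (incr v s T t j)| ≤ C := by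
  have hcpt : IsCompact (Icc s T ×ˢ Icc s T) := isCompact_Icc.prod isCompact_Icc
  obtain ⟨C, hC⟩ := hcpt.exists_bound_of_continuousOn (continuous_mon_disp hv c).continuousOn
  refine ⟨C, (norm_nonneg _).trans (hC (s, s) ⟨⟨le_rfl, hs⟩, ⟨le_rfl, hs⟩⟩), fun t ht j => ?_⟩
  obtain ⟨h1, h2, h3⟩ := knots_mem hs ht j
  exact hC (_, _) ⟨⟨h1, h2.trans h3⟩, ⟨h1.trans h2, h3⟩⟩

theorem integrableOn_block (hv : ConstSpeed v Λ) {m : ℕ} {s T : ℝ} (hs : s ≤ T)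
    (c : Fin (m + 1) → Fin 2 → ℕ) (e : Fin m → Fin 2) :
    IntegrableOn (fun t => (∏ j, v (t j) (e j)) * ∏ j, mon (c j) (incr v s T t j))
      (simplex m s T) := by
  choose C hC0 hC using fun j => exists_mon_incr_bound hv (m := m) hs (c j)
  refine integrableOn_simplex (C := (∏ _j : Fin m, Λ) * ∏ j, C j) ?_ ?_
  · refine Measurable.mul ?_ ?_
    · exact Finset.measurable_prod _ fun i _ => (hv.meas _).comp (measurable_pi_apply i)
    · exact Finset.measurable_prod _ fun j _ => measurable_mon_incr hv s T j (c j)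
  · intro t ht
    rw [abs_mul, Finset.abs_prod, Finset.abs_prod]
    refine mul_le_mul ?_ ?_ (Finset.prod_nonneg fun _ _ => abs_nonneg _)
      (Finset.prod_nonneg fun _ _ => hv.pos.le)
    · exact Finset.prod_le_prod (fun _ _ => abs_nonneg _) fun i _ => hv.abs_le _ _
    · exact Finset.prod_le_prod (fun _ _ => abs_nonneg _) fun j _ => hC j t ht j

/-- The sum of iterated integrals over block words as an integral over the separating times. -/
theorem blockSum_iterInt (hv : ConstSpeed v Λ) {m : ℕ} {s T : ℝ} (hs : s ≤ T)
    (c : Fin (m + 1) → Fin 2 → ℕ) (e : Fin m → Fin 2) :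
    blockSum (k := m + 1) (fun w => iterInt v T w s) c e =
      ∫ t in simplex m s T, (∏ j, v (t j) (e j)) * ∏ j, mon (c j) (incr v s T t j) := by
  induction m generalizing s with
  | zero =>
    rw [setIntegral_simplex_zero, blockSum_iterInt_one hv hs]
    simp [incr, Fin.snoc]
  | succ m ih =>
    rw [setIntegral_simplex_succ (integrableOn_block hv hs c e), blockSum_iterInt_succ hv]
    refine setIntegral_congr_fun measurableSet_Ioo fun t ht => ?_
    simp only
    rw [ih ht.2.le, ← mul_assoc, ← integral_const_mul]
    congr 1
    ext u
    rw [Fin.prod_univ_succ (fun j => v ((Fin.cons t u : Fin (m + 1) → ℝ) j) (e j)),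
      Fin.prod_univ_succ (n := m + 1)]
    have h0 : incr v s T (Fin.cons t u : Fin (m + 1) → ℝ) 0 = disp v s t := by
      unfold incr
      rw [← Fin.cons_snoc_eq_snoc_cons]
      rfl
    have h1 : ∀ j : Fin (m + 1), incr v s T (Fin.cons t u : Fin (m + 1) → ℝ) j.succ =
        incr v t T u j := by
      intro j
      unfold incr
      rw [← Fin.cons_snoc_eq_snoc_cons]
      rfl
    simp only [h0, h1, Fin.cons_zero, Fin.cons_succ]
    ring

end

section

/-! ### Even binomial sums -/

/-- The `ℓ¹` norm of a displacement. -/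
def dnorm (d : Fin 2 → ℝ) : ℝ := |d 0| + |d 1|

theorem dnorm_nonneg (d : Fin 2 → ℝ) : 0 ≤ dnorm d := by
  unfold dnorm
  positivity

/-- The letter counts of a block of length `2 n` with `2 l` letters `x`. -/
def evenPair (n l : ℕ) : Fin 2 → ℕ := ![2 * l, 2 * n - 2 * l]

theorem sum_range_two_mul_succ (f : ℕ → ℝ) (n : ℕ) :
    ∑ j ∈ Finset.range (2 * n + 1), f j =
      ∑ l ∈ Finset.range (n + 1), f (2 * l) + ∑ l ∈ Finset.range n, f (2 * l + 1) := by
  induction n with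
  | zero => simp
  | succ n ih =>
    rw [show 2 * (n + 1) + 1 = 2 * n + 1 + 1 + 1 by ring, Finset.sum_range_succ,
      Finset.sum_range_succ _ (2 * n + 1), ih, Finset.sum_range_succ _ (n + 1),
      Finset.sum_range_succ (fun l => f (2 * l + 1)) n, show 2 * n + 1 + 1 = 2 * (n + 1) by ring]
    ring

/-- Both exponents are even, so the signs of the increments disappear. Up to a common factor what
remains is a binomial weight with parameter |d 0| / dnorm d, taken at even indices only. -/
theorem mon_evenPair {n l : ℕ} (hl : l ≤ n) (d : Fin 2 → ℝ) :
    mon (evenPair n l) d = |d 0| ^ (2 * l) * |d 1| ^ (2 * n - 2 * l) *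
      ((2 * n).choose (2 * l) : ℝ) / ((2 * n).factorial : ℝ) := by
  have h1 : Even (2 * l) := even_two_mul l
  have h2 : Even (2 * n - 2 * l) := by
    rw [← Nat.mul_sub]
    exact even_two_mul _
  rw [Nat.cast_choose ℝ (by omega : 2 * l ≤ 2 * n), h1.pow_abs, h2.pow_abs]
  simp only [mon, evenPair, Matrix.cons_val_zero, Matrix.cons_val_one]
  have a1 : ((2 * n).factorial : ℝ) ≠ 0 := by positivity
  have a2 : ((2 * l).factorial : ℝ) ≠ 0 := by positivity
  have a3 : ((2 * n - 2 * l).factorial : ℝ) ≠ 0 := by positivity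
  field_simp

theorem mon_evenPair_nonneg {n l : ℕ} (hl : l ≤ n) (d : Fin 2 → ℝ) :
    0 ≤ mon (evenPair n l) d := by
  rw [mon_evenPair hl]
  positivity

/-- The left side consists of the even terms of the binomial expansion on the right; the odd terms
are nonnegative and are dropped. The parameter z makes this a moment generating function. -/
theorem sum_exp_mon_le (n : ℕ) (d : Fin 2 → ℝ) (z : ℝ) :
    ∑ l : Fin (n + 1), Real.exp (z * (2 * (l : ℕ) : ℕ)) * mon (evenPair n l) d ≤
      (|d 0| * Real.exp z + |d 1|) ^ (2 * n) / ((2 * n).factorial : ℝ) := by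
  rw [Fin.sum_univ_eq_sum_range
    (fun l => Real.exp (z * (2 * l : ℕ)) * mon (evenPair n l) d), add_pow,
    sum_range_two_mul_succ, le_div_iff₀ (by positivity), Finset.sum_mul]
  refine le_add_of_le_of_nonneg (Finset.sum_le_sum fun l hl => le_of_eq ?_)
    (Finset.sum_nonneg fun l _ => by positivity)
  rw [mon_evenPair (Finset.mem_range_succ_iff.1 hl), mul_pow, ← Real.exp_nat_mul,
    mul_comm z]
  have : ((2 * n).factorial : ℝ) ≠ 0 := by positivity
  field_simp

theorem sum_mon_le (n : ℕ) (d : Fin 2 → ℝ) :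
    ∑ l : Fin (n + 1), mon (evenPair n l) d ≤ dnorm d ^ (2 * n) / ((2 * n).factorial : ℝ) := by
  simpa [dnorm] using sum_exp_mon_le n d 0

/-- The even terms are the average of (|d 0| + |d 1|)^(2n) and (-|d 0| + |d 1|)^(2n), and the second
power is nonnegative. Restricting to even counts thus costs at most a factor 2 per block. -/
theorem le_sum_mon (n : ℕ) (d : Fin 2 → ℝ) :
    dnorm d ^ (2 * n) / ((2 * n).factorial : ℝ) ≤ 2 * ∑ l : Fin (n + 1), mon (evenPair n l) d := by
  have h1 := add_pow |d 0| |d 1| (2 * n)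
  have h2 := add_pow (-|d 0|) |d 1| (2 * n)
  have h3 : 0 ≤ (-|d 0| + |d 1|) ^ (2 * n) := (even_two_mul n).pow_nonneg _
  rw [sum_range_two_mul_succ] at h1 h2
  have h4 : ∑ l ∈ Finset.range (n + 1), (-|d 0|) ^ (2 * l) * |d 1| ^ (2 * n - 2 * l) *
      ((2 * n).choose (2 * l) : ℝ) = ∑ l ∈ Finset.range (n + 1), |d 0| ^ (2 * l) *
      |d 1| ^ (2 * n - 2 * l) * ((2 * n).choose (2 * l) : ℝ) :=
    Finset.sum_congr rfl fun l _ => by rw [(even_two_mul l).neg_pow]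
  have h5 : ∑ l ∈ Finset.range n, (-|d 0|) ^ (2 * l + 1) * |d 1| ^ (2 * n - (2 * l + 1)) *
      ((2 * n).choose (2 * l + 1) : ℝ) = -∑ l ∈ Finset.range n, |d 0| ^ (2 * l + 1) *
      |d 1| ^ (2 * n - (2 * l + 1)) * ((2 * n).choose (2 * l + 1) : ℝ) := by
    rw [← Finset.sum_neg_distrib]
    exact Finset.sum_congr rfl fun l _ => by
      rw [(even_two_mul l).add_one.neg_pow]
      ring
  rw [h4, h5] at h2
  have h6 : (∑ l : Fin (n + 1), mon (evenPair n l) d) * ((2 * n).factorial : ℝ) =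
      ∑ l ∈ Finset.range (n + 1), |d 0| ^ (2 * l) *
      |d 1| ^ (2 * n - 2 * l) * ((2 * n).choose (2 * l) : ℝ) := by
    rw [Fin.sum_univ_eq_sum_range (fun l => mon (evenPair n l) d), Finset.sum_mul]
    refine Finset.sum_congr rfl fun l hl => ?_
    rw [mon_evenPair (Finset.mem_range_succ_iff.1 hl)]
    have : ((2 * n).factorial : ℝ) ≠ 0 := by positivity
    field_simp
  rw [div_le_iff₀ (by positivity), mul_assoc, h6, dnorm]
  linarith

/-- Expanding with e^x ≤ 1 + x + x² for |x| ≤ 1, the linear terms cancel because the variable is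
centred, and the variance p(1 - p) is at most 1. -/
theorem mgf_le {p z : ℝ} (hp : p ∈ Icc (0 : ℝ) 1) (hz : |z| ≤ 1) :
    p * Real.exp (z * (1 - p)) + (1 - p) * Real.exp (-(z * p)) ≤ Real.exp (z ^ 2) := by
  obtain ⟨h0, h1⟩ := hp
  obtain ⟨hz1, hz2⟩ := abs_le.1 hz
  have key : ∀ x : ℝ, |x| ≤ 1 → Real.exp x ≤ 1 + x + x ^ 2 := fun x hx => by
    have := (abs_le.1 (Real.abs_exp_sub_one_sub_id_le hx)).2
    linarith
  have e1 := key (z * (1 - p)) (by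
    rw [abs_mul, abs_of_nonneg (by linarith : 0 ≤ 1 - p)]
    nlinarith [abs_nonneg z])
  have e2 := key (-(z * p)) (by
    rw [abs_neg, abs_mul, abs_of_nonneg h0]
    nlinarith [abs_nonneg z])
  have e3 := Real.add_one_le_exp (z ^ 2)
  have h2 := mul_le_mul_of_nonneg_left e1 h0
  have h3 := mul_le_mul_of_nonneg_left e2 (by linarith : 0 ≤ 1 - p)
  have h4 : p * (1 + z * (1 - p) + (z * (1 - p)) ^ 2) +
      (1 - p) * (1 + -(z * p) + (-(z * p)) ^ 2) = 1 + z ^ 2 * (p * (1 - p)) := by ring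
  have h5 : z ^ 2 * (p * (1 - p)) ≤ z ^ 2 * 1 :=
    mul_le_mul_of_nonneg_left (by nlinarith) (sq_nonneg z)
  linarith

theorem sum_exp_centered_mon_le (n : ℕ) {d : Fin 2 → ℝ} (hd : 0 < dnorm d) {z : ℝ}
    (hz : |z| ≤ 1) :
    ∑ l : Fin (n + 1), Real.exp (2 * z * ((l : ℕ) - n * (|d 0| / dnorm d))) *
      mon (evenPair n l) d ≤
      Real.exp (2 * n * z ^ 2) * (dnorm d ^ (2 * n) / ((2 * n).factorial : ℝ)) := by
  set p := |d 0| / dnorm d with hp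
  have hd0 : |d 0| = dnorm d * p := by
    rw [hp]
    field_simp
  have hd1 : |d 1| = dnorm d * (1 - p) := by
    rw [mul_sub, ← hd0, dnorm]
    ring
  have hp01 : p ∈ Icc (0 : ℝ) 1 := by
    refine ⟨div_nonneg (abs_nonneg _) hd.le, (div_le_one hd).2 ?_⟩
    rw [dnorm]
    linarith [abs_nonneg (d 1)]
  clear_value p
  have h1 := sum_exp_mon_le n d z
  have h2 : ∑ l : Fin (n + 1), Real.exp (2 * z * ((l : ℕ) - n * p)) * mon (evenPair n l) d =
      Real.exp (-(z * p)) ^ (2 * n) *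
        ∑ l : Fin (n + 1), Real.exp (z * (2 * (l : ℕ) : ℕ)) * mon (evenPair n l) d := by
    rw [Finset.mul_sum]
    refine Finset.sum_congr rfl fun l _ => ?_
    rw [← mul_assoc, ← Real.exp_nat_mul, ← Real.exp_add]
    congr 2
    push_cast
    ring
  rw [h2]
  refine (mul_le_mul_of_nonneg_left h1 (by positivity)).trans ?_
  rw [← mul_div_assoc, ← mul_div_assoc]
  refine (div_le_div_iff_of_pos_right
    (by positivity : (0 : ℝ) < ((2 * n).factorial : ℝ))).2 ?_
  rw [← mul_pow]
  have h3 : Real.exp (-(z * p)) * (|d 0| * Real.exp z + |d 1|) ≤ Real.exp (z ^ 2) * dnorm d := by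
    have h4 : Real.exp (z * (1 - p)) = Real.exp z * Real.exp (-(z * p)) := by
      rw [← Real.exp_add]
      ring_nf
    have := mul_le_mul_of_nonneg_right (mgf_le hp01 hz) hd.le
    rw [h4] at this
    refine le_trans (le_of_eq ?_) this
    rw [hd0, hd1]
    ring
  have h5 : Real.exp (2 * n * z ^ 2) = Real.exp (z ^ 2) ^ (2 * n) := by
    rw [← Real.exp_nat_mul]
    push_cast
    ring_nf
  rw [h5, ← mul_pow]
  exact pow_le_pow_left₀ (by positivity) h3 _

/-- Concentration of the even binomial weights. -/
theorem sum_tail_mon_le {n : ℕ} {d : Fin 2 → ℝ} (hd : 0 < dnorm d) {μ : ℝ}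
    (hμ0 : 0 ≤ μ) (hμ : μ ≤ 2) (A : Finset (Fin (n + 1)))
    (hA : ∀ l ∈ A, n * μ ≤ |((l : ℕ) : ℝ) - n * (|d 0| / dnorm d)|) :
    ∑ l ∈ A, mon (evenPair n l) d ≤
      2 * Real.exp (-(n * μ ^ 2 / 2)) * (dnorm d ^ (2 * n) / ((2 * n).factorial : ℝ)) := by
  set p := |d 0| / dnorm d with hp
  -- Chernoff bound with z = ±μ/2, one sign for each tail: the exponent is 2n(μ/2)² - nμ² = -nμ²/2.
  -- The bound μ ≤ 2 keeps |z| ≤ 1.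
  have h1 := sum_exp_centered_mon_le n hd (z := μ / 2) (by rw [abs_of_nonneg] <;> linarith)
  have h2 := sum_exp_centered_mon_le n hd (z := -(μ / 2))
    (by rw [abs_neg, abs_of_nonneg] <;> linarith)
  have h3 : ∑ l ∈ A, mon (evenPair n l) d ≤ ∑ l : Fin (n + 1), Real.exp (-(n * μ ^ 2)) *
      (Real.exp (2 * (μ / 2) * ((l : ℕ) - n * p)) * mon (evenPair n l) d +
        Real.exp (2 * -(μ / 2) * ((l : ℕ) - n * p)) * mon (evenPair n l) d) := by
    refine (Finset.sum_le_sum fun l hl => ?_).trans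
      (Finset.sum_le_univ_sum_of_nonneg fun l => ?_)
    · have hm := mon_evenPair_nonneg (n := n) (l := l) (Nat.lt_succ_iff.1 l.2) d
      rw [← add_mul, ← mul_assoc]
      refine le_mul_of_one_le_left hm ?_
      rw [mul_add, ← Real.exp_add, ← Real.exp_add]
      rcases abs_cases (((l : ℕ) : ℝ) - n * p) with ⟨h, _⟩ | ⟨h, _⟩
      · refine le_add_of_le_of_nonneg (Real.one_le_exp ?_) (Real.exp_pos _).le
        have := hA l hl
        rw [h] at this
        nlinarith
      · refine le_add_of_nonneg_of_le (Real.exp_pos _).le (Real.one_le_exp ?_)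
        have := hA l hl
        rw [h] at this
        nlinarith
    · have hm := mon_evenPair_nonneg (n := n) (l := l) (Nat.lt_succ_iff.1 l.2) d
      positivity
  rw [← Finset.mul_sum, Finset.sum_add_distrib] at h3
  refine h3.trans ((mul_le_mul_of_nonneg_left (add_le_add h1 h2) (Real.exp_pos _).le).trans
    (le_of_eq ?_))
  have h4 : Real.exp (-(n * μ ^ 2 / 2)) =
      Real.exp (-(n * μ ^ 2)) * Real.exp (2 * n * (μ / 2) ^ 2) := by
    rw [← Real.exp_add]
    ring_nf
  rw [h4, neg_sq]
  ring

/-- The only signed factor gained from an additional letter a is d a; this is how the signs of the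
increments become visible. For even pairs the denominator is at most 2n + 1, a merely polynomial
loss. -/
theorem mon_add_single (c : Fin 2 → ℕ) (a : Fin 2) (d : Fin 2 → ℝ) :
    mon (fun m => c m + if m = a then 1 else 0) d = d a / (c a + 1) * mon c d := by
  have h : ∀ p : ℕ, ((p + 1).factorial : ℝ) = (p + 1) * p.factorial := fun p => by
    rw [Nat.factorial_succ]
    push_cast
    ring
  have hp : ∀ p : ℕ, (p.factorial : ℝ) ≠ 0 := fun p => by positivity
  have hq : ∀ p : ℕ, (p : ℝ) + 1 ≠ 0 := fun p => by positivity
  fin_cases a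
  · have := hp (c 0)
    have := hp (c 1)
    have := hq (c 0)
    simp [mon, h]
    field_simp
    ring
  · have := hp (c 0)
    have := hp (c 1)
    have := hq (c 1)
    simp [mon, h]
    field_simp
    ring

theorem evenPair_le {n l : ℕ} (hl : l ≤ n) (a : Fin 2) : evenPair n l a ≤ 2 * n := by
  fin_cases a
  · simpa [evenPair] using hl
  · simp [evenPair]

theorem abs_sum_mon_single_le (n : ℕ) (a : Fin 2) (d : Fin 2 → ℝ) :
    |∑ l : Fin (n + 1), mon (fun m => evenPair n l m + if m = a then 1 else 0) d| ≤
      |d a| * ∑ l : Fin (n + 1), mon (evenPair n l) d := by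
  refine (Finset.abs_sum_le_sum_abs _ _).trans ?_
  rw [Finset.mul_sum]
  refine Finset.sum_le_sum fun l _ => ?_
  have hm := mon_evenPair_nonneg (n := n) (l := l) (Nat.lt_succ_iff.1 l.2) d
  rw [mon_add_single, abs_mul, abs_of_nonneg hm, abs_div]
  refine mul_le_mul_of_nonneg_right (div_le_self (abs_nonneg _) ?_) hm
  rw [abs_of_pos (by positivity)]
  simp

theorem le_sum_mon_single (n : ℕ) (a : Fin 2) {d : Fin 2 → ℝ} {σ : ℝ} (hσ : 0 ≤ σ * d a)
    (hσ1 : |σ| = 1) :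
    |d a| / (2 * n + 1) * ∑ l : Fin (n + 1), mon (evenPair n l) d ≤
      σ * ∑ l : Fin (n + 1), mon (fun m => evenPair n l m + if m = a then 1 else 0) d := by
  have hda : |d a| = σ * d a := by
    rw [← abs_of_nonneg hσ, abs_mul, hσ1, one_mul]
  rw [Finset.mul_sum, Finset.mul_sum]
  refine Finset.sum_le_sum fun l _ => ?_
  have hm := mon_evenPair_nonneg (n := n) (l := l) (Nat.lt_succ_iff.1 l.2) d
  rw [mon_add_single, ← mul_assoc, ← mul_div_assoc, ← hda]
  refine mul_le_mul_of_nonneg_right ?_ hm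
  refine div_le_div_of_nonneg_left (abs_nonneg _) (by positivity) ?_
  have := evenPair_le (n := n) (l := l) (Nat.lt_succ_iff.1 l.2) a
  have : (evenPair n l a : ℝ) ≤ ((2 * n : ℕ) : ℝ) := by exact_mod_cast this
  push_cast at this
  linarith

end

section

variable {v : ℝ → Plane} {Λ : ℝ}

/-! ### Symmetrized signatures as integrals -/

/-- The signature of the path with velocity `v` on `[0, T]`. -/
def pathSig (v : ℝ → Plane) (T : ℝ) : Series := fun w => iterInt v T w 0

/-- The product of the velocity coordinates chosen by `w` at the separating times. -/
def sepProd (v : ℝ → Plane) {m : ℕ} (w : Fin m → Fin 2) (t : Fin m → ℝ) : ℝ :=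
  ∏ j, v (t j) (w j)

/-- The product of the block monomials. -/
def blk (v : ℝ → Plane) (T : ℝ) {m n : ℕ} (l : Fin (m + 1) → Fin (n + 1)) (t : Fin m → ℝ) : ℝ :=
  ∏ j, mon (evenPair n (l j)) (incr v 0 T t j)

/-- The product of the block monomials with one additional letter `a` in block `i`. -/
def blkExtra (v : ℝ → Plane) (T : ℝ) {m n : ℕ} (i : Fin (m + 1)) (a : Fin 2)
    (l : Fin (m + 1) → Fin (n + 1)) (t : Fin m → ℝ) : ℝ :=
  ∏ j, mon (fun b => evenPair n (l j) b + if j = i ∧ b = a then 1 else 0) (incr v 0 T t j)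

/-- The total block weight `∏_j |Δ_j|^{2n} / (2n)!`. -/
def mass (v : ℝ → Plane) (T : ℝ) {m : ℕ} (n : ℕ) (t : Fin m → ℝ) : ℝ :=
  ∏ j : Fin (m + 1), dnorm (incr v 0 T t j) ^ (2 * n) / ((2 * n).factorial : ℝ)

theorem symSig_pathSig (hv : ConstSpeed v Λ) {T : ℝ} (hT : 0 ≤ T) {m n : ℕ} (w : Fin m → Fin 2)
    (l : Fin (m + 1) → Fin (n + 1)) :
    symSig (k := m + 1) (pathSig v T) w l = ∫ t in simplex m 0 T, sepProd v w t * blk v T l t :=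
  blockSum_iterInt hv hT _ _

theorem symSigExtra_pathSig (hv : ConstSpeed v Λ) {T : ℝ} (hT : 0 ≤ T) {m n : ℕ} (i : Fin (m + 1))
    (a : Fin 2) (w : Fin m → Fin 2) (l : Fin (m + 1) → Fin (n + 1)) :
    symSigExtra (k := m + 1) (pathSig v T) i a w l =
      ∫ t in simplex m 0 T, sepProd v w t * blkExtra v T i a l t :=
  blockSum_iterInt hv hT _ _

theorem integrableOn_sepProd_blk (hv : ConstSpeed v Λ) {T : ℝ} (hT : 0 ≤ T) {m n : ℕ}
    (w : Fin m → Fin 2) (l : Fin (m + 1) → Fin (n + 1)) :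
    IntegrableOn (fun t => sepProd v w t * blk v T l t) (simplex m 0 T) :=
  integrableOn_block hv hT _ _

theorem integrableOn_sepProd_blkExtra (hv : ConstSpeed v Λ) {T : ℝ} (hT : 0 ≤ T) {m n : ℕ}
    (i : Fin (m + 1)) (a : Fin 2) (w : Fin m → Fin 2) (l : Fin (m + 1) → Fin (n + 1)) :
    IntegrableOn (fun t => sepProd v w t * blkExtra v T i a l t) (simplex m 0 T) :=
  integrableOn_block hv hT _ _

theorem dnorm_disp_le (hv : ConstSpeed v Λ) {s t : ℝ} (hst : s ≤ t) :
    dnorm (disp v s t) ≤ Λ * (t - s) := by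
  have h := fun a => intervalIntegral.norm_integral_le_integral_norm (μ := volume)
    (f := fun u => v u a) hst
  have hI := fun a => (hv.intervalIntegrable a s t).norm
  calc dnorm (disp v s t) ≤ (∫ u in s..t, ‖v u 0‖) + ∫ u in s..t, ‖v u 1‖ := add_le_add (h 0) (h 1)
    _ = ∫ u in s..t, (‖v u 0‖ + ‖v u 1‖) := (intervalIntegral.integral_add (hI 0) (hI 1)).symm
    _ = ∫ _u in s..t, Λ := by
        congr 1
        ext u
        rw [← hv.speed u, plane_norm]
        rfl
    _ = Λ * (t - s) := by
        rw [intervalIntegral.integral_const, smul_eq_mul, mul_comm]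

theorem dnorm_incr_le (hv : ConstSpeed v Λ) {T : ℝ} (hT : 0 ≤ T) {m : ℕ} {t : Fin m → ℝ}
    (ht : t ∈ simplex m 0 T) (j : Fin (m + 1)) : dnorm (incr v 0 T t j) ≤ Λ * T := by
  obtain ⟨h1, h2, h3⟩ := knots_mem hT ht j
  refine (dnorm_disp_le hv h2).trans (mul_le_mul_of_nonneg_left ?_ hv.pos.le)
  linarith

theorem abs_le_dnorm (d : Fin 2 → ℝ) (a : Fin 2) : |d a| ≤ dnorm d := by
  unfold dnorm
  fin_cases a <;> simp

theorem measurable_mass (hv : ConstSpeed v Λ) (T : ℝ) {m : ℕ} (n : ℕ) :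
    Measurable fun t : Fin m → ℝ => mass v T n t := by
  refine Finset.measurable_prod _ fun j _ => ((Measurable.add ?_ ?_).pow_const _).div_const _
  · exact continuous_abs.measurable.comp (measurable_incr hv 0 T j 0)
  · exact continuous_abs.measurable.comp (measurable_incr hv 0 T j 1)

theorem mass_nonneg (v : ℝ → Plane) (T : ℝ) {m : ℕ} (n : ℕ) (t : Fin m → ℝ) :
    0 ≤ mass v T n t :=
  Finset.prod_nonneg fun _ _ =>
    div_nonneg (pow_nonneg (dnorm_nonneg _) _) (Nat.cast_nonneg _)

theorem integrableOn_mass (hv : ConstSpeed v Λ) {T : ℝ} (hT : 0 ≤ T) (m n : ℕ) :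
    IntegrableOn (fun t : Fin m → ℝ => mass v T n t) (simplex m 0 T) := by
  refine integrableOn_simplex
    (C := ∏ _j : Fin (m + 1), (Λ * T) ^ (2 * n) / ((2 * n).factorial : ℝ))
    (measurable_mass hv T n) fun t ht => ?_
  rw [abs_of_nonneg (mass_nonneg _ _ _ _)]
  refine Finset.prod_le_prod (fun _ _ =>
    div_nonneg (pow_nonneg (dnorm_nonneg _) _) (Nat.cast_nonneg _)) fun j _ => ?_
  have := pow_le_pow_left₀ (dnorm_nonneg _) (dnorm_incr_le hv hT ht j) (2 * n)
  gcongr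

theorem measurable_blk (hv : ConstSpeed v Λ) (T : ℝ) {m n : ℕ} (l : Fin (m + 1) → Fin (n + 1)) :
    Measurable (blk v T l) :=
  Finset.measurable_prod _ fun j _ => measurable_mon_incr hv 0 T j _

theorem measurable_blkExtra (hv : ConstSpeed v Λ) (T : ℝ) {m n : ℕ} (i : Fin (m + 1)) (a : Fin 2)
    (l : Fin (m + 1) → Fin (n + 1)) : Measurable (blkExtra v T i a l) :=
  Finset.measurable_prod _ fun j _ => measurable_mon_incr hv 0 T j _

theorem measurable_sepProd (hv : ConstSpeed v Λ) {m : ℕ} (w : Fin m → Fin 2) :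
    Measurable (sepProd v w) :=
  Finset.measurable_prod _ fun j _ => (hv.meas _).comp (measurable_pi_apply j)

theorem blk_nonneg (v : ℝ → Plane) (T : ℝ) {m n : ℕ} (l : Fin (m + 1) → Fin (n + 1))
    (t : Fin m → ℝ) : 0 ≤ blk v T l t :=
  Finset.prod_nonneg fun j _ => mon_evenPair_nonneg (Nat.lt_succ_iff.1 (l j).2) _

theorem sum_blk_eq (v : ℝ → Plane) (T : ℝ) {m n : ℕ} (t : Fin m → ℝ) :
    ∑ l : Fin (m + 1) → Fin (n + 1), blk v T l t =
      ∏ j, ∑ l : Fin (n + 1), mon (evenPair n l) (incr v 0 T t j) :=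
  (Fintype.prod_sum fun j (l : Fin (n + 1)) => mon (evenPair n l) (incr v 0 T t j)).symm

theorem sum_mon_nonneg (n : ℕ) (d : Fin 2 → ℝ) :
    0 ≤ ∑ l : Fin (n + 1), mon (evenPair n l) d :=
  Finset.sum_nonneg fun l _ => mon_evenPair_nonneg (Nat.lt_succ_iff.1 l.2) _

theorem sum_blk_le (v : ℝ → Plane) (T : ℝ) {m n : ℕ} (t : Fin m → ℝ) :
    ∑ l : Fin (m + 1) → Fin (n + 1), blk v T l t ≤ mass v T n t := by
  rw [sum_blk_eq]
  exact Finset.prod_le_prod (fun j _ => sum_mon_nonneg _ _) fun j _ => sum_mon_le _ _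

theorem mass_le_sum_blk (v : ℝ → Plane) (T : ℝ) {m n : ℕ} (t : Fin m → ℝ) :
    mass v T n t ≤ 2 ^ (m + 1) * ∑ l : Fin (m + 1) → Fin (n + 1), blk v T l t := by
  have h2 : (2 : ℝ) ^ (m + 1) = ∏ _j : Fin (m + 1), (2 : ℝ) := by simp
  rw [sum_blk_eq, h2, ← Finset.prod_mul_distrib]
  exact Finset.prod_le_prod (fun j _ =>
    div_nonneg (pow_nonneg (dnorm_nonneg _) _) (Nat.cast_nonneg _)) fun j _ => le_sum_mon _ _

/-- The sum over all multi-indices factorises over the blocks and the restriction touches only block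
i; every other block is bounded by its full weight. -/
theorem sum_blk_filter_le (v : ℝ → Plane) (T : ℝ) {m n : ℕ} (t : Fin m → ℝ) (i : Fin (m + 1))
    (P : Fin (n + 1) → Prop) [DecidablePred P] {c : ℝ}
    (hc : ∑ l with P l, mon (evenPair n l) (incr v 0 T t i) ≤
      c * (dnorm (incr v 0 T t i) ^ (2 * n) / ((2 * n).factorial : ℝ))) :
    ∑ l : Fin (m + 1) → Fin (n + 1) with P (l i), blk v T l t ≤ c * mass v T n t := by
  have hset : (Finset.univ.filter fun l : Fin (m + 1) → Fin (n + 1) => P (l i)) =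
      Fintype.piFinset fun j => if j = i then Finset.univ.filter P else Finset.univ := by
    ext l
    simp only [Finset.mem_filter, Finset.mem_univ, true_and, Fintype.mem_piFinset]
    constructor
    · intro h j
      split_ifs with hj
      · subst hj
        simpa using h
      · simp
    · intro h
      simpa using h i
  rw [hset]
  unfold blk mass
  rw [← Finset.prod_univ_sum (fun j => if j = i then Finset.univ.filter P else Finset.univ)
    (fun j (l : Fin (n + 1)) => mon (evenPair n l) (incr v 0 T t j)),
    ← Finset.mul_prod_erase Finset.univ _ (Finset.mem_univ i),
    ← Finset.mul_prod_erase Finset.univ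
      (fun j => dnorm (incr v 0 T t j) ^ (2 * n) / ((2 * n).factorial : ℝ)) (Finset.mem_univ i),
    ← mul_assoc, if_pos rfl]
  have hle : ∏ x ∈ Finset.univ.erase i, ∑ j ∈ (if x = i then Finset.univ.filter P
      else Finset.univ), mon (evenPair n j) (incr v 0 T t x) ≤
      ∏ x ∈ Finset.univ.erase i, dnorm (incr v 0 T t x) ^ (2 * n) / ((2 * n).factorial : ℝ) := by
    refine Finset.prod_le_prod (fun j _ => Finset.sum_nonneg fun l _ =>
      mon_evenPair_nonneg (Nat.lt_succ_iff.1 l.2) _) fun j hj => ?_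
    rw [if_neg (Finset.ne_of_mem_erase hj)]
    exact sum_mon_le _ _
  have h0 : 0 ≤ ∑ l with P l, mon (evenPair n l) (incr v 0 T t i) :=
    Finset.sum_nonneg fun l _ => mon_evenPair_nonneg (Nat.lt_succ_iff.1 l.2) _
  exact mul_le_mul hc hle (Finset.prod_nonneg fun j _ => Finset.sum_nonneg fun l _ =>
      mon_evenPair_nonneg (Nat.lt_succ_iff.1 l.2) _) (h0.trans hc)

theorem sum_blkExtra_eq (v : ℝ → Plane) (T : ℝ) {m n : ℕ} (i : Fin (m + 1)) (a : Fin 2)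
    (t : Fin m → ℝ) :
    ∑ l : Fin (m + 1) → Fin (n + 1), blkExtra v T i a l t =
      (∑ l : Fin (n + 1), mon (fun b => evenPair n l b + if b = a then 1 else 0)
        (incr v 0 T t i)) *
      ∏ j ∈ Finset.univ.erase i, ∑ l : Fin (n + 1), mon (evenPair n l) (incr v 0 T t j) := by
  have h := Fintype.prod_sum fun j (l : Fin (n + 1)) =>
    mon (fun b => evenPair n l b + if j = i ∧ b = a then 1 else 0) (incr v 0 T t j)
  refine Eq.trans h.symm ?_
  rw [← Finset.mul_prod_erase Finset.univ _ (Finset.mem_univ i)]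
  congr 1
  · simp
  · refine Finset.prod_congr rfl fun j hj => ?_
    simp [Finset.ne_of_mem_erase hj]

theorem sum_blk_eq_mul (v : ℝ → Plane) (T : ℝ) {m n : ℕ} (i : Fin (m + 1)) (t : Fin m → ℝ) :
    ∑ l : Fin (m + 1) → Fin (n + 1), blk v T l t =
      (∑ l : Fin (n + 1), mon (evenPair n l) (incr v 0 T t i)) *
      ∏ j ∈ Finset.univ.erase i, ∑ l : Fin (n + 1), mon (evenPair n l) (incr v 0 T t j) := by
  rw [sum_blk_eq]
  exact (Finset.mul_prod_erase Finset.univ _ (Finset.mem_univ i)).symm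

theorem abs_sum_blkExtra_le (v : ℝ → Plane) (T : ℝ) {m n : ℕ} (i : Fin (m + 1)) (a : Fin 2)
    (t : Fin m → ℝ) :
    |∑ l : Fin (m + 1) → Fin (n + 1), blkExtra v T i a l t| ≤
      |incr v 0 T t i a| * mass v T n t := by
  have hp : 0 ≤ ∏ j ∈ Finset.univ.erase i,
      ∑ l : Fin (n + 1), mon (evenPair n l) (incr v 0 T t j) :=
    Finset.prod_nonneg fun j _ => sum_mon_nonneg _ _
  rw [sum_blkExtra_eq, abs_mul, abs_of_nonneg hp]
  refine (mul_le_mul_of_nonneg_right (abs_sum_mon_single_le n a _) hp).trans ?_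
  rw [mul_assoc, ← sum_blk_eq_mul]
  exact mul_le_mul_of_nonneg_left (sum_blk_le v T t) (abs_nonneg _)

theorem le_sum_blkExtra (v : ℝ → Plane) (T : ℝ) {m n : ℕ} (i : Fin (m + 1)) (a : Fin 2)
    {t : Fin m → ℝ} {σ : ℝ} (hσ : 0 ≤ σ * incr v 0 T t i a) (hσ1 : |σ| = 1) :
    |incr v 0 T t i a| / ((2 * n + 1) * 2 ^ (m + 1)) * mass v T n t ≤
      σ * ∑ l : Fin (m + 1) → Fin (n + 1), blkExtra v T i a l t := by
  have hp : 0 ≤ ∏ j ∈ Finset.univ.erase i,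
      ∑ l : Fin (n + 1), mon (evenPair n l) (incr v 0 T t j) :=
    Finset.prod_nonneg fun j _ => sum_mon_nonneg _ _
  rw [sum_blkExtra_eq, ← mul_assoc]
  refine le_trans ?_ (mul_le_mul_of_nonneg_right (le_sum_mon_single n a hσ hσ1) hp)
  rw [mul_assoc (|incr v 0 T t i a| / (2 * n + 1)), ← sum_blk_eq_mul]
  refine (mul_le_mul_of_nonneg_left (mass_le_sum_blk v T t) (by positivity)).trans (le_of_eq ?_)
  field_simp

/-- Summing over the words factorises into ∏ ‖v (t j)‖. Since the norm is ℓ¹ and the speed constant,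
the result does not depend on the times. -/
theorem sum_abs_sepProd (hv : ConstSpeed v Λ) {m : ℕ} (t : Fin m → ℝ) :
    ∑ w : Fin m → Fin 2, |sepProd v w t| = Λ ^ m := by
  unfold sepProd
  simp only [Finset.abs_prod]
  rw [← Fintype.prod_sum fun j (a : Fin 2) => |v (t j) a|]
  simp only [Fin.sum_univ_two, ← plane_norm, hv.speed]
  simp

theorem abs_sepProd_le (hv : ConstSpeed v Λ) {m : ℕ} (w : Fin m → Fin 2) (t : Fin m → ℝ) :
    |sepProd v w t| ≤ Λ ^ m := by
  have h : Λ ^ m = ∏ _j : Fin m, Λ := by simp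
  rw [sepProd, Finset.abs_prod, h]
  exact Finset.prod_le_prod (fun _ _ => abs_nonneg _) fun i _ => hv.abs_le _ _

theorem integrableOn_blk (hv : ConstSpeed v Λ) {T : ℝ} (hT : 0 ≤ T) {m n : ℕ}
    (l : Fin (m + 1) → Fin (n + 1)) : IntegrableOn (blk v T l) (simplex m 0 T) := by
  refine (integrableOn_mass hv hT m n).mono' (measurable_blk hv T l).aestronglyMeasurable
    (Eventually.of_forall fun t => ?_)
  rw [Real.norm_of_nonneg (blk_nonneg _ _ _ _)]
  exact (Finset.single_le_sum (fun l _ => blk_nonneg v T l t) (Finset.mem_univ l)).trans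
    (sum_blk_le v T t)

theorem sum_abs_symSig_le (hv : ConstSpeed v Λ) {T : ℝ} (hT : 0 ≤ T) {m n : ℕ}
    (A : Finset (Fin (m + 1) → Fin (n + 1))) :
    ∑ w : Fin m → Fin 2, ∑ l ∈ A, |symSig (k := m + 1) (pathSig v T) w l| ≤
      Λ ^ m * ∫ t in simplex m 0 T, ∑ l ∈ A, blk v T l t := by
  have hI := fun (w : Fin m → Fin 2) (l : Fin (m + 1) → Fin (n + 1)) =>
    (integrableOn_sepProd_blk hv hT w l).norm
  calc ∑ w : Fin m → Fin 2, ∑ l ∈ A, |symSig (k := m + 1) (pathSig v T) w l|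
      ≤ ∑ w : Fin m → Fin 2, ∑ l ∈ A, ∫ t in simplex m 0 T, ‖sepProd v w t * blk v T l t‖ := by
        refine Finset.sum_le_sum fun w _ => Finset.sum_le_sum fun l _ => ?_
        rw [symSig_pathSig hv hT]
        exact norm_integral_le_integral_norm (fun t => sepProd v w t * blk v T l t)
    _ = ∫ t in simplex m 0 T, ∑ w : Fin m → Fin 2, ∑ l ∈ A, ‖sepProd v w t * blk v T l t‖ := by
        rw [integral_finsetSum _ fun w _ => integrable_finsetSum _ fun l _ => hI w l]
        exact Finset.sum_congr rfl fun w _ => (integral_finsetSum _ fun l _ => hI w l).symm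
    _ = ∫ t in simplex m 0 T, Λ ^ m * ∑ l ∈ A, blk v T l t := by
        congr 1
        ext t
        rw [← sum_abs_sepProd hv t, Finset.sum_mul]
        refine Finset.sum_congr rfl fun w _ => ?_
        rw [Finset.mul_sum]
        refine Finset.sum_congr rfl fun l _ => ?_
        rw [norm_mul, Real.norm_of_nonneg (blk_nonneg v T l t), Real.norm_eq_abs]
    _ = _ := integral_const_mul _ _

/-- On `W` the separating letters `w` see velocities of a fixed sign that are not small. -/
def GoodWord (v : ℝ → Plane) (Λ : ℝ) {m : ℕ} (W : Set (Fin m → ℝ)) (w : Fin m → Fin 2)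
    (σ : Fin m → ℝ) : Prop :=
  ∀ j, |σ j| = 1 ∧ ∀ t ∈ W, Λ / 8 ≤ σ j * v (t j) (w j)

/-- On `W` the sign ∏ σ j makes the separator product at least (Λ/8)^m, so nothing cancels there;
off `W` the integrand is bounded in absolute value by Λ^m H'. -/
theorem le_signed_integral (hv : ConstSpeed v Λ) {T : ℝ} {m : ℕ} {W : Set (Fin m → ℝ)}
    (hWm : MeasurableSet W) (hW : W ⊆ simplex m 0 T) {w : Fin m → Fin 2} {σ : Fin m → ℝ}
    (hw : GoodWord v Λ W w σ) {H H' : (Fin m → ℝ) → ℝ} (hHm : Measurable H)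
    (hH' : IntegrableOn H' (simplex m 0 T)) (hHW : ∀ t ∈ W, 0 ≤ H t)
    (hHH' : ∀ t ∈ simplex m 0 T, |H t| ≤ H' t) :
    (Λ / 8) ^ m * (∫ t in W, H t) - Λ ^ m * (∫ t in simplex m 0 T \ W, H' t) ≤
      (∏ j, σ j) * ∫ t in simplex m 0 T, sepProd v w t * H t := by
  have hH : IntegrableOn H (simplex m 0 T) := by
    refine hH'.mono' hHm.aestronglyMeasurable ?_
    filter_upwards [ae_restrict_mem (measurableSet_simplex m 0 T)] with t ht
    exact hHH' t ht
  have hint : IntegrableOn (fun t => sepProd v w t * H t) (simplex m 0 T) := by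
    refine (hH'.const_mul (Λ ^ m)).mono'
      ((measurable_sepProd hv w).mul hHm).aestronglyMeasurable ?_
    filter_upwards [ae_restrict_mem (measurableSet_simplex m 0 T)] with t ht
    rw [norm_mul]
    exact mul_le_mul (abs_sepProd_le hv w t) (hHH' t ht) (norm_nonneg _) (pow_nonneg hv.pos.le _)
  have hsplit : ∫ t in simplex m 0 T, sepProd v w t * H t =
      (∫ t in W, sepProd v w t * H t) + ∫ t in simplex m 0 T \ W, sepProd v w t * H t := by
    rw [← setIntegral_union disjoint_sdiff_right ((measurableSet_simplex m 0 T).diff hWm)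
      (hint.mono_set hW) (hint.mono_set sdiff_subset), union_sdiff_cancel hW]
  have hσ : |∏ j, σ j| = 1 := by
    rw [Finset.abs_prod]
    exact Finset.prod_eq_one fun j _ => (hw j).1
  have h1 : (Λ / 8) ^ m * (∫ t in W, H t) ≤ (∏ j, σ j) * ∫ t in W, sepProd v w t * H t := by
    rw [← integral_const_mul, ← integral_const_mul]
    refine setIntegral_mono_on ((hH.mono_set hW).const_mul _) ((hint.mono_set hW).const_mul _)
      hWm fun t ht => ?_
    rw [← mul_assoc]
    refine mul_le_mul_of_nonneg_right ?_ (hHW t ht)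
    rw [sepProd, ← Finset.prod_mul_distrib]
    have : (Λ / 8) ^ m = ∏ _j : Fin m, (Λ / 8) := by simp [div_pow]
    rw [this]
    exact Finset.prod_le_prod (fun _ _ => by have := hv.pos; positivity) fun j _ => (hw j).2 t ht
  have h2 : -(Λ ^ m * ∫ t in simplex m 0 T \ W, H' t) ≤
      (∏ j, σ j) * ∫ t in simplex m 0 T \ W, sepProd v w t * H t := by
    refine (neg_le_neg ?_).trans (neg_abs_le _)
    rw [abs_mul, hσ, one_mul, ← integral_const_mul]
    refine (norm_integral_le_integral_norm (fun t => sepProd v w t * H t)).trans ?_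
    refine setIntegral_mono_on (hint.mono_set sdiff_subset).norm
      ((hH'.mono_set sdiff_subset).const_mul _) ((measurableSet_simplex m 0 T).diff hWm)
      fun t ht => ?_
    rw [norm_mul]
    exact mul_le_mul (abs_sepProd_le hv w t) (hHH' t ht.1) (norm_nonneg _)
      (pow_nonneg hv.pos.le _)
  rw [hsplit, mul_add]
  linarith

end

section

variable {v : ℝ → Plane} {Λ : ℝ}

/-! ### Concentration implies correctness of directions and signs -/

/-- The weight outside `W` is at most `q` times the weight of `B ⊆ W`. -/
structure Window (v : ℝ → Plane) (T : ℝ) {m : ℕ} (n : ℕ) (W B : Set (Fin m → ℝ)) (q : ℝ) :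
    Prop where
  measW : MeasurableSet W
  measB : MeasurableSet B
  subW : W ⊆ simplex m 0 T
  subB : B ⊆ W
  out : ∫ t in simplex m 0 T \ W, mass v T n t ≤ q * ∫ t in B, mass v T n t
  pos : 0 < ∫ t in B, mass v T n t

variable {T q : ℝ} {m n : ℕ} {W B : Set (Fin m → ℝ)}

theorem Window.mass_le (hv : ConstSpeed v Λ) (hT : 0 ≤ T) (hW : Window v T n W B q) :
    ∫ t in B, mass v T n t ≤ ∫ t in W, mass v T n t :=
  setIntegral_mono_set ((integrableOn_mass hv hT m n).mono_set hW.subW)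
    (Eventually.of_forall fun t => mass_nonneg v T n t) hW.subB.eventuallyLE

theorem le_signed_sum_symSig (hv : ConstSpeed v Λ) (hT : 0 ≤ T) (hW : Window v T n W B q)
    {w : Fin m → Fin 2} {σ : Fin m → ℝ} (hw : GoodWord v Λ W w σ) :
    (Λ / 8) ^ m * ((∫ t in W, mass v T n t) / 2 ^ (m + 1)) -
        Λ ^ m * (q * ∫ t in B, mass v T n t) ≤
      (∏ j, σ j) * ∑ l : Fin (m + 1) → Fin (n + 1), symSig (k := m + 1) (pathSig v T) w l := by
  have h := le_signed_integral hv hW.measW hW.subW hw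
    (H := fun t => ∑ l : Fin (m + 1) → Fin (n + 1), blk v T l t) (H' := fun t => mass v T n t)
    (Finset.measurable_fun_sum _ fun l _ => measurable_blk hv T l) (integrableOn_mass hv hT m n)
    (fun t _ => Finset.sum_nonneg fun l _ => blk_nonneg v T l t)
    (fun t _ => by
      rw [abs_of_nonneg (Finset.sum_nonneg fun l _ => blk_nonneg v T l t)]
      exact sum_blk_le v T t)
  have heq : ∑ l : Fin (m + 1) → Fin (n + 1), symSig (k := m + 1) (pathSig v T) w l =
      ∫ t in simplex m 0 T,
        sepProd v w t * ∑ l : Fin (m + 1) → Fin (n + 1), blk v T l t := by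
    simp only [Finset.mul_sum, symSig_pathSig hv hT]
    exact (integral_finsetSum _ fun l _ => integrableOn_sepProd_blk hv hT w l).symm
  rw [heq]
  refine le_trans (sub_le_sub ?_ ?_) h
  · refine mul_le_mul_of_nonneg_left ?_ (by have := hv.pos; positivity)
    rw [← integral_div]
    refine setIntegral_mono_on
      (((integrableOn_mass hv hT m n).mono_set hW.subW).div_const _)
      (integrable_finsetSum _ fun l _ => (integrableOn_blk hv hT l).mono_set hW.subW)
      hW.measW fun t _ => ?_
    rw [div_le_iff₀ (by positivity), mul_comm]
    exact mass_le_sum_blk v T t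
  · exact mul_le_mul_of_nonneg_left hW.out (pow_nonneg hv.pos.le _)

/-- `le_signed_integral` for the signed sum of the `blkExtra`, which is nonnegative on `W`. The
increment of block i may be tiny on parts of `W`; the lower bound therefore keeps only `B`, where
its size is at least `lam`. -/
theorem le_signed_sum_symSigExtra (hv : ConstSpeed v Λ) (hT : 0 ≤ T) (hW : Window v T n W B q)
    {w : Fin m → Fin 2} {σ : Fin m → ℝ} (hw : GoodWord v Λ W w σ) (i : Fin (m + 1)) (a : Fin 2)
    {s lam : ℝ} (hs1 : |s| = 1) (hs : ∀ t ∈ W, 0 ≤ s * incr v 0 T t i a)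
    (hlam : ∀ t ∈ B, lam ≤ |incr v 0 T t i a|) :
    (Λ / 8) ^ m * (lam / ((2 * n + 1) * 2 ^ (m + 1)) * ∫ t in B, mass v T n t) -
        Λ ^ m * (Λ * T * (q * ∫ t in B, mass v T n t)) ≤
      (∏ j, σ j) * (s * ∑ l : Fin (m + 1) → Fin (n + 1),
        symSigExtra (k := m + 1) (pathSig v T) i a w l) := by
  have hmeas : Measurable fun t : Fin m → ℝ =>
      s * ∑ l : Fin (m + 1) → Fin (n + 1), blkExtra v T i a l t :=
    (Finset.measurable_fun_sum _ fun l _ => measurable_blkExtra hv T i a l).const_mul s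
  have hle : ∀ t ∈ simplex m 0 T, |s * ∑ l : Fin (m + 1) → Fin (n + 1), blkExtra v T i a l t| ≤
      Λ * T * mass v T n t := by
    intro t ht
    rw [abs_mul, hs1, one_mul]
    refine (abs_sum_blkExtra_le v T i a t).trans ?_
    exact mul_le_mul_of_nonneg_right ((abs_le_dnorm _ a).trans (dnorm_incr_le hv hT ht i))
      (mass_nonneg _ _ _ _)
  have hH' : IntegrableOn (fun t : Fin m → ℝ => Λ * T * mass v T n t) (simplex m 0 T) :=
    (integrableOn_mass hv hT m n).const_mul _
  have hnn : ∀ t ∈ W, 0 ≤ s * ∑ l : Fin (m + 1) → Fin (n + 1), blkExtra v T i a l t := by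
    intro t ht
    refine le_trans ?_ (le_sum_blkExtra v T i a (hs t ht) hs1)
    have := mass_nonneg v T n t
    positivity
  have h := le_signed_integral hv hW.measW hW.subW hw hmeas hH' hnn hle
  have heq : s * ∑ l : Fin (m + 1) → Fin (n + 1),
      symSigExtra (k := m + 1) (pathSig v T) i a w l = ∫ t in simplex m 0 T,
        sepProd v w t * (s * ∑ l : Fin (m + 1) → Fin (n + 1), blkExtra v T i a l t) := by
    simp only [symSigExtra_pathSig hv hT]
    rw [← integral_finsetSum _ fun l _ => integrableOn_sepProd_blkExtra hv hT i a w l,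
      ← integral_const_mul]
    congr 1
    ext t
    simp only [Finset.mul_sum]
    exact Finset.sum_congr rfl fun l _ => by ring
  rw [heq]
  have hHint : IntegrableOn (fun t : Fin m → ℝ =>
      s * ∑ l : Fin (m + 1) → Fin (n + 1), blkExtra v T i a l t) (simplex m 0 T) := by
    refine hH'.mono' hmeas.aestronglyMeasurable ?_
    filter_upwards [ae_restrict_mem (measurableSet_simplex m 0 T)] with t ht
    exact hle t ht
  refine le_trans (sub_le_sub ?_ ?_) h
  · refine mul_le_mul_of_nonneg_left ?_ (by have := hv.pos; positivity)
    have hmono : ∫ t in B, s * ∑ l : Fin (m + 1) → Fin (n + 1), blkExtra v T i a l t ≤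
        ∫ t in W, s * ∑ l : Fin (m + 1) → Fin (n + 1), blkExtra v T i a l t := by
      refine setIntegral_mono_set (hHint.mono_set hW.subW) ?_ hW.subB.eventuallyLE
      filter_upwards [ae_restrict_mem hW.measW] with t ht
      exact hnn t ht
    refine le_trans ?_ hmono
    rw [← integral_const_mul]
    refine setIntegral_mono_on
      (((integrableOn_mass hv hT m n).mono_set (hW.subB.trans hW.subW)).const_mul _)
      (hHint.mono_set (hW.subB.trans hW.subW)) hW.measB fun t ht => ?_
    refine le_trans ?_ (le_sum_blkExtra v T i a (hs t (hW.subB ht)) hs1)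
    refine mul_le_mul_of_nonneg_right ?_ (mass_nonneg _ _ _ _)
    exact div_le_div_of_nonneg_right (hlam t ht) (by positivity)
  · rw [integral_const_mul]
    refine mul_le_mul_of_nonneg_left ?_ (pow_nonneg hv.pos.le _)
    exact mul_le_mul_of_nonneg_left hW.out (mul_nonneg hv.pos.le hT)

/-- Origin of the factor 16^k: 8 per separator from the smallest admissible velocity coordinate, 2
per block from the restriction to even counts. -/
theorem pow_div_eight (Λ : ℝ) (m : ℕ) (x : ℝ) :
    (Λ / 8) ^ m * (x / 2 ^ (m + 1)) = 8 * (Λ ^ m / 16 ^ (m + 1) * x) := by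
  have h : (16 : ℝ) ^ (m + 1) = 8 ^ m * 8 * 2 ^ (m + 1) := by
    rw [← pow_succ, ← mul_pow]
    norm_num
  rw [div_pow, h]
  field_simp

theorem sum_symSig_pos (hv : ConstSpeed v Λ) (hT : 0 ≤ T) (hW : Window v T n W B q)
    (hq : q ≤ 1 / (8 * 16 ^ (m + 1)))
    {w : Fin m → Fin 2} {σ : Fin m → ℝ} (hw : GoodWord v Λ W w σ) :
    7 * (Λ ^ m / 16 ^ (m + 1) * ∫ t in W, mass v T n t) ≤
      (∏ j, σ j) * ∑ l : Fin (m + 1) → Fin (n + 1), symSig (k := m + 1) (pathSig v T) w l := by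
  refine le_trans ?_ (le_signed_sum_symSig hv hT hW hw)
  rw [pow_div_eight]
  -- In units of Λ^m / 16^(m+1) times the weight of `W`, the main term is 8 and the part off the
  -- window at most 1/8, which leaves more than 7.
  have h1 : q * ∫ t in B, mass v T n t ≤ 1 / (8 * 16 ^ (m + 1)) * ∫ t in W, mass v T n t :=
    mul_le_mul hq (hW.mass_le hv hT) hW.pos.le (by positivity)
  have h2 := mul_le_mul_of_nonneg_left h1 (pow_nonneg hv.pos.le m)
  have h3 : Λ ^ m * (1 / (8 * 16 ^ (m + 1)) * ∫ t in W, mass v T n t) =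
      1 / 8 * (Λ ^ m / 16 ^ (m + 1) * ∫ t in W, mass v T n t) := by
    field_simp
  have h4 : 0 ≤ Λ ^ m / 16 ^ (m + 1) * ∫ t in W, mass v T n t :=
    mul_nonneg (div_nonneg (pow_nonneg hv.pos.le _) (by positivity))
      (hW.pos.le.trans (hW.mass_le hv hT))
  linarith

/-- For t in `W`, an index at distance at least β + μ from α is at distance at least μ from the true
ratio |d 0| / dnorm d, so the binomial tail applies. Off `W` all indices are admitted and
`Window.out` bounds the total. -/
theorem sum_abs_symSig_bad_le (hv : ConstSpeed v Λ) (hT : 0 ≤ T) (hW : Window v T n W B q)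
    (hn : 0 < n) (i : Fin (m + 1)) {α β μ : ℝ} (hμ0 : 0 ≤ μ) (hμ2 : μ ≤ 2)
    (hwin : ∀ t ∈ W, 0 < dnorm (incr v 0 T t i) ∧
      |(|incr v 0 T t i 0|) - α * dnorm (incr v 0 T t i)| ≤ β * dnorm (incr v 0 T t i)) :
    ∑ w : Fin m → Fin 2, ∑ l : Fin (m + 1) → Fin (n + 1) with
        ¬ |((l i : ℕ) : ℝ) / (n : ℝ) - α| < β + μ, |symSig (k := m + 1) (pathSig v T) w l| ≤
      Λ ^ m * (2 * Real.exp (-(n * μ ^ 2 / 2)) * (∫ t in W, mass v T n t) +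
        q * ∫ t in B, mass v T n t) := by
  refine (sum_abs_symSig_le hv hT _).trans ?_
  refine mul_le_mul_of_nonneg_left ?_ (pow_nonneg hv.pos.le _)
  set A : Finset (Fin (m + 1) → Fin (n + 1)) := Finset.univ.filter fun l =>
    ¬ |((l i : ℕ) : ℝ) / (n : ℝ) - α| < β + μ with hA
  have hint : IntegrableOn (fun t : Fin m → ℝ => ∑ l ∈ A, blk v T l t) (simplex m 0 T) :=
    integrable_finsetSum _ fun l _ => integrableOn_blk hv hT l
  have hM := integrableOn_mass hv hT m n
  have hsplit : ∫ t in simplex m 0 T, ∑ l ∈ A, blk v T l t =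
      (∫ t in W, ∑ l ∈ A, blk v T l t) + ∫ t in simplex m 0 T \ W, ∑ l ∈ A, blk v T l t := by
    rw [← setIntegral_union disjoint_sdiff_right ((measurableSet_simplex m 0 T).diff hW.measW)
      (hint.mono_set hW.subW) (hint.mono_set sdiff_subset), union_sdiff_cancel hW.subW]
  rw [hsplit]
  refine add_le_add ?_ (le_trans ?_ hW.out)
  · rw [← integral_const_mul]
    refine setIntegral_mono_on (hint.mono_set hW.subW) ((hM.mono_set hW.subW).const_mul _)
      hW.measW fun t ht => ?_
    obtain ⟨hpos, hr⟩ := hwin t ht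
    refine sum_blk_filter_le v T t i (fun l : Fin (n + 1) =>
      ¬ |((l : ℕ) : ℝ) / (n : ℝ) - α| < β + μ) ?_
    refine sum_tail_mon_le hpos hμ0 hμ2 _ fun l hl => ?_
    have hl' : β + μ ≤ |((l : ℕ) : ℝ) / (n : ℝ) - α| := by simpa using hl
    have hn' : (0 : ℝ) < n := by exact_mod_cast hn
    set p := |incr v 0 T t i 0| / dnorm (incr v 0 T t i) with hp
    have hpα : |p - α| ≤ β := by
      have : p - α = (|incr v 0 T t i 0| - α * dnorm (incr v 0 T t i)) /
          dnorm (incr v 0 T t i) := by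
        rw [hp]
        field_simp
      rw [this, abs_div, abs_of_pos hpos, div_le_iff₀ hpos]
      exact hr
    have h1 : μ ≤ |((l : ℕ) : ℝ) / (n : ℝ) - p| := by
      have := abs_sub_le (((l : ℕ) : ℝ) / (n : ℝ)) p α
      linarith
    have h2 : ((l : ℕ) : ℝ) - n * p = n * (((l : ℕ) : ℝ) / (n : ℝ) - p) := by
      field_simp
    rw [h2, abs_mul, abs_of_pos hn']
    exact mul_le_mul_of_nonneg_left h1 hn'.le
  · refine setIntegral_mono_on (hint.mono_set sdiff_subset) (hM.mono_set sdiff_subset)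
      ((measurableSet_simplex m 0 T).diff hW.measW) fun t _ => ?_
    exact (Finset.sum_le_univ_sum_of_nonneg fun l => blk_nonneg v T l t).trans (sum_blk_le v T t)

/-- With X = Λ^m / 16^(m+1) times the weight of the window, the total mass is at least 7X because a
good word sees no cancellation, whereas the indices outside the tolerance carry at most X/4. -/
theorem half_lt_direction_mass (hv : ConstSpeed v Λ) (hT : 0 ≤ T) (hW : Window v T n W B q)
    (hq : q ≤ 1 / (8 * 16 ^ (m + 1)))
    {w : Fin m → Fin 2} {σ : Fin m → ℝ} (hw : GoodWord v Λ W w σ)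
    (hn : 0 < n) (i : Fin (m + 1)) {α β μ : ℝ} (hμ0 : 0 ≤ μ) (hμ2 : μ ≤ 2)
    (hμ : 2 * Real.exp (-(n * μ ^ 2 / 2)) ≤ 1 / (8 * 16 ^ (m + 1)))
    (hwin : ∀ t ∈ W, 0 < dnorm (incr v 0 T t i) ∧
      |(|incr v 0 T t i 0|) - α * dnorm (incr v 0 T t i)| ≤ β * dnorm (incr v 0 T t i)) :
    1 / 2 < (∑ w : Fin m → Fin 2, ∑ l : Fin (m + 1) → Fin (n + 1) with
          |((l i : ℕ) : ℝ) / (n : ℝ) - α| < β + μ, |symSig (k := m + 1) (pathSig v T) w l|) /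
        (∑ w : Fin m → Fin 2, ∑ l : Fin (m + 1) → Fin (n + 1),
          |symSig (k := m + 1) (pathSig v T) w l|) := by
  set X := Λ ^ m / 16 ^ (m + 1) * ∫ t in W, mass v T n t with hX
  have hIW : 0 < ∫ t in W, mass v T n t := hW.pos.trans_le (hW.mass_le hv hT)
  have hXpos : 0 < X := mul_pos (div_pos (pow_pos hv.pos _) (by positivity)) hIW
  have hσ : |∏ j, σ j| = 1 := by
    rw [Finset.abs_prod]
    exact Finset.prod_eq_one fun j _ => (hw j).1
  have htot : 7 * X ≤ ∑ w : Fin m → Fin 2, ∑ l : Fin (m + 1) → Fin (n + 1),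
      |symSig (k := m + 1) (pathSig v T) w l| := by
    refine (sum_symSig_pos hv hT hW hq hw).trans ((le_abs_self _).trans ?_)
    rw [abs_mul, hσ, one_mul]
    refine (Finset.abs_sum_le_sum_abs _ _).trans ?_
    exact Finset.single_le_sum (f := fun w : Fin m → Fin 2 =>
      ∑ l : Fin (m + 1) → Fin (n + 1), |symSig (k := m + 1) (pathSig v T) w l|)
      (fun w _ => Finset.sum_nonneg fun l _ => abs_nonneg _) (Finset.mem_univ w)
  have hbad := sum_abs_symSig_bad_le hv hT hW hn i hμ0 hμ2 hwin
  have hbad2 : Λ ^ m * (2 * Real.exp (-(n * μ ^ 2 / 2)) * (∫ t in W, mass v T n t) +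
        q * ∫ t in B, mass v T n t) ≤ X / 4 := by
    have h1 : q * ∫ t in B, mass v T n t ≤ 1 / (8 * 16 ^ (m + 1)) * ∫ t in W, mass v T n t :=
      mul_le_mul hq (hW.mass_le hv hT) hW.pos.le (by positivity)
    have h2 := mul_le_mul_of_nonneg_right hμ hIW.le
    refine (mul_le_mul_of_nonneg_left (add_le_add h2 h1) (pow_nonneg hv.pos.le m)).trans
      (le_of_eq ?_)
    rw [hX]
    ring
  have hsum : ∀ w : Fin m → Fin 2, (∑ l : Fin (m + 1) → Fin (n + 1),
      |symSig (k := m + 1) (pathSig v T) w l|) =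
      (∑ l : Fin (m + 1) → Fin (n + 1) with |((l i : ℕ) : ℝ) / (n : ℝ) - α| < β + μ,
        |symSig (k := m + 1) (pathSig v T) w l|) +
      ∑ l : Fin (m + 1) → Fin (n + 1) with ¬ |((l i : ℕ) : ℝ) / (n : ℝ) - α| < β + μ,
        |symSig (k := m + 1) (pathSig v T) w l| :=
    fun w => (Finset.sum_filter_add_sum_filter_not _ _ _).symm
  rw [Finset.sum_congr rfl fun w _ => hsum w, Finset.sum_add_distrib] at htot ⊢
  rw [lt_div_iff₀ (by linarith)]
  linarith

/-- Two sets of indices that each carry more than half of the same total must meet; a common index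
links ρ i to α by the triangle inequality. -/
theorem exists_common_index {k : ℕ} {X : Series} {θ : ℝ} {ρ : Fin k → ℝ}
    (hρ : IsDirections X n θ ρ) (i : Fin k) {α r : ℝ}
    (h : 1 / 2 < (∑ w : Fin (k - 1) → Fin 2, ∑ l : Fin k → Fin (n + 1) with
          |((l i : ℕ) : ℝ) / (n : ℝ) - α| < r, |symSig X w l|) /
        (∑ w : Fin (k - 1) → Fin 2, ∑ l : Fin k → Fin (n + 1), |symSig X w l|)) :
    |ρ i - α| < θ + r := by
  have h' := (hρ i).2
  set D := ∑ w : Fin (k - 1) → Fin 2, ∑ l : Fin k → Fin (n + 1), |symSig X w l| with hD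
  -- A zero denominator would give the quotient the value 0, contradicting `h`.
  have hD0 : 0 < D := by
    have h0 : 0 ≤ D := Finset.sum_nonneg fun _ _ => Finset.sum_nonneg fun _ _ => abs_nonneg _
    refine lt_of_le_of_ne h0 fun h0 => ?_
    rw [← h0, div_zero] at h
    norm_num at h
  rw [lt_div_iff₀ hD0] at h h'
  have hex : ∃ l : Fin k → Fin (n + 1), |((l i : ℕ) : ℝ) / (n : ℝ) - α| < r ∧
      |((l i : ℕ) : ℝ) / (n : ℝ) - ρ i| < θ := by
    by_contra! hne
    have hle : (∑ w : Fin (k - 1) → Fin 2, ∑ l : Fin k → Fin (n + 1) with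
          |((l i : ℕ) : ℝ) / (n : ℝ) - α| < r, |symSig X w l|) +
        (∑ w : Fin (k - 1) → Fin 2, ∑ l : Fin k → Fin (n + 1) with
          |((l i : ℕ) : ℝ) / (n : ℝ) - ρ i| < θ, |symSig X w l|) ≤ D := by
      rw [← Finset.sum_add_distrib]
      refine Finset.sum_le_sum fun w _ => ?_
      rw [← Finset.sum_union]
      · exact Finset.sum_le_univ_sum_of_nonneg fun l => abs_nonneg _
      · refine Finset.disjoint_left.2 fun l hl hl' => ?_
        simp only [Finset.mem_filter, Finset.mem_univ, true_and] at hl hl'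
        exact absurd hl' (not_lt.2 (hne l hl))
    linarith
  obtain ⟨l, h1, h2⟩ := hex
  have := abs_sub_le (ρ i) (((l i : ℕ) : ℝ) / (n : ℝ)) α
  rw [abs_sub_comm (ρ i) (((l i : ℕ) : ℝ) / (n : ℝ))] at this
  linarith

/-- Numerator and denominator of the quotient in `sgn` carry the same unknown sign ∏ σ j, which
cancels and leaves the sign s of the increment. The last hypothesis says that the leaked weight is
too small to reverse the sign of the denominator. -/
theorem sgn_eq (hv : ConstSpeed v Λ) (hT : 0 ≤ T) (hW : Window v T n W B q)
    (hq : q ≤ 1 / (8 * 16 ^ (m + 1))) {ρ : Fin (m + 1) → ℝ} {σ : Fin m → ℝ}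
    (hw : GoodWord v Λ W (chosenWord (k := m + 1) ρ) σ) (i : Fin (m + 1)) (a : Fin 2)
    {s lam : ℝ} (hs1 : s = 1 ∨ s = -1) (hs : ∀ t ∈ W, 0 ≤ s * incr v 0 T t i a)
    (hlam : ∀ t ∈ B, lam ≤ |incr v 0 T t i a|)
    (hqlam : 16 ^ (m + 1) * (Λ * T) * q * (2 * n + 1) < 8 * lam) :
    sgn (pathSig v T) n ρ i a = s := by
  have hs1' : |s| = 1 := by rcases hs1 with rfl | rfl <;> simp
  have hΛ := hv.pos
  have hIB := hW.pos
  have hIW : 0 < ∫ t in W, mass v T n t := hW.pos.trans_le (hW.mass_le hv hT)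
  have hA : 0 < (∏ j, σ j) * ∑ l : Fin (m + 1) → Fin (n + 1),
      symSig (k := m + 1) (pathSig v T) (chosenWord (k := m + 1) ρ) l :=
    lt_of_lt_of_le (by positivity) (sum_symSig_pos hv hT hW hq hw)
  have hE : 0 < (∏ j, σ j) * (s * ∑ l : Fin (m + 1) → Fin (n + 1),
      symSigExtra (k := m + 1) (pathSig v T) i a (chosenWord (k := m + 1) ρ) l) := by
    refine lt_of_lt_of_le ?_ (le_signed_sum_symSigExtra hv hT hW hw i a hs1' hs hlam)
    have h1 : (Λ / 8) ^ m * (lam / ((2 * n + 1) * 2 ^ (m + 1)) * ∫ t in B, mass v T n t) =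
        8 * (Λ ^ m / 16 ^ (m + 1) * (lam / (2 * n + 1) * ∫ t in B, mass v T n t)) := by
      rw [← pow_div_eight]
      field_simp
    rw [h1, sub_pos]
    have h2 : Λ * T * q < 8 * lam / (16 ^ (m + 1) * (2 * n + 1)) := by
      rw [lt_div_iff₀ (by positivity)]
      linarith
    calc Λ ^ m * (Λ * T * (q * ∫ t in B, mass v T n t))
        = (Λ * T * q) * (Λ ^ m * ∫ t in B, mass v T n t) := by ring
      _ < 8 * lam / (16 ^ (m + 1) * (2 * n + 1)) * (Λ ^ m * ∫ t in B, mass v T n t) :=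
          mul_lt_mul_of_pos_right h2 (by positivity)
      _ = _ := by
          field_simp
  set P := ∏ j, σ j
  set S := ∑ l : Fin (m + 1) → Fin (n + 1),
      symSig (k := m + 1) (pathSig v T) (chosenWord (k := m + 1) ρ) l with hS
  set E := ∑ l : Fin (m + 1) → Fin (n + 1),
      symSigExtra (k := m + 1) (pathSig v T) i a (chosenWord (k := m + 1) ρ) l with hE'
  have hdef : sgn (pathSig v T) n ρ i a = if 0 ≤ S / E then 1 else -1 := rfl
  rw [hdef]
  have hprod : 0 < S * (s * E) := by
    have h3 : 0 < (P * S) * (P * (s * E)) := mul_pos hA hE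
    have h4 : (P * S) * (P * (s * E)) = P ^ 2 * (S * (s * E)) := by ring
    rw [h4] at h3
    exact pos_of_mul_pos_right h3 (sq_nonneg _)
  rcases hs1 with rfl | rfl
  · rw [if_pos]
    have : 0 < S * E := by linarith
    exact (div_pos_iff.2 (mul_pos_iff.1 this)).le
  · rw [if_neg]
    have : S * E < 0 := by linarith
    exact not_le.2 (div_neg_iff.2 (mul_neg_iff.1 this))

end

section

variable {v : ℝ → Plane} {Λ : ℝ}

/-! ### Concentration of the separating times at the uniform grid -/

/-- Pinsker's inequality for two Bernoulli laws. As a function of P the left side is nonincreasing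
from P = p on: its derivative is -(P - p)(1 - 2P)² / (P(1 - P)). -/
theorem binary_entropy_le_of_le {p P : ℝ} (hp0 : 0 < p) (hpP : p ≤ P) (hP1 : P < 1) :
    p * Real.log P + (1 - p) * Real.log (1 - P) + 2 * (P - p) ^ 2 ≤
      p * Real.log p + (1 - p) * Real.log (1 - p) := by
  set g : ℝ → ℝ := fun x => p * Real.log x + (1 - p) * Real.log (1 - x) + 2 * (x - p) ^ 2 with hg
  have hd : ∀ x ∈ Icc p P, HasDerivAt g
      (p * x⁻¹ + (1 - p) * (-1 / (1 - x)) + 2 * (2 * (x - p))) x := by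
    intro x hx
    have hx0 : 0 < x := hp0.trans_le hx.1
    have hx1 : 0 < 1 - x := by linarith [hx.2]
    have h1 := (Real.hasDerivAt_log hx0.ne').const_mul p
    have h2 := (((hasDerivAt_id x).const_sub 1).log hx1.ne').const_mul (1 - p)
    have h3 := (((hasDerivAt_id x).sub_const p).pow 2).const_mul 2
    refine ((h1.add h2).add h3).congr_deriv ?_
    simp
  have hanti : AntitoneOn g (Icc p P) := by
    refine antitoneOn_of_deriv_nonpos (convex_Icc _ _)
      (fun x hx => (hd x hx).continuousAt.continuousWithinAt) ?_ ?_
    · intro x hx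
      exact (hd x (interior_subset hx)).differentiableAt.differentiableWithinAt
    · intro x hx
      have hx' := interior_subset hx
      rw [(hd x hx').deriv]
      have hx0 : 0 < x := hp0.trans_le hx'.1
      have hx1 : 0 < 1 - x := by linarith [hx'.2]
      have : p * x⁻¹ + (1 - p) * (-1 / (1 - x)) + 2 * (2 * (x - p)) =
          -((x - p) * (1 - 2 * x) ^ 2 / (x * (1 - x))) := by
        field_simp
        ring
      rw [this, neg_nonpos]
      have := sub_nonneg.2 hx'.1
      positivity
  have h := hanti ⟨le_rfl, hpP⟩ ⟨hpP, le_rfl⟩ hpP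
  simpa [hg] using h

theorem binary_entropy_le {p P : ℝ} (hp0 : 0 < p) (hp1 : p < 1) (hP0 : 0 < P) (hP1 : P < 1) :
    p * Real.log P + (1 - p) * Real.log (1 - P) + 2 * (P - p) ^ 2 ≤
      p * Real.log p + (1 - p) * Real.log (1 - p) := by
  rcases le_total p P with h | h
  · exact binary_entropy_le_of_le hp0 h hP1
  · have := binary_entropy_le_of_le (p := 1 - p) (P := 1 - P) (by linarith) (by linarith)
      (by linarith)
    simp only [sub_sub_cancel] at this
    nlinarith

/-- AM-GM from x/y ≤ exp(x/y - 1): the exponents sum to zero by the hypothesis on the mean. -/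
theorem prod_le_pow_mean {ι : Type*} (s : Finset ι) {x : ι → ℝ} (hx : ∀ i ∈ s, 0 ≤ x i) {y : ℝ}
    (hy : 0 < y) (hs : ∑ i ∈ s, x i = s.card * y) : ∏ i ∈ s, x i ≤ y ^ s.card := by
  have h : ∀ i ∈ s, x i ≤ y * Real.exp (x i / y - 1) := by
    intro i _
    have := Real.add_one_le_exp (x i / y - 1)
    rw [sub_add_cancel, div_le_iff₀ hy] at this
    linarith
  refine (Finset.prod_le_prod hx h).trans (le_of_eq ?_)
  rw [Finset.prod_mul_distrib, ← Real.exp_sum, Finset.sum_sub_distrib, ← Finset.sum_div, hs]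
  simp [hy.ne']

/-- AM-GM is applied separately to the steps before and after knot i. What remains is the loss from
dividing [0, T] at f i instead of iT/k; its logarithm is -k times the relative entropy of i/k with
respect to f i / T, to which Pinsker's inequality applies. -/
theorem prod_steps_le {k i : ℕ} (hi : 0 < i) (hik : i < k) {f : ℕ → ℝ} {T ε : ℝ} (hT : 0 < T)
    (hf : ∀ j < k, f j ≤ f (j + 1)) (hf0 : f 0 = 0) (hfk : f k = T) (hfi0 : 0 < f i)
    (hfiT : f i < T) (hε0 : 0 ≤ ε) (hε : ε ≤ |f i - i * T / k|) :
    ∏ j ∈ Finset.range k, (f (j + 1) - f j) ≤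
      (T / k) ^ k * Real.exp (-(2 * k * ε ^ 2 / T ^ 2)) := by
  have hk : (0 : ℝ) < k := by exact_mod_cast hi.trans hik
  have hi' : (0 : ℝ) < i := by exact_mod_cast hi
  have hki : (0 : ℝ) < k - i := by
    have : (i : ℝ) < k := by exact_mod_cast hik
    linarith
  have hcard : ((Finset.Ico i k).card : ℝ) = k - i := by
    rw [Nat.card_Ico, Nat.cast_sub hik.le]
  rw [← Finset.prod_range_mul_prod_Ico _ hik.le]
  have h1 : ∏ j ∈ Finset.range i, (f (j + 1) - f j) ≤ (f i / i) ^ i := by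
    have := prod_le_pow_mean (Finset.range i) (x := fun j => f (j + 1) - f j) (y := f i / i)
      (fun j hj => sub_nonneg.2 (hf j ((Finset.mem_range.1 hj).trans hik))) (by positivity) (by
        rw [Finset.sum_range_sub, hf0, Finset.card_range]
        field_simp
        ring)
    rwa [Finset.card_range] at this
  have h2 : ∏ j ∈ Finset.Ico i k, (f (j + 1) - f j) ≤ ((T - f i) / (k - i)) ^ (k - i) := by
    have := prod_le_pow_mean (Finset.Ico i k) (x := fun j => f (j + 1) - f j)
      (y := (T - f i) / (k - i))
      (fun j hj => sub_nonneg.2 (hf j (Finset.mem_Ico.1 hj).2))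
      (div_pos (by linarith) hki) (by
        rw [Finset.sum_Ico_eq_sub _ hik.le, Finset.sum_range_sub, Finset.sum_range_sub, hcard,
          hfk]
        field_simp
        ring)
    rwa [Nat.card_Ico] at this
  refine (mul_le_mul h1 h2 (Finset.prod_nonneg fun j hj =>
    sub_nonneg.2 (hf j (Finset.mem_Ico.1 hj).2)) (by positivity)).trans ?_
  have hpos1 : 0 < f i / i := by positivity
  have hpos2 : 0 < (T - f i) / (k - i) := div_pos (by linarith) hki
  rw [← Real.log_le_log_iff (by positivity) (by positivity), Real.log_mul (by positivity)
    (by positivity), Real.log_mul (by positivity) (by positivity), Real.log_pow, Real.log_pow,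
    Real.log_pow, Real.log_exp, Nat.cast_sub hik.le]
  have hent := binary_entropy_le (p := i / k) (P := f i / T) (by positivity)
    ((div_lt_one hk).2 (by linarith)) (by positivity) ((div_lt_one hT).2 hfiT)
  have e1 : 1 - (i : ℝ) / k = (k - i) / k := by
    field_simp
  have e2 : 1 - f i / T = (T - f i) / T := by
    field_simp
  have hTf : T - f i ≠ 0 := by linarith
  rw [e1, e2, Real.log_div hfi0.ne' hT.ne', Real.log_div hTf hT.ne',
    Real.log_div hi'.ne' hk.ne', Real.log_div hki.ne' hk.ne'] at hent
  rw [Real.log_div hfi0.ne' hi'.ne', Real.log_div hTf hki.ne', Real.log_div hT.ne' hk.ne']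
  have e3 : ε ^ 2 / T ^ 2 ≤ (f i / T - i / k) ^ 2 := by
    have : f i / T - i / k = (f i - i * T / k) / T := by
      field_simp
    rw [this, div_pow, ← sq_abs (f i - i * T / k)]
    gcongr
  have e4 := mul_le_mul_of_nonneg_left hent hk.le
  have e5 := mul_le_mul_of_nonneg_left e3 hk.le
  have e6 : k * (i / k * (Real.log (f i) - Real.log T) +
      (k - i) / k * (Real.log (T - f i) - Real.log T) + 2 * (f i / T - i / k) ^ 2) =
      i * (Real.log (f i) - Real.log T) +
      (k - i) * (Real.log (T - f i) - Real.log T) + 2 * (k * (f i / T - i / k) ^ 2) := by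
    field_simp
  have e7 : k * (i / k * (Real.log i - Real.log k) +
      (k - i) / k * (Real.log (k - i) - Real.log k)) =
      i * (Real.log i - Real.log k) + (k - i) * (Real.log (k - i) - Real.log k) := by
    field_simp
  rw [e6, e7] at e4
  have e8 : 2 * k * ε ^ 2 / T ^ 2 = 2 * (k * (ε ^ 2 / T ^ 2)) := by ring
  rw [e8]
  linarith

/-- The knots `0, t_0, …, t_{m-1}, T` as a sequence. -/
def knotSeq (T : ℝ) {m : ℕ} (t : Fin m → ℝ) (j : ℕ) : ℝ :=
  if j = 0 then 0 else if h : j - 1 < m then t ⟨j - 1, h⟩ else T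

theorem cons_eq_knotSeq (T : ℝ) {m : ℕ} (t : Fin m → ℝ) (j : Fin (m + 1)) :
    (Fin.cons 0 t : Fin (m + 1) → ℝ) j = knotSeq T t j := by
  induction j using Fin.cases with
  | zero => simp [knotSeq]
  | succ j => simp [knotSeq]

theorem snoc_eq_knotSeq (T : ℝ) {m : ℕ} (t : Fin m → ℝ) (j : Fin (m + 1)) :
    (Fin.snoc t T : Fin (m + 1) → ℝ) j = knotSeq T t (j + 1) := by
  induction j using Fin.lastCases with
  | last => simp [knotSeq]
  | cast j => simp [knotSeq]

/-- The length of the `j`-th time interval. -/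
def gap (T : ℝ) {m : ℕ} (t : Fin m → ℝ) (j : Fin (m + 1)) : ℝ :=
  (Fin.snoc t T : Fin (m + 1) → ℝ) j - (Fin.cons 0 t : Fin (m + 1) → ℝ) j

theorem gap_nonneg {T : ℝ} (hT : 0 ≤ T) {m : ℕ} {t : Fin m → ℝ} (ht : t ∈ simplex m 0 T)
    (j : Fin (m + 1)) : 0 ≤ gap T t j :=
  sub_nonneg.2 (knots_mem hT ht j).2.1

theorem prod_gap_le {T ε : ℝ} (hT : 0 < T) (hε0 : 0 ≤ ε) {m : ℕ} {t : Fin m → ℝ}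
    (ht : t ∈ simplex m 0 T) (i : Fin m)
    (hi : ε ≤ |t i - ((i : ℕ) + 1) * T / ((m : ℝ) + 1)|) :
    ∏ j, gap T t j ≤ (T / (m + 1)) ^ (m + 1) *
      Real.exp (-(2 * (m + 1) * ε ^ 2 / T ^ 2)) := by
  have h1 : ∏ j, gap T t j =
      ∏ j ∈ Finset.range (m + 1), (knotSeq T t (j + 1) - knotSeq T t j) := by
    rw [← Fin.prod_univ_eq_prod_range (fun j => knotSeq T t (j + 1) - knotSeq T t j)]
    refine Finset.prod_congr rfl fun j _ => ?_
    rw [gap, snoc_eq_knotSeq, cons_eq_knotSeq T]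
  have hki : knotSeq T t (i + 1) = t i := by simp [knotSeq]
  have h := prod_steps_le (k := m + 1) (i := i + 1) (f := knotSeq T t) (T := T) (ε := ε)
    (Nat.succ_pos _) (Nat.succ_lt_succ i.2) hT ?_ (by simp [knotSeq]) (by simp [knotSeq])
    (by rw [hki]; exact (ht.2 i).1) (by rw [hki]; exact (ht.2 i).2) hε0
    (by rw [hki]; push_cast; exact hi)
  · rw [h1]
    push_cast at h
    exact h
  · intro j hj
    have := (knots_mem hT.le ht ⟨j, hj⟩).2.1
    rwa [snoc_eq_knotSeq, cons_eq_knotSeq T] at this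

/-- The separating times that are within `ε` of the uniform grid. -/
def gridWindow (T ε : ℝ) (m : ℕ) : Set (Fin m → ℝ) :=
  {t | t ∈ simplex m 0 T ∧ ∀ i : Fin m, |t i - ((i : ℕ) + 1) * T / ((m : ℝ) + 1)| ≤ ε}

/-- The box of radius `r` around the uniform grid. -/
def gridBox (T r : ℝ) (m : ℕ) : Set (Fin m → ℝ) :=
  Icc (fun i => ((i : ℕ) + 1) * T / ((m : ℝ) + 1) - r)
    (fun i => ((i : ℕ) + 1) * T / ((m : ℝ) + 1) + r)

theorem measurableSet_gridWindow (T ε : ℝ) (m : ℕ) : MeasurableSet (gridWindow T ε m) := by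
  have h : gridWindow T ε m = simplex m 0 T ∩
      ⋂ i : Fin m, {t | |t i - ((i : ℕ) + 1) * T / ((m : ℝ) + 1)| ≤ ε} := by
    ext
    simp [gridWindow]
  rw [h]
  refine (measurableSet_simplex m 0 T).inter ?_
  exact MeasurableSet.iInter fun i => measurableSet_le
    (continuous_abs.measurable.comp ((measurable_pi_apply i).sub_const _)) measurable_const

theorem abs_sub_le_of_mem_gridBox {T r : ℝ} {m : ℕ} {t : Fin m → ℝ} (ht : t ∈ gridBox T r m)
    (i : Fin m) : |t i - ((i : ℕ) + 1) * T / ((m : ℝ) + 1)| ≤ r := by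
  have h1 := ht.1 i
  have h2 := ht.2 i
  simp only at h1 h2
  rw [abs_le]
  constructor <;> linarith

theorem gridBox_subset_simplex {T r : ℝ} {m : ℕ} (hT : 0 < T) (hr : 2 * r < T / (m + 1)) :
    gridBox T r m ⊆ simplex m 0 T := by
  intro t ht
  have h := fun i => abs_le.1 (abs_sub_le_of_mem_gridBox ht i)
  have hm : (0 : ℝ) < m + 1 := by positivity
  have hg : ∀ x : ℝ, x * T / ((m : ℝ) + 1) = x * (T / (m + 1)) := fun x => by ring
  have hδ : 0 < T / ((m : ℝ) + 1) := by positivity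
  have hmT : ((m : ℝ) + 1) * (T / (m + 1)) = T := by field_simp
  simp only [hg] at h
  have h0r : ∀ i : Fin m, 0 ≤ r := fun i => by linarith [h i]
  refine ⟨fun i j hij => ?_, fun i => ⟨?_, ?_⟩⟩
  · have h1 := (h i).2
    have h2 := (h j).1
    have hij' : ((i : ℕ) : ℝ) + 1 ≤ (j : ℕ) := by exact_mod_cast hij
    nlinarith
  · have h1 := (h i).1
    have h2 : (0 : ℝ) ≤ (i : ℕ) := Nat.cast_nonneg _
    have := h0r i
    nlinarith
  · have h1 := (h i).2
    have h2 : ((i : ℕ) : ℝ) + 1 ≤ m := by exact_mod_cast i.2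
    have := h0r i
    nlinarith

theorem abs_cons_sub_le {T ε : ℝ} (hε : 0 ≤ ε) {m : ℕ} {t : Fin m → ℝ}
    (ht : ∀ i : Fin m, |t i - ((i : ℕ) + 1) * T / ((m : ℝ) + 1)| ≤ ε) (j : Fin (m + 1)) :
    |(Fin.cons 0 t : Fin (m + 1) → ℝ) j - (j : ℕ) * T / ((m : ℝ) + 1)| ≤ ε := by
  induction j using Fin.cases with
  | zero => simpa using hε
  | succ j => simpa using ht j

theorem abs_snoc_sub_le {T ε : ℝ} (hε : 0 ≤ ε) {m : ℕ} {t : Fin m → ℝ}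
    (ht : ∀ i : Fin m, |t i - ((i : ℕ) + 1) * T / ((m : ℝ) + 1)| ≤ ε) (j : Fin (m + 1)) :
    |(Fin.snoc t T : Fin (m + 1) → ℝ) j - ((j : ℕ) + 1) * T / ((m : ℝ) + 1)| ≤ ε := by
  induction j using Fin.lastCases with
  | last =>
    have hm : (m : ℝ) + 1 ≠ 0 := by positivity
    have : ((m : ℝ) + 1) * T / (m + 1) = T := by field_simp
    simpa [this] using hε
  | cast j => simpa using ht j

theorem le_gap_of_mem_gridBox {T r : ℝ} (hr : 0 ≤ r) {m : ℕ} {t : Fin m → ℝ}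
    (ht : t ∈ gridBox T r m) (j : Fin (m + 1)) : T / (m + 1) - 2 * r ≤ gap T t j := by
  have h := fun i => abs_sub_le_of_mem_gridBox ht i
  have h1 := (abs_le.1 (abs_cons_sub_le hr h j)).2
  have h2 := (abs_le.1 (abs_snoc_sub_le hr h j)).1
  have h3 : (((j : ℕ) : ℝ) + 1) * T / (m + 1) = (j : ℕ) * T / (m + 1) + T / (m + 1) := by ring
  rw [h3] at h2
  unfold gap
  linarith

theorem exp_neg_two_mul_le {x : ℝ} (h0 : 0 ≤ x) (h1 : x ≤ 1 / 2) :
    Real.exp (-(2 * x)) ≤ 1 - x := by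
  have h := Real.quadratic_le_exp_of_nonneg (x := 2 * x) (by linarith)
  rw [Real.exp_neg, inv_le_comm₀ (Real.exp_pos _) (by linarith)]
  refine le_trans ?_ h
  rw [inv_le_iff_one_le_mul₀ (by linarith)]
  nlinarith [mul_nonneg h0 (sq_nonneg x), sq_nonneg x, mul_nonneg h0 h0]

theorem volume_real_gridBox {T r : ℝ} (hr : 0 ≤ r) (m : ℕ) :
    volume.real (gridBox T r m) = (2 * r) ^ m := by
  rw [Measure.real, gridBox, Real.volume_Icc_pi, ENNReal.toReal_prod]
  have : ∀ x : ℝ, x + r - (x - r) = 2 * r := fun x => by ring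
  simp [this, ENNReal.toReal_ofReal, hr]

/-- The ratio of the weight off the window to the weight of the box. -/
def leak (k n : ℕ) : ℝ := ((k : ℝ) ^ 3 / 2) ^ (k - 1) * Real.exp (-(4 * n) + 8 * n / k)

/-- Two competing estimates of one weight. Off the window some knot is displaced by ε and the
product of the gaps is exponentially small compared with the grid. In the box the gaps are almost
T/(m+1) and the increments almost Λ times the gaps. By `hxs` the first loss exceeds the speed
deficit of the second by a factor e^{-4n}; `leak` combines this with the gap loss and the volume
ratio of simplex and box. -/
theorem window_grid (hv : ConstSpeed v Λ) {T ε : ℝ} (hT : 0 < T) {m n : ℕ} (hm : 1 ≤ m)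
    (hε : T / ((m : ℝ) + 1) ^ 3 ≤ ε) {x : Fin (m + 1) → ℝ} (hx0 : ∀ j, 0 ≤ x j)
    (hx1 : ∀ j, x j ≤ 1 / 2) (hxs : ∑ j, x j + 1 ≤ (m + 1) * ε ^ 2 / T ^ 2)
    (hlow : ∀ t ∈ gridBox T (T / ((m : ℝ) + 1) ^ 3) m, ∀ j,
      Λ * gap T t j * (1 - x j) ≤ dnorm (incr v 0 T t j)) :
    Window v T n (gridWindow T ε m) (gridBox T (T / ((m : ℝ) + 1) ^ 3) m) (leak (m + 1) n) := by
  have hΛ := hv.pos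
  have hk : (2 : ℝ) ≤ (m : ℝ) + 1 := by
    have : (1 : ℝ) ≤ m := by exact_mod_cast hm
    linarith
  have hk0 : (0 : ℝ) < (m : ℝ) + 1 := by linarith
  set r := T / ((m : ℝ) + 1) ^ 3 with hr
  have hr0 : 0 < r := by positivity
  have hrk : 2 * r = T / (m + 1) * (2 / ((m : ℝ) + 1) ^ 2) := by
    rw [hr]
    field_simp
  have hy1 : 2 / ((m : ℝ) + 1) ^ 2 ≤ 1 / 2 := by
    rw [div_le_div_iff₀ (by positivity) (by norm_num)]
    nlinarith
  set y := 2 / ((m : ℝ) + 1) ^ 2 with hy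
  have hy0 : 0 ≤ y := by positivity
  have hTk : 0 < T / ((m : ℝ) + 1) := by positivity
  have hε0 : 0 ≤ ε := hr0.le.trans hε
  have hBs : gridBox T r m ⊆ simplex m 0 T := by
    refine gridBox_subset_simplex hT ?_
    rw [hrk]
    nlinarith
  have hBW : gridBox T r m ⊆ gridWindow T ε m := fun t ht =>
    ⟨hBs ht, fun i => (abs_sub_le_of_mem_gridBox ht i).trans hε⟩
  -- The weight that equal gaps and undiminished increments would give; both estimates are relative
  -- to it.
  set M : ℝ := ∏ _j : Fin (m + 1), (Λ * (T / (m + 1))) ^ (2 * n) / ((2 * n).factorial : ℝ) with hM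
  have hMpos : 0 < M := Finset.prod_pos fun _ _ => by positivity
  have hout : ∀ t ∈ simplex m 0 T \ gridWindow T ε m,
      mass v T n t ≤ M * Real.exp (-(4 * n * (m + 1) * ε ^ 2 / T ^ 2)) := by
    rintro t ⟨ht, htW⟩
    obtain ⟨i, hi⟩ : ∃ i : Fin m, ε ≤ |t i - ((i : ℕ) + 1) * T / ((m : ℝ) + 1)| := by
      by_contra! h
      exact htW ⟨ht, fun i => (h i).le⟩
    have h1 : mass v T n t ≤
        ∏ j : Fin (m + 1), (Λ * gap T t j) ^ (2 * n) / ((2 * n).factorial : ℝ) := by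
      refine Finset.prod_le_prod (fun j _ => div_nonneg (pow_nonneg (dnorm_nonneg _) _)
        (Nat.cast_nonneg _)) fun j _ => ?_
      have := pow_le_pow_left₀ (dnorm_nonneg _)
        (dnorm_disp_le hv (knots_mem hT.le ht j).2.1) (2 * n)
      exact div_le_div_of_nonneg_right this (Nat.cast_nonneg _)
    refine h1.trans ?_
    have h2 := prod_gap_le hT hε0 ht i hi
    have h3 := pow_le_pow_left₀ (Finset.prod_nonneg fun j _ => gap_nonneg hT.le ht j) h2 (2 * n)
    have h4 : ∏ j : Fin (m + 1), (Λ * gap T t j) ^ (2 * n) / ((2 * n).factorial : ℝ) =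
        (∏ j, gap T t j) ^ (2 * n) *
          ∏ _j : Fin (m + 1), Λ ^ (2 * n) / ((2 * n).factorial : ℝ) := by
      rw [← Finset.prod_pow, ← Finset.prod_mul_distrib]
      exact Finset.prod_congr rfl fun j _ => by ring
    rw [h4]
    refine (mul_le_mul_of_nonneg_right h3 (Finset.prod_nonneg fun _ _ => by positivity)).trans
      (le_of_eq ?_)
    rw [mul_pow, ← Real.exp_nat_mul, hM]
    simp only [Finset.prod_const, Finset.card_univ, Fintype.card_fin]
    have e1 : ((2 * n : ℕ) : ℝ) * -(2 * ((m : ℝ) + 1) * ε ^ 2 / T ^ 2) =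
        -(4 * n * (m + 1) * ε ^ 2 / T ^ 2) := by
      push_cast
      ring
    rw [e1]
    ring
  -- Each factor 1 - x is bounded below by e^{-2x}. The gap deficit y = 2/(m+1)², raised to the
  -- power 2n over m + 1 blocks, gives 8n/(m+1); the speed deficits give 4n ∑ x j.
  have hin : ∀ t ∈ gridBox T r m,
      M * Real.exp (-(8 * n / (m + 1) + 4 * n * ∑ j, x j)) ≤ mass v T n t := by
    intro t ht
    have h1 : M * Real.exp (-(8 * n / (m + 1) + 4 * n * ∑ j, x j)) = ∏ j : Fin (m + 1),
        (Λ * (T / (m + 1)) * Real.exp (-(2 * y)) * Real.exp (-(2 * x j))) ^ (2 * n) /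
          ((2 * n).factorial : ℝ) := by
      have e : Real.exp (-(8 * n / (m + 1) + 4 * n * ∑ j, x j)) = ∏ j : Fin (m + 1),
          (Real.exp (-(2 * y)) * Real.exp (-(2 * x j))) ^ (2 * n) := by
        simp_rw [← Real.exp_add, ← Real.exp_nat_mul]
        have hneg : ∑ j, -(2 * x j) = -(2 * ∑ j, x j) := by
          rw [Finset.mul_sum, Finset.sum_neg_distrib]
        rw [← Real.exp_sum, ← Finset.mul_sum, Finset.sum_add_distrib, hneg]
        congr 1
        simp only [Finset.sum_const, Finset.card_univ, Fintype.card_fin, nsmul_eq_mul, hy]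
        push_cast
        field_simp
        ring
      rw [e, hM, ← Finset.prod_mul_distrib]
      exact Finset.prod_congr rfl fun j _ => by ring
    rw [h1]
    refine Finset.prod_le_prod (fun j _ => by positivity) fun j _ => ?_
    refine div_le_div_of_nonneg_right (pow_le_pow_left₀ (by positivity) ?_ _) (Nat.cast_nonneg _)
    refine le_trans ?_ (hlow t ht j)
    have h2 := le_gap_of_mem_gridBox hr0.le ht j
    have h3 : T / (m + 1) * Real.exp (-(2 * y)) ≤ gap T t j := by
      refine le_trans ?_ h2
      rw [hrk]
      have := mul_le_mul_of_nonneg_left (exp_neg_two_mul_le hy0 hy1) hTk.le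
      linarith
    rw [mul_assoc Λ]
    refine mul_le_mul (mul_le_mul_of_nonneg_left h3 hΛ.le) (exp_neg_two_mul_le (hx0 j) (hx1 j))
      (Real.exp_pos _).le (mul_nonneg hΛ.le (gap_nonneg hT.le (hBs ht) j))
  have hBm : MeasurableSet (gridBox T r m) := measurableSet_Icc
  have hint := integrableOn_mass hv hT.le m n
  have hB : M * Real.exp (-(8 * n / (m + 1) + 4 * n * ∑ j, x j)) * (2 * r) ^ m ≤
      ∫ t in gridBox T r m, mass v T n t := by
    rw [← volume_real_gridBox (T := T) hr0.le m]
    have := setIntegral_mono_on (μ := volume)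
      (integrableOn_const (C := M * Real.exp (-(8 * n / (m + 1) + 4 * n * ∑ j, x j)))
        (s := gridBox T r m) (by exact isCompact_Icc.measure_lt_top.ne)) (hint.mono_set hBs) hBm hin
    rw [setIntegral_const, smul_eq_mul] at this
    linarith
  have hO : ∫ t in simplex m 0 T \ gridWindow T ε m, mass v T n t ≤
      M * Real.exp (-(4 * n * (m + 1) * ε ^ 2 / T ^ 2)) * T ^ m := by
    have hfin : volume (simplex m 0 T \ gridWindow T ε m) ≠ ⊤ :=
      ((measure_mono sdiff_subset).trans_lt (volume_simplex_lt_top m 0 T)).ne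
    have := setIntegral_mono_on (μ := volume) (hint.mono_set sdiff_subset)
      (integrableOn_const (C := M * Real.exp (-(4 * n * (m + 1) * ε ^ 2 / T ^ 2)))
        (s := simplex m 0 T \ gridWindow T ε m) hfin)
      ((measurableSet_simplex m 0 T).diff (measurableSet_gridWindow T ε m)) hout
    rw [setIntegral_const, smul_eq_mul] at this
    refine this.trans ?_
    rw [mul_comm]
    refine mul_le_mul_of_nonneg_left ?_ (by positivity)
    refine (measureReal_mono sdiff_subset (volume_simplex_lt_top m 0 T).ne).trans ?_
    exact volume_real_simplex_le m hT.le
  refine ⟨measurableSet_gridWindow T ε m, hBm, fun t ht => ht.1, hBW, ?_, ?_⟩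
  · refine hO.trans (le_trans ?_ (mul_le_mul_of_nonneg_left hB (by unfold leak; positivity)))
    -- `leak` cancels the gap loss and trades the box volume (2r)^m for the bound T^m on the
    -- simplex, leaving the surplus e^{-4n}.
    have e1 : leak (m + 1) n * (M * Real.exp (-(8 * n / (m + 1) + 4 * n * ∑ j, x j)) *
        (2 * r) ^ m) = M * Real.exp (-(4 * n * (∑ j, x j + 1))) * T ^ m := by
      have e2 : T = ((m : ℝ) + 1) ^ 3 / 2 * (2 * r) := by
        rw [hr]
        field_simp
      have e3 : Real.exp (-(4 * n * (∑ j, x j + 1))) =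
          Real.exp (-(4 * n) + 8 * n / ((m + 1 : ℕ) : ℝ)) *
            Real.exp (-(8 * n / (m + 1) + 4 * n * ∑ j, x j)) := by
        rw [← Real.exp_add]
        congr 1
        push_cast
        ring
      have e4 : T ^ m = (((m : ℝ) + 1) ^ 3 / 2) ^ m * (2 * r) ^ m := by
        rw [← mul_pow, ← e2]
      rw [leak, e3, e4, Nat.add_sub_cancel]
      push_cast
      ring
    rw [e1]
    refine mul_le_mul_of_nonneg_right (mul_le_mul_of_nonneg_left ?_ hMpos.le) (by positivity)
    refine Real.exp_le_exp.2 (neg_le_neg ?_)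
    have := mul_le_mul_of_nonneg_left hxs (by positivity : (0 : ℝ) ≤ 4 * n)
    refine this.trans (le_of_eq ?_)
    ring
  · refine lt_of_lt_of_le ?_ hB
    positivity

end

section

variable {v : ℝ → Plane} {Λ : ℝ}

/-! ### Accuracy of the directions, signs and length -/

theorem knots_lt {m : ℕ} {s T : ℝ} (hs : s < T) {t : Fin m → ℝ} (ht : t ∈ simplex m s T)
    (j : Fin (m + 1)) : (Fin.cons s t : Fin (m + 1) → ℝ) j < (Fin.snoc t T : Fin (m + 1) → ℝ) j := by
  induction j using Fin.cases with
  | zero =>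
    cases m with
    | zero => simpa [Fin.snoc] using hs
    | succ m =>
      have : (0 : Fin (m + 2)) = Fin.castSucc 0 := rfl
      rw [this, Fin.snoc_castSucc]
      simpa using (ht.2 0).1
  | succ j =>
    rw [Fin.cons_succ]
    cases m with
    | zero => exact j.elim0
    | succ m =>
      induction j using Fin.lastCases with
      | last => simpa using (ht.2 _).2
      | cast j =>
        rw [Fin.succ_castSucc, Fin.snoc_castSucc]
        exact ht.1 j.castSucc_lt_succ

theorem gap_pos {T : ℝ} (hT : 0 < T) {m : ℕ} {t : Fin m → ℝ} (ht : t ∈ simplex m 0 T)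
    (j : Fin (m + 1)) : 0 < gap T t j :=
  sub_pos.2 (knots_lt hT ht j)

/-- A displacement is close to the displacement of a nearby velocity field. -/
theorem dnorm_disp_sub_le (hv : ConstSpeed v Λ) {v' : ℝ → Plane} {Λ' : ℝ} (hv' : ConstSpeed v' Λ')
    {s t η : ℝ} (hst : s ≤ t) (h : ∀ u ∈ Icc s t, ‖v u - v' u‖ ≤ η) :
    |disp v s t 0 - disp v' s t 0| + |disp v s t 1 - disp v' s t 1| ≤ η * (t - s) := by
  have hI := fun a => (hv.intervalIntegrable a s t).sub (hv'.intervalIntegrable a s t)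
  have e : ∀ a, disp v s t a - disp v' s t a = ∫ u in s..t, (v u a - v' u a) := fun a =>
    (intervalIntegral.integral_sub (hv.intervalIntegrable a s t)
      (hv'.intervalIntegrable a s t)).symm
  have h1 := fun a => intervalIntegral.norm_integral_le_integral_norm (μ := volume)
    (f := fun u => v u a - v' u a) hst
  rw [e, e]
  calc |∫ u in s..t, (v u 0 - v' u 0)| + |∫ u in s..t, (v u 1 - v' u 1)|
      ≤ (∫ u in s..t, ‖v u 0 - v' u 0‖) + ∫ u in s..t, ‖v u 1 - v' u 1‖ := add_le_add (h1 0) (h1 1)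
    _ = ∫ u in s..t, (‖v u 0 - v' u 0‖ + ‖v u 1 - v' u 1‖) :=
        (intervalIntegral.integral_add (hI 0).norm (hI 1).norm).symm
    _ ≤ ∫ _u in s..t, η := by
        refine intervalIntegral.integral_mono_on hst ((hI 0).norm.add (hI 1).norm)
          intervalIntegrable_const fun u hu => ?_
        refine le_trans (le_of_eq ?_) (h u hu)
        rw [plane_norm]
        rfl
    _ = η * (t - s) := by
        rw [intervalIntegral.integral_const, smul_eq_mul, mul_comm]

theorem ConstSpeed.const {p : Plane} (hp : ‖p‖ = Λ) (hΛ : 0 < Λ) : ConstSpeed (fun _ => p) Λ :=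
  ⟨fun _ => measurable_const, ⟨∅, countable_empty, fun _ _ => continuousAt_const⟩, fun _ => hp, hΛ⟩

theorem disp_const (p : Plane) (s t : ℝ) (a : Fin 2) :
    disp (fun _ => p) s t a = (t - s) * p a := by
  simp [disp]

/-- Stability of the ratio |d 0| / dnorm d, with the division cleared. As η ≤ Λ/3, dnorm d is at
least (2/3)Λτ, whence the factor 3/2. -/
theorem abs_abs_sub_ratio_le {d e : Fin 2 → ℝ} {η τ : ℝ} (hτ : 0 < τ) (hΛ : 0 < Λ)
    (hη : η ≤ Λ / 3) (he : dnorm e = Λ * τ) (h : |d 0 - e 0| + |d 1 - e 1| ≤ η * τ) :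
    0 < dnorm d ∧ ∀ α β : ℝ, |(|e 0|) - α * dnorm e| ≤ β * dnorm e →
      |(|d 0|) - α * dnorm d| ≤ (β + 3 / 2 * (η / Λ)) * dnorm d := by
  have h0 := abs_abs_sub_abs_le (d 0) (e 0)
  have h1 := abs_abs_sub_abs_le (d 1) (e 1)
  unfold dnorm at *
  set a := |d 0|
  set b := |d 1|
  set A := |e 0| with hA
  set B := |e 1| with hB
  have hA0 : 0 ≤ A := abs_nonneg _
  have hB0 : 0 ≤ B := abs_nonneg _
  have hη0 : 0 ≤ η := by
    by_contra hneg
    nlinarith [abs_nonneg (d 0 - e 0), abs_nonneg (d 1 - e 1)]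
  have hlow : Λ * τ - η * τ ≤ a + b := by
    have := (abs_le.1 h0).1
    have := (abs_le.1 h1).1
    linarith
  have hητ : η * τ ≤ Λ / 3 * τ := mul_le_mul_of_nonneg_right hη hτ.le
  have hΛτ : 0 < Λ * τ := mul_pos hΛ hτ
  refine ⟨by nlinarith, fun α β hαβ => ?_⟩
  have hp : |a * (A + B) - A * (a + b)| ≤ (A + B) * (η * τ) := by
    have e1 : a * (A + B) - A * (a + b) = B * (a - A) - A * (b - B) := by ring
    rw [e1]
    refine (abs_sub _ _).trans ?_
    rw [abs_mul, abs_mul, abs_of_nonneg hA0, abs_of_nonneg hB0]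
    nlinarith [mul_le_mul_of_nonneg_left h0 hB0, mul_le_mul_of_nonneg_left h1 hA0,
      abs_nonneg (d 0 - e 0), abs_nonneg (d 1 - e 1)]
  have hab : 0 < a + b := by nlinarith
  have hk : |(a - α * (a + b)) * (A + B)| ≤ (β * (A + B)) * (a + b) + (A + B) * (η * τ) := by
    have e1 : (a - α * (a + b)) * (A + B) =
        (A - α * (A + B)) * (a + b) + (a * (A + B) - A * (a + b)) := by ring
    rw [e1]
    refine (abs_add_le _ _).trans (add_le_add ?_ hp)
    rw [abs_mul, abs_of_pos hab]
    exact mul_le_mul_of_nonneg_right hαβ hab.le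
  have hABpos : 0 < A + B := by rw [he]; exact hΛτ
  rw [abs_mul, abs_of_pos hABpos] at hk
  have hk' : |a - α * (a + b)| ≤ β * (a + b) + η * τ := by
    refine le_of_mul_le_mul_right ?_ hABpos
    linarith
  have h3 : η * τ ≤ 3 / 2 * (η / Λ) * (a + b) := by
    have e1 : 3 / 2 * (η / Λ) * (a + b) = (η * (3 / 2 * (a + b))) / Λ := by ring
    rw [e1, le_div_iff₀ hΛ]
    have : τ * Λ ≤ 3 / 2 * (a + b) := by linarith
    nlinarith
  linarith

/-- The time interval of block `j` on the uniform grid of `[0, T]`. -/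
def gridPiece (T : ℝ) {m : ℕ} (j : Fin (m + 1)) : Set ℝ :=
  Icc ((j : ℕ) * T / ((m : ℝ) + 1)) (((j : ℕ) + 1) * T / ((m : ℝ) + 1))

theorem gridPiece_subset {T : ℝ} (hT : 0 ≤ T) {m : ℕ} (j : Fin (m + 1)) :
    gridPiece T j ⊆ Icc 0 T := by
  have hm : (0 : ℝ) < m + 1 := by positivity
  refine Icc_subset_Icc (by positivity) ?_
  rw [div_le_iff₀ hm]
  have : ((j : ℕ) : ℝ) + 1 ≤ m + 1 := by exact_mod_cast j.2
  nlinarith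

theorem mem_window_interval {T ε : ℝ} (hT : 0 ≤ T) (hε : 0 ≤ ε) {m : ℕ} {t : Fin m → ℝ}
    (ht : t ∈ gridWindow T ε m) {j : Fin (m + 1)} {u s : ℝ} (hu : u ∈ gridPiece T j)
    (hs : s ∈ Icc ((Fin.cons 0 t : Fin (m + 1) → ℝ) j) ((Fin.snoc t T : Fin (m + 1) → ℝ) j)) :
    s ∈ Icc 0 T ∧ |s - u| ≤ ε + T / (m + 1) := by
  have h1 := (abs_le.1 (abs_cons_sub_le hε ht.2 j)).1
  have h2 := (abs_le.1 (abs_snoc_sub_le hε ht.2 j)).2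
  obtain ⟨k1, k2, k3⟩ := knots_mem hT ht.1 j
  have h3 : (((j : ℕ) : ℝ) + 1) * T / (m + 1) = (j : ℕ) * T / (m + 1) + T / (m + 1) := by ring
  obtain ⟨u1, u2⟩ := hu
  refine ⟨⟨k1.trans hs.1, hs.2.trans k3⟩, abs_le.2 ⟨?_, ?_⟩⟩
  · linarith [hs.1]
  · linarith [hs.2]

/-- The hypotheses under which the procedure is accurate: concentration on the window, small
oscillation `η` of the velocity on the scale of the window, and dominated error terms. -/
structure Regime (v : ℝ → Plane) (Λ T ε η q : ℝ) (m n : ℕ) : Prop where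
  speed : ConstSpeed v Λ
  T_pos : 0 < T
  m_pos : 1 ≤ m
  n_pos : 0 < n
  ε_nonneg : 0 ≤ ε
  window : Window v T n (gridWindow T ε m) (gridBox T (T / ((m : ℝ) + 1) ^ 3) m) q
  osc : ∀ s ∈ Icc 0 T, ∀ u ∈ Icc 0 T, |s - u| ≤ ε + T / (m + 1) → ‖v s - v u‖ ≤ η
  η_pos : 0 < η
  η_le : η ≤ Λ / 32
  q_le : q ≤ 1 / (8 * 16 ^ (m + 1))
  q_lt : 16 ^ (m + 1) * (Λ * T) * q * (2 * n + 1) < 8 * (T / (m + 1) * η)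

variable {T ε η q : ℝ} {m n : ℕ}

theorem Regime.incr_close (h : Regime v Λ T ε η q m n) {t : Fin m → ℝ}
    (ht : t ∈ gridWindow T ε m) {j : Fin (m + 1)} {u : ℝ} (hu : u ∈ gridPiece T j) :
    |incr v 0 T t j 0 - gap T t j * v u 0| + |incr v 0 T t j 1 - gap T t j * v u 1| ≤
      η * gap T t j := by
  have := dnorm_disp_sub_le h.speed (ConstSpeed.const (h.speed.speed u) h.speed.pos)
    (knots_mem h.T_pos.le ht.1 j).2.1 (η := η) fun s hs => by
      obtain ⟨h1, h2⟩ := mem_window_interval h.T_pos.le h.ε_nonneg ht hu hs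
      exact h.osc s h1 u (gridPiece_subset h.T_pos.le j hu) h2
  rw [disp_const, disp_const] at this
  exact this

theorem Regime.ratio_close (h : Regime v Λ T ε η q m n) {t : Fin m → ℝ}
    (ht : t ∈ gridWindow T ε m) {j : Fin (m + 1)} {u : ℝ} (hu : u ∈ gridPiece T j) :
    0 < dnorm (incr v 0 T t j) ∧
      |(|incr v 0 T t j 0|) - |v u 0| / Λ * dnorm (incr v 0 T t j)| ≤
        3 / 2 * (η / Λ) * dnorm (incr v 0 T t j) := by
  have hΛ := h.speed.pos
  have hg := gap_pos h.T_pos ht.1 j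
  have hnorm : dnorm (fun a => gap T t j * v u a) = Λ * gap T t j := by
    rw [dnorm, abs_mul, abs_mul, abs_of_pos hg, ← mul_add, ← plane_norm, h.speed.speed]
    ring
  obtain ⟨h1, h2⟩ := abs_abs_sub_ratio_le (d := incr v 0 T t j)
    (e := fun a => gap T t j * v u a) hg hΛ (by linarith [h.η_le]) hnorm (h.incr_close ht hu)
  refine ⟨h1, ?_⟩
  have := h2 (|v u 0| / Λ) 0 (by
    rw [hnorm, abs_mul, abs_of_pos hg]
    have : gap T t j * |v u 0| - |v u 0| / Λ * (Λ * gap T t j) = 0 := by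
      field_simp
      ring
    rw [this]
    simp)
  rwa [zero_add] at this

theorem exists_sign (x : ℝ) : ∃ s : ℝ, (s = 1 ∨ s = -1) ∧ s * x = |x| := by
  rcases le_total 0 x with h | h
  · exact ⟨1, Or.inl rfl, by rw [one_mul, abs_of_nonneg h]⟩
  · exact ⟨-1, Or.inr rfl, by rw [abs_of_nonpos h]; ring⟩

theorem right_mem_gridPiece (hT : 0 ≤ T) (j : Fin m) :
    ((j : ℕ) + 1) * T / ((m : ℝ) + 1) ∈ gridPiece T j.castSucc := by
  refine ⟨?_, le_rfl⟩
  have hm : (0 : ℝ) < m + 1 := by positivity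
  simp only [Fin.val_castSucc]
  gcongr
  linarith

/-- Inside the window the velocity differs from its value at the grid time by at most η ≤ Λ/32, so a
coordinate of size at least Λ/4 keeps its sign and remains above Λ/8. -/
theorem Regime.exists_goodWord (h : Regime v Λ T ε η q m n) {w : Fin m → Fin 2}
    (hw : ∀ j : Fin m, Λ / 4 ≤ |v (((j : ℕ) + 1) * T / ((m : ℝ) + 1)) (w j)|) :
    ∃ σ, GoodWord v Λ (gridWindow T ε m) w σ := by
  choose σ hσ1 hσ2 using fun j : Fin m =>
    exists_sign (v (((j : ℕ) + 1) * T / ((m : ℝ) + 1)) (w j))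
  refine ⟨σ, fun j => ?_⟩
  have hσ : |σ j| = 1 := by rcases hσ1 j with h | h <;> simp [h]
  refine ⟨hσ, fun t ht => ?_⟩
  have hu := right_mem_gridPiece (m := m) h.T_pos.le j
  set u := ((j : ℕ) + 1) * T / ((m : ℝ) + 1) with hudef
  have hT' : 0 ≤ T / ((m : ℝ) + 1) := div_nonneg h.T_pos.le (by positivity)
  have h1 := h.osc (t j) ⟨(ht.1.2 j).1.le, (ht.1.2 j).2.le⟩ u
    (gridPiece_subset h.T_pos.le _ hu) ((ht.2 j).trans (by linarith))
  have h2 : |σ j * v (t j) (w j) - σ j * v u (w j)| ≤ η := by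
    rw [← mul_sub, abs_mul, hσ, one_mul]
    exact (abs_coord_le (v (t j) - v u) (w j)).trans h1
  have h3 := (abs_le.1 h2).1
  rw [hσ2 j] at h3
  have := hw j
  have := h.η_le
  linarith [h.speed.pos]

theorem Regime.half_lt (h : Regime v Λ T ε η q m n) (i : Fin (m + 1)) {α β μ : ℝ} (hμ0 : 0 ≤ μ)
    (hμ2 : μ ≤ 2) (hμ : 2 * Real.exp (-(n * μ ^ 2 / 2)) ≤ 1 / (8 * 16 ^ (m + 1)))
    (hwin : ∀ t ∈ gridWindow T ε m, 0 < dnorm (incr v 0 T t i) ∧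
      |(|incr v 0 T t i 0|) - α * dnorm (incr v 0 T t i)| ≤ β * dnorm (incr v 0 T t i)) :
    1 / 2 < (∑ w : Fin m → Fin 2, ∑ l : Fin (m + 1) → Fin (n + 1) with
          |((l i : ℕ) : ℝ) / (n : ℝ) - α| < β + μ, |symSig (k := m + 1) (pathSig v T) w l|) /
        (∑ w : Fin m → Fin 2, ∑ l : Fin (m + 1) → Fin (n + 1),
          |symSig (k := m + 1) (pathSig v T) w l|) := by
  -- The sizes of the two coordinates add up to Λ, so one of them is at least Λ/2.
  have hex : ∀ j : Fin m, ∃ a, Λ / 4 ≤ |v (((j : ℕ) + 1) * T / ((m : ℝ) + 1)) a| := by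
    intro j
    have hn := h.speed.speed (((j : ℕ) + 1) * T / ((m : ℝ) + 1))
    rw [plane_norm] at hn
    by_contra! hlt
    have h0 := hlt 0
    have h1 := hlt 1
    linarith [h.speed.pos]
  choose w hw using hex
  obtain ⟨σ, hσ⟩ := h.exists_goodWord hw
  exact half_lt_direction_mass h.speed h.T_pos.le h.window h.q_le hσ h.n_pos i hμ0 hμ2 hμ hwin

/-- The tail condition for the binomial weights at scale `μ`. -/
def TailSmall (m n : ℕ) (μ : ℝ) : Prop :=
  2 * Real.exp (-(n * μ ^ 2 / 2)) ≤ 1 / (8 * 16 ^ (m + 1))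

theorem Regime.mass_near (h : Regime v Λ T ε η q m n) (hμ : TailSmall m n (η / (2 * Λ)))
    {j : Fin (m + 1)} {u : ℝ} (hu : u ∈ gridPiece T j) :
    1 / 2 < (∑ w : Fin m → Fin 2, ∑ l : Fin (m + 1) → Fin (n + 1) with
          |((l j : ℕ) : ℝ) / (n : ℝ) - |v u 0| / Λ| < 2 * (η / Λ),
            |symSig (k := m + 1) (pathSig v T) w l|) /
        (∑ w : Fin m → Fin 2, ∑ l : Fin (m + 1) → Fin (n + 1),
          |symSig (k := m + 1) (pathSig v T) w l|) := by
  have hΛ := h.speed.pos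
  have hη := h.η_pos
  -- The tolerance splits into 3η/(2Λ) for the variation of the direction over the window and μ =
  -- η/(2Λ) for the binomial fluctuation.
  have e : 2 * (η / Λ) = 3 / 2 * (η / Λ) + η / (2 * Λ) := by
    field_simp
    norm_num
  rw [e]
  refine h.half_lt j (by positivity) ?_ hμ fun t ht => h.ratio_close ht hu
  rw [div_le_iff₀ (by positivity)]
  linarith [h.η_le]

theorem Regime.directions_close (h : Regime v Λ T ε η q m n) (hμ : TailSmall m n (η / (2 * Λ)))
    {θ : ℝ} {ρ : Fin (m + 1) → ℝ} (hρ : IsDirections (pathSig v T) n θ ρ)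
    {j : Fin (m + 1)} {u : ℝ} (hu : u ∈ gridPiece T j) :
    |ρ j - |v u 0| / Λ| < θ + 2 * (η / Λ) :=
  exists_common_index hρ j (h.mass_near hμ hu)

/-- The unsigned coordinates of a direction. -/
theorem Regime.coord_close (h : Regime v Λ T ε η q m n) (hμ : TailSmall m n (η / (2 * Λ)))
    {θ : ℝ} {ρ : Fin (m + 1) → ℝ} (hρ : IsDirections (pathSig v T) n θ ρ)
    {j : Fin (m + 1)} {u : ℝ} (hu : u ∈ gridPiece T j) :
    |Λ * ρ j - (|v u 0|)| ≤ Λ * θ + 2 * η ∧ |Λ * (1 - ρ j) - (|v u 1|)| ≤ Λ * θ + 2 * η := by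
  have hΛ := h.speed.pos
  have h1 := mul_le_mul_of_nonneg_left (h.directions_close hμ hρ hu).le hΛ.le
  have e1 : Λ * (θ + 2 * (η / Λ)) = Λ * θ + 2 * η := by
    field_simp
  have e2 : Λ * ρ j - |v u 0| = Λ * (ρ j - |v u 0| / Λ) := by
    field_simp
  have h2 : |Λ * ρ j - (|v u 0|)| ≤ Λ * θ + 2 * η := by
    rw [e2, abs_mul, abs_of_pos hΛ, ← e1]
    exact h1
  refine ⟨h2, ?_⟩
  have hn := h.speed.speed u
  rw [plane_norm] at hn
  have e3 : Λ * (1 - ρ j) - |v u 1| = -(Λ * ρ j - |v u 0|) := by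
    linarith
  rw [e3, abs_neg]
  exact h2

/-- The chosen letter has at least 1/2 in the recovered unsigned direction. The velocity coordinate
is then at least Λ/2 - Λ/16 - Λ/16, above the threshold Λ/4 of `Regime.exists_goodWord`. -/
theorem Regime.chosenWord_good (h : Regime v Λ T ε η q m n) (hμ : TailSmall m n (η / (2 * Λ)))
    {θ : ℝ} (hθ : θ ≤ 1 / 16) {ρ : Fin (m + 1) → ℝ} (hρ : IsDirections (pathSig v T) n θ ρ) :
    ∃ σ, GoodWord v Λ (gridWindow T ε m) (chosenWord (k := m + 1) ρ) σ := by
  refine h.exists_goodWord fun j => ?_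
  have hΛ := h.speed.pos
  obtain ⟨h1, h2⟩ := h.coord_close hμ hρ (right_mem_gridPiece (m := m) h.T_pos.le j)
  have hη := h.η_le
  have hθ' := mul_le_mul_of_nonneg_left hθ hΛ.le
  have hcw : chosenWord (k := m + 1) ρ j = if 1 / 2 ≤ ρ j.castSucc then 0 else 1 := rfl
  by_cases hj : 1 / 2 ≤ ρ j.castSucc
  · rw [hcw, if_pos hj]
    have := (abs_le.1 h1).2
    nlinarith
  · rw [hcw, if_neg hj]
    have := (abs_le.1 h2).2
    nlinarith

/-- A velocity coordinate above 3η stays above 2η, with its sign, across the window, so the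
increment of the block has a constant sign there. For smaller coordinates no correct sign is needed.
-/
theorem Regime.sgn_eq_sign (h : Regime v Λ T ε η q m n) (hμ : TailSmall m n (η / (2 * Λ)))
    {θ : ℝ} (hθ : θ ≤ 1 / 16) {ρ : Fin (m + 1) → ℝ} (hρ : IsDirections (pathSig v T) n θ ρ)
    {j : Fin (m + 1)} {u : ℝ} (hu : u ∈ gridPiece T j) {a : Fin 2} (ha : 3 * η < |v u a|) :
    sgn (pathSig v T) n ρ j a * v u a = |v u a| := by
  obtain ⟨s, hs1, hs2⟩ := exists_sign (v u a)
  obtain ⟨σ, hσ⟩ := h.chosenWord_good hμ hθ hρ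
  have hsabs : |s| = 1 := by rcases hs1 with h | h <;> simp [h]
  have hη := h.η_pos
  have key : ∀ t ∈ gridWindow T ε m, gap T t j * (2 * η) ≤ s * incr v 0 T t j a := by
    intro t ht
    have hg := gap_pos h.T_pos ht.1 j
    have h1 := h.incr_close ht hu
    have h2 : |incr v 0 T t j a - gap T t j * v u a| ≤ η * gap T t j := by
      refine le_trans ?_ h1
      fin_cases a <;> simp
    have h3 : |s * incr v 0 T t j a - gap T t j * (|v u a|)| ≤ η * gap T t j := by
      have e : s * incr v 0 T t j a - gap T t j * |v u a| =
          s * (incr v 0 T t j a - gap T t j * v u a) := by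
        rw [← hs2]
        ring
      rw [e, abs_mul, hsabs, one_mul]
      exact h2
    have h4 := (abs_le.1 h3).1
    nlinarith
  have hm : (2 : ℝ) ≤ (m : ℝ) + 1 := by
    have : (1 : ℝ) ≤ m := by exact_mod_cast h.m_pos
    linarith
  -- On the box every gap is at least T/(2(m+1)), so the increment has size at least (T/(m+1))η;
  -- this is `lam`.
  have hsgn := sgn_eq h.speed h.T_pos.le h.window h.q_le hσ j a (s := s)
    (lam := T / (m + 1) * η) hs1 (fun t ht => by
      have := key t ht
      have := gap_pos h.T_pos ht.1 j
      have : 0 ≤ gap T t j * (2 * η) := by positivity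
      linarith) (fun t ht => by
      have h1 := key t (h.window.subB ht)
      have hTp := h.T_pos
      have h2 := le_gap_of_mem_gridBox (T := T) (r := T / ((m : ℝ) + 1) ^ 3) (by positivity) ht j
      have h3 : 2 * (T / ((m : ℝ) + 1) ^ 3) ≤ T / (m + 1) / 2 := by
        rw [div_div, ← mul_div_assoc, div_le_div_iff₀ (by positivity) (by positivity)]
        have : 0 < T * ((m : ℝ) + 1) := by positivity
        nlinarith [mul_le_mul_of_nonneg_left
          (by nlinarith : (4 : ℝ) ≤ ((m : ℝ) + 1) ^ 2) this.le]
      have h4 : s * incr v 0 T t j a ≤ |incr v 0 T t j a| := by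
        refine (le_abs_self _).trans ?_
        rw [abs_mul, hsabs, one_mul]
      nlinarith) h.q_lt
  rw [hsgn, hs2]

/-- A coordinate above 3η gets its correct sign and an error of at most Λθ + 2η. For a smaller one
the sign may be wrong, but Λr ≤ Λθ + 5η and |v u a| ≤ 3η, so the error is at most Λθ + 8η. Two
coordinates give the constants 2 and 16. -/
theorem Regime.direction_close (h : Regime v Λ T ε η q m n) (hμ : TailSmall m n (η / (2 * Λ)))
    {θ : ℝ} (hθ : θ ≤ 1 / 16) {ρ : Fin (m + 1) → ℝ}
    (hρ : IsDirections (pathSig v T) n θ ρ) {j : Fin (m + 1)} {u : ℝ} (hu : u ∈ gridPiece T j) :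
    ‖Λ • direction (pathSig v T) n ρ j - v u‖ ≤ 2 * Λ * θ + 16 * η := by
  have hΛ := h.speed.pos
  have hη := h.η_pos
  obtain ⟨h0, h1⟩ := h.coord_close hμ hρ hu
  obtain ⟨hρ0, hρ1⟩ := (hρ j).1
  have key : ∀ (a : Fin 2) (r : ℝ), 0 ≤ r → |Λ * r - (|v u a|)| ≤ Λ * θ + 2 * η →
      |Λ * (sgn (pathSig v T) n ρ j a * r) - v u a| ≤ Λ * θ + 8 * η := by
    intro a r hr hc
    have hsg : |sgn (pathSig v T) n ρ j a| = 1 := by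
      unfold sgn
      split_ifs <;> simp
    by_cases ha : 3 * η < |v u a|
    · have hs := h.sgn_eq_sign hμ hθ hρ hu ha
      set s := sgn (pathSig v T) n ρ j a
      have hss : s * s = 1 := by
        rw [← abs_mul_abs_self, hsg]
        norm_num
      have e : Λ * (s * r) - v u a = s * (Λ * r - |v u a|) := by
        rw [← hs]
        linear_combination (v u a) * hss
      rw [e, abs_mul, hsg, one_mul]
      linarith
    · refine (abs_sub _ _).trans ?_
      rw [abs_mul, abs_mul, hsg, one_mul, abs_of_pos hΛ, abs_of_nonneg hr]
      have := (abs_le.1 hc).2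
      linarith [not_lt.1 ha]
  have k0 := key 0 (ρ j) hρ0 h0
  have k1 := key 1 (1 - ρ j) (by linarith) h1
  rw [plane_norm]
  have e0 : (Λ • direction (pathSig v T) n ρ j - v u) 0 =
      Λ * (sgn (pathSig v T) n ρ j 0 * ρ j) - v u 0 := by
    simp [direction]
  have e1 : (Λ • direction (pathSig v T) n ρ j - v u) 1 =
      Λ * (sgn (pathSig v T) n ρ j 1 * (1 - ρ j)) - v u 1 := by
    simp [direction]
  rw [e0, e1]
  linarith

/-! ### Accuracy of the recovered length -/

theorem pathSig_letter (v : ℝ → Plane) (hT : 0 ≤ T) (a : Fin 2) :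
    pathSig v T [a] = disp v 0 T a := by
  simp only [pathSig, iterInt, mul_one, disp]
  rw [intervalIntegral.integral_of_le hT, integral_Ioc_eq_integral_Ioo]

theorem levelOneNorm_pathSig (v : ℝ → Plane) (hT : 0 ≤ T) :
    levelOneNorm (pathSig v T) = dnorm (disp v 0 T) := by
  rw [levelOneNorm, pathSig_letter v hT, pathSig_letter v hT, dnorm]

theorem disp_eq_sum (hv : ConstSpeed v Λ) (T : ℝ) (m : ℕ) (a : Fin 2) :
    disp v 0 T a = ∑ j : Fin (m + 1),
      disp v ((j : ℕ) * T / ((m : ℝ) + 1)) (((j : ℕ) + 1) * T / ((m : ℝ) + 1)) a := by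
  have h := intervalIntegral.sum_integral_adjacent_intervals (μ := volume)
    (f := fun u => v u a) (a := fun j : ℕ => (j : ℝ) * T / ((m : ℝ) + 1)) (n := m + 1)
    fun k _ => hv.intervalIntegrable a _ _
  have hm : (m : ℝ) + 1 ≠ 0 := by positivity
  have e : ((m : ℝ) + 1) * T / ((m : ℝ) + 1) = T := by field_simp
  push_cast at h
  rw [zero_mul, zero_div, e] at h
  rw [disp, ← h, Finset.sum_range]
  rfl

/-- In each coordinate, ΛT times the average direction is the displacement of the path up to TE.
Taking norms, ΛT·D is close to N, where N is the norm of the displacement and D the denominator of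
`scaledLength`; hence N/D is close to ΛT. The error is divided by N, which is why closed paths need
a separate treatment. -/
theorem abs_scaledLength_sub_le (hv : ConstSpeed v Λ) (hT : 0 < T) {X : Series}
    {ρ : Fin (m + 1) → ℝ} {E : ℝ}
    (hX : X = pathSig v T)
    (hE : ∀ j : Fin (m + 1), ∀ u ∈ gridPiece T j, ‖Λ • direction X n ρ j - v u‖ ≤ E)
    (hN : 0 < levelOneNorm X) (hEN : 4 * T * E ≤ levelOneNorm X) :
    |scaledLength X n ρ - Λ * T| ≤ 4 * Λ * T ^ 2 * E / levelOneNorm X := by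
  have hΛ := hv.pos
  have hk : (0 : ℝ) < (m : ℝ) + 1 := by positivity
  have hδ : 0 ≤ T / ((m : ℝ) + 1) := by positivity
  have hE0 : 0 ≤ E := by
    refine (norm_nonneg _).trans (hE 0 0 ⟨?_, ?_⟩)
    · simp
    · simpa using hδ
  have key : ∀ a, |Λ * (T / (m + 1)) * (∑ j, direction X n ρ j a) - disp v 0 T a| ≤ T * E := by
    intro a
    rw [disp_eq_sum hv T m a, Finset.mul_sum, ← Finset.sum_sub_distrib]
    refine (Finset.abs_sum_le_sum_abs _ _).trans ?_
    have hb : ∀ j ∈ (Finset.univ : Finset (Fin (m + 1))),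
        |Λ * (T / (m + 1)) * direction X n ρ j a -
          disp v ((j : ℕ) * T / ((m : ℝ) + 1)) (((j : ℕ) + 1) * T / ((m : ℝ) + 1)) a| ≤
          E * (T / (m + 1)) := by
      intro j _
      have hle : (j : ℕ) * T / ((m : ℝ) + 1) ≤ ((j : ℕ) + 1) * T / ((m : ℝ) + 1) := by
        gcongr
        linarith
      have hlen : ((j : ℕ) + 1) * T / ((m : ℝ) + 1) - (j : ℕ) * T / ((m : ℝ) + 1) =
          T / (m + 1) := by ring
      have e : Λ * (T / (m + 1)) * direction X n ρ j a -
          disp v ((j : ℕ) * T / ((m : ℝ) + 1)) (((j : ℕ) + 1) * T / ((m : ℝ) + 1)) a =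
          ∫ u in ((j : ℕ) * T / ((m : ℝ) + 1))..(((j : ℕ) + 1) * T / ((m : ℝ) + 1)),
            (Λ * direction X n ρ j a - v u a) := by
        rw [intervalIntegral.integral_sub intervalIntegrable_const (hv.intervalIntegrable a _ _),
          intervalIntegral.integral_const, hlen, disp, smul_eq_mul]
        ring
      rw [e]
      have hn := intervalIntegral.norm_integral_le_of_norm_le_const
        (f := fun u => Λ * direction X n ρ j a - v u a) (C := E)
        (a := (j : ℕ) * T / ((m : ℝ) + 1)) (b := ((j : ℕ) + 1) * T / ((m : ℝ) + 1)) fun u hu => by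
          rw [uIoc_of_le hle] at hu
          have := hE j u ⟨hu.1.le, hu.2⟩
          refine le_trans ?_ this
          have := abs_coord_le (Λ • direction X n ρ j - v u) a
          simpa using this
      rw [hlen, abs_of_nonneg hδ] at hn
      exact hn
    refine (Finset.sum_le_sum hb).trans (le_of_eq ?_)
    simp
    field_simp
  set N := levelOneNorm X with hNdef
  have hNeq : N = |disp v 0 T 0| + |disp v 0 T 1| := by
    rw [hNdef, hX, levelOneNorm_pathSig v hT.le, dnorm]
  set D := (|∑ j, sgn X n ρ j 0 * ρ j| + |∑ j, sgn X n ρ j 1 * (1 - ρ j)|) / ((m + 1 : ℕ) : ℝ)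
    with hD
  have hDeq : Λ * T * D = |Λ * (T / (m + 1)) * ∑ j, direction X n ρ j 0| +
      |Λ * (T / (m + 1)) * ∑ j, direction X n ρ j 1| := by
    have hc : |Λ * (T / ((m : ℝ) + 1))| = Λ * (T / ((m : ℝ) + 1)) :=
      abs_of_nonneg (by positivity)
    rw [abs_mul (Λ * (T / ((m : ℝ) + 1))), abs_mul (Λ * (T / ((m : ℝ) + 1))), hc, hD]
    simp only [direction, PiLp.toLp_apply, Matrix.cons_val_zero, Matrix.cons_val_one]
    push_cast
    field_simp
  have hclose : |Λ * T * D - N| ≤ 2 * T * E := by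
    rw [hDeq, hNeq]
    have h0 := (abs_abs_sub_abs_le _ _).trans (key 0)
    have h1 := (abs_abs_sub_abs_le _ _).trans (key 1)
    rw [abs_le] at h0 h1 ⊢
    constructor <;> linarith
  -- `hEN` makes the error 2TE at most N/2, so the denominator D cannot vanish.
  have hDlow : N / 2 ≤ Λ * T * D := by
    have := (abs_le.1 hclose).1
    linarith
  have hDpos : 0 < D := by
    by_contra hneg
    have : Λ * T * D ≤ 0 := mul_nonpos_of_nonneg_of_nonpos (by positivity) (not_lt.1 hneg)
    linarith
  have hsc : scaledLength X n ρ = N / D := rfl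
  have e : N / D - Λ * T = (N - Λ * T * D) / D := by
    field_simp
  rw [hsc, e, abs_div, abs_of_pos hDpos, div_le_div_iff₀ hDpos hN, abs_sub_comm]
  calc |Λ * T * D - N| * N ≤ (2 * T * E) * N := mul_le_mul_of_nonneg_right hclose hN.le
    _ ≤ (2 * T * E) * (2 * (Λ * T * D)) := mul_le_mul_of_nonneg_left (by linarith) (by positivity)
    _ = 4 * Λ * T ^ 2 * E * D := by ring

end

section

/-! ### The error terms are negligible -/

theorem sixteen_pow_le (k : ℕ) : (16 : ℝ) ^ k ≤ Real.exp (3 * k) := by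
  rw [mul_comm, Real.exp_nat_mul]
  refine pow_le_pow_left₀ (by norm_num) ?_ k
  have h : Real.exp 3 = Real.exp 1 ^ 3 := by
    rw [← Real.exp_nat_mul]
    norm_num
  rw [h]
  have := Real.exp_one_gt_d9
  have h2 : (2.6 : ℝ) ^ 3 ≤ Real.exp 1 ^ 3 := pow_le_pow_left₀ (by norm_num) (by linarith) 3
  norm_num at h2 ⊢
  linarith

/-- For k ≥ 8 the correction 8n/k is at most n, so the leak is at most e^{3k log k - 3n}. As n is
about k² log k, one factor e^{-n} absorbs both e^{3k log k} and 16^k ≤ e^{3k}. -/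
theorem leak_le {k n : ℕ} (hk : 8 ≤ k) (hlog : 2 ≤ Real.log k)
    (hn : |(n : ℝ) - (k : ℝ) ^ 2 * Real.log k| < 1) :
    (k : ℝ) ^ 2 ≤ n ∧ 16 ^ k * leak k n ≤ Real.exp (-(2 * n)) := by
  have hk' : (8 : ℝ) ≤ k := by exact_mod_cast hk
  have hn1 := (abs_lt.1 hn).1
  set ℓ := Real.log k with hℓ
  have h2 : (k : ℝ) ^ 2 * 2 ≤ (k : ℝ) ^ 2 * ℓ := mul_le_mul_of_nonneg_left hlog (by positivity)
  refine ⟨by nlinarith, ?_⟩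
  have hn0 : (0 : ℝ) ≤ n := Nat.cast_nonneg n
  have h3 : 8 * (n : ℝ) / k ≤ n := by
    rw [div_le_iff₀ (by linarith)]
    nlinarith
  have h4 : ((k : ℝ) ^ 3 / 2) ^ (k - 1) ≤ Real.exp (3 * k * ℓ) := by
    have e1 : Real.exp (3 * k * ℓ) = ((k : ℝ) ^ 3) ^ k := by
      rw [← pow_mul, ← Real.exp_log (by positivity : (0 : ℝ) < (k : ℝ) ^ (3 * k)), Real.log_pow]
      push_cast
      rfl
    rw [e1]
    refine (pow_le_pow_left₀ (by positivity) (half_le_self (by positivity)) _).trans ?_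
    refine pow_le_pow_right₀ ?_ (Nat.sub_le _ _)
    exact one_le_pow₀ (by linarith)
  have h5 : leak k n ≤ Real.exp (3 * k * ℓ) * Real.exp (-(4 * n) + n) := by
    unfold leak
    exact mul_le_mul h4 (Real.exp_le_exp.2 (by linarith)) (Real.exp_pos _).le (Real.exp_pos _).le
  have h6 : 0 ≤ leak k n := by
    unfold leak
    positivity
  refine (mul_le_mul (sixteen_pow_le k) h5 h6 (Real.exp_pos _).le).trans ?_
  rw [← Real.exp_add, ← Real.exp_add]
  refine Real.exp_le_exp.2 ?_
  have h7 : (8 : ℝ) * (k * ℓ) ≤ k ^ 2 * ℓ := by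
    have : 0 ≤ (k : ℝ) * ℓ := by positivity
    nlinarith
  nlinarith

/-- The choice n ≈ k² log k serves two purposes: e^{-2n} dominates every polynomial factor, and nμ²
with μ ≥ c/√k is at least of order k log k, so the binomial tails at that scale beat 16^k. -/
theorem eventually_negligible {Λ T c : ℝ} (hΛ : 0 < Λ) (hT : 0 < T) (hc : 0 < c) :
    ∀ᶠ k : ℕ in atTop, ∀ n : ℕ, |(n : ℝ) - (k : ℝ) ^ 2 * Real.log k| < 1 →
      0 < n ∧ leak k n ≤ 1 / (8 * 16 ^ k) ∧
      (∀ η : ℝ, c / √(k : ℝ) ≤ η →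
        16 ^ k * (Λ * T) * leak k n * (2 * n + 1) < 8 * (T / k * η)) ∧
      ∀ μ : ℝ, c / √(k : ℝ) ≤ μ → 2 * Real.exp (-(n * μ ^ 2 / 2)) ≤ 1 / (8 * 16 ^ k) := by
  have hlog : Tendsto (fun k : ℕ => Real.log k) atTop atTop :=
    Real.tendsto_log_atTop.comp tendsto_natCast_atTop_atTop
  have hnat : Tendsto (fun k : ℕ => (k : ℝ)) atTop atTop := tendsto_natCast_atTop_atTop
  filter_upwards [eventually_ge_atTop 8, hlog.eventually_ge_atTop 2,
    hlog.eventually_ge_atTop (24 / c ^ 2), hnat.eventually_gt_atTop (Λ / (4 * c))]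
    with k hk hl2 hlc hkc n hn
  obtain ⟨hnk, hleak⟩ := leak_le hk hl2 hn
  have hk' : (8 : ℝ) ≤ k := by exact_mod_cast hk
  have hn64 : (64 : ℝ) ≤ n := by nlinarith
  have hsq : √(k : ℝ) ≤ k := by
    rw [Real.sqrt_le_left (by linarith)]
    nlinarith
  have hsq0 : 0 < √(k : ℝ) := Real.sqrt_pos.2 (by linarith)
  refine ⟨by exact_mod_cast (by linarith : (0 : ℝ) < n), ?_, ?_, ?_⟩
  · rw [le_div_iff₀ (by positivity)]
    have h1 : Real.exp (-(2 * n)) ≤ 1 / 8 := by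
      rw [Real.exp_neg, inv_le_comm₀ (Real.exp_pos _) (by norm_num)]
      have := Real.add_one_le_exp (2 * (n : ℝ))
      norm_num
      linarith
    linarith
  · intro η hη
    have h1 : (2 * (n : ℝ) + 1) * Real.exp (-(2 * n)) ≤ 2 / n ^ 2 := by
      have e1 := Real.quadratic_le_exp_of_nonneg (x := (n : ℝ)) (by linarith)
      have e2 : Real.exp (-(2 * (n : ℝ))) = (Real.exp n * Real.exp n)⁻¹ := by
        rw [← Real.exp_add, ← Real.exp_neg]
        ring_nf
      rw [e2, ← div_eq_mul_inv, div_le_div_iff₀ (by positivity) (by positivity)]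
      have e3 : (2 * (n : ℝ) + 1) ≤ Real.exp n := by nlinarith
      have e4 : (n : ℝ) ^ 2 / 2 ≤ Real.exp n := by nlinarith
      have := mul_le_mul e3 e4 (by positivity) (Real.exp_pos _).le
      linarith
    have h2 : 16 ^ k * (Λ * T) * leak k n * (2 * n + 1) ≤ Λ * T * (2 / n ^ 2) := by
      calc 16 ^ k * (Λ * T) * leak k n * (2 * n + 1)
          = Λ * T * ((16 ^ k * leak k n) * (2 * n + 1)) := by ring
        _ ≤ Λ * T * (Real.exp (-(2 * n)) * (2 * n + 1)) := by gcongr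
        _ ≤ _ := by
          rw [mul_comm (Real.exp _)]
          gcongr
    refine h2.trans_lt ?_
    have h3 : Λ * T * (2 / (n : ℝ) ^ 2) ≤ Λ * T * (2 / ((k : ℝ) ^ 2) ^ 2) := by gcongr
    refine h3.trans_lt ?_
    have h4 : 8 * (T / k * (c / k)) ≤ 8 * (T / k * η) := by
      have : c / (k : ℝ) ≤ c / √(k : ℝ) := by gcongr
      have := this.trans hη
      gcongr
    refine lt_of_lt_of_le ?_ h4
    rw [div_lt_iff₀ (by positivity)] at hkc
    have e5 : Λ * T * (2 / ((k : ℝ) ^ 2) ^ 2) = (2 * T / k ^ 2) * (Λ / k ^ 2) := by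
      field_simp
    have e6 : 8 * (T / k * (c / k)) = (2 * T / (k : ℝ) ^ 2) * (4 * c) := by
      field_simp
      norm_num
    rw [e5, e6]
    refine mul_lt_mul_of_pos_left ?_ (by positivity)
    rw [div_lt_iff₀ (by positivity)]
    have : (k : ℝ) * (4 * c) ≤ 4 * c * k ^ 2 := by nlinarith
    linarith
  · intro μ hμ
    have h1 : c ^ 2 / k ≤ μ ^ 2 := by
      have := pow_le_pow_left₀ (by positivity) hμ 2
      rwa [div_pow, Real.sq_sqrt (by linarith)] at this
    have h2 : (k : ℝ) ^ 2 * Real.log k / 2 ≤ n := by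
      have := (abs_lt.1 hn).1
      nlinarith
    rw [div_le_iff₀ (by positivity)] at hlc
    -- From log k ≥ 24/c² follows nμ² ≥ 12k, hence exp(nμ²/2) ≥ 16^(k+1), which is the required 2 ·
    -- 8 · 16^k.
    have h3 : 3 * ((k : ℝ) + 1) ≤ n * μ ^ 2 / 2 := by
      have e1 : (k : ℝ) ^ 2 * Real.log k / 2 * (c ^ 2 / k) ≤ n * μ ^ 2 := by gcongr
      have e2 : (k : ℝ) ^ 2 * Real.log k / 2 * (c ^ 2 / k) = k / 2 * (Real.log k * c ^ 2) := by
        field_simp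
      rw [e2] at e1
      have e3 : (k : ℝ) / 2 * 24 ≤ k / 2 * (Real.log k * c ^ 2) := by gcongr
      linarith
    have h4 := sixteen_pow_le (k + 1)
    push_cast at h4
    have h5 : (16 : ℝ) ^ (k + 1) ≤ Real.exp (n * μ ^ 2 / 2) :=
      h4.trans (Real.exp_le_exp.2 h3)
    rw [Real.exp_neg, ← div_eq_mul_inv, div_le_div_iff₀ (Real.exp_pos _) (by positivity)]
    rw [pow_succ] at h5
    linarith

end

section

/-! ### The modulus of continuity of the velocity -/

variable {γ : ℝ → Plane} {L : ℝ}

theorem continuousOn_velocity (hγ : ContDiffOn ℝ 1 γ (Icc 0 1)) :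
    ContinuousOn (velocity γ) (Icc 0 1) :=
  hγ.continuousOn_derivWithin (uniqueDiffOn_Icc zero_lt_one) le_rfl

/-- The velocity, extended to all times by its values at the end points. -/
def field (γ : ℝ → Plane) (u : ℝ) : Plane := velocity γ (projIcc 0 1 zero_le_one u)

theorem field_of_mem {u : ℝ} (hu : u ∈ Icc (0 : ℝ) 1) : field γ u = velocity γ u := by
  rw [field, projIcc_of_mem zero_le_one hu]

theorem continuous_field (hγ : ContDiffOn ℝ 1 γ (Icc 0 1)) : Continuous (field γ) :=
  ((continuousOn_velocity hγ).domRestrict).comp continuous_projIcc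

theorem constSpeed_field (hγ : ContDiffOn ℝ 1 γ (Icc 0 1)) (hL : 0 < L)
    (hspeed : ∀ u ∈ Icc (0 : ℝ) 1, ‖velocity γ u‖ = L) : ConstSpeed (field γ) L := by
  refine ⟨fun a => ?_, ⟨∅, countable_empty, fun u _ => (continuous_field hγ).continuousAt⟩,
    fun u => hspeed _ (projIcc 0 1 zero_le_one u).2, hL⟩
  exact ((PiLp.continuous_apply 1 _ a).comp (continuous_field hγ)).measurable

theorem signature_eq_pathSig (hγ : ContDiffOn ℝ 1 γ (Icc 0 1)) (hL : 0 < L)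
    (hspeed : ∀ u ∈ Icc (0 : ℝ) 1, ‖velocity γ u‖ = L) :
    signature γ = pathSig (field γ) 1 := by
  ext w
  rw [pathSig, iterInt_eq_setIntegral (constSpeed_field hγ hL hspeed)]
  refine setIntegral_congr_fun (measurableSet_simplex _ _ _) fun u hu => ?_
  refine Finset.prod_congr rfl fun i _ => ?_
  rw [field_of_mem (Ioo_subset_Icc_self (hu.2 i))]

theorem bddAbove_modulus (hspeed : ∀ u ∈ Icc (0 : ℝ) 1, ‖velocity γ u‖ = L) (h : ℝ) :
    BddAbove {d : ℝ | ∃ s ∈ Icc (0 : ℝ) 1, ∃ t ∈ Icc (0 : ℝ) 1,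
      |s - t| < h ∧ d = ‖velocity γ s - velocity γ t‖} := by
  refine ⟨L + L, ?_⟩
  rintro d ⟨s, hs, t, ht, _, rfl⟩
  exact (norm_sub_le _ _).trans (add_le_add (hspeed s hs).le (hspeed t ht).le)

theorem le_modulus (hspeed : ∀ u ∈ Icc (0 : ℝ) 1, ‖velocity γ u‖ = L) {s t h : ℝ}
    (hs : s ∈ Icc (0 : ℝ) 1) (ht : t ∈ Icc (0 : ℝ) 1) (hst : |s - t| < h) :
    ‖velocity γ s - velocity γ t‖ ≤ modulus γ h :=
  le_csSup (bddAbove_modulus hspeed h) ⟨s, hs, t, ht, hst, rfl⟩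

theorem modulus_nonneg (γ : ℝ → Plane) (h : ℝ) : 0 ≤ modulus γ h := by
  refine Real.sSup_nonneg ?_
  rintro d ⟨s, _, t, _, _, rfl⟩
  exact norm_nonneg _

theorem modulus_le {h c : ℝ} (hc : 0 ≤ c) (H : ∀ s ∈ Icc (0 : ℝ) 1, ∀ t ∈ Icc (0 : ℝ) 1,
    |s - t| < h → ‖velocity γ s - velocity γ t‖ ≤ c) : modulus γ h ≤ c := by
  refine Real.sSup_le ?_ hc
  rintro d ⟨s, hs, t, ht, hst, rfl⟩
  exact H s hs t ht hst

/-- The segment from s to t is divided into N equal steps, each shorter than h. -/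
theorem norm_sub_le_nsmul_modulus (hspeed : ∀ u ∈ Icc (0 : ℝ) 1, ‖velocity γ u‖ = L) {h : ℝ}
    (N : ℕ) {s t : ℝ} (hs : s ∈ Icc (0 : ℝ) 1) (ht : t ∈ Icc (0 : ℝ) 1)
    (hst : |s - t| < N * h) : ‖velocity γ s - velocity γ t‖ ≤ N * modulus γ h := by
  rcases Nat.eq_zero_or_pos N with rfl | hN
  · simp only [Nat.cast_zero, zero_mul] at hst
    exact absurd hst (not_lt.2 (abs_nonneg _))
  have hN' : (0 : ℝ) < N := by exact_mod_cast hN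
  set p : ℕ → ℝ := fun i => s + (i / N) * (t - s) with hp
  have hpmem : ∀ i ≤ N, p i ∈ Icc (0 : ℝ) 1 := by
    intro i hi
    have h1 : (i : ℝ) / N ∈ Icc (0 : ℝ) 1 :=
      ⟨by positivity, (div_le_one hN').2 (by exact_mod_cast hi)⟩
    exact (convex_Icc (0 : ℝ) 1).add_smul_sub_mem hs ht h1
  have hstep : ∀ i ∈ Finset.range N, dist (velocity γ (p i)) (velocity γ (p (i + 1))) ≤
      modulus γ h := by
    intro i hi
    have hi' := Finset.mem_range.1 hi
    rw [dist_eq_norm]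
    refine le_modulus hspeed (hpmem i hi'.le) (hpmem (i + 1) hi') ?_
    have e : p i - p (i + 1) = (s - t) / N := by
      simp only [hp]
      push_cast
      field_simp
      ring
    rw [e, abs_div, abs_of_pos hN', div_lt_iff₀ hN']
    linarith
  have h2 := dist_le_range_sum_dist (fun i => velocity γ (p i)) N
  have h3 := h2.trans (Finset.sum_le_sum hstep)
  have e0 : p 0 = s := by simp [hp]
  have eN : p N = t := by
    simp only [hp]
    field_simp
    ring
  simpa [e0, eN, dist_eq_norm] using h3

theorem tendsto_modulus (hγ : ContDiffOn ℝ 1 γ (Icc 0 1)) {ι : Type*} {l : Filter ι} {h : ι → ℝ}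
    (hh : Tendsto h l (𝓝 0)) : Tendsto (fun i => modulus γ (h i)) l (𝓝 0) := by
  have huc := isCompact_Icc.uniformContinuousOn_of_continuous (continuousOn_velocity hγ)
  rw [Metric.uniformContinuousOn_iff] at huc
  rw [Metric.tendsto_nhds]
  intro e he
  obtain ⟨δ, hδ, H⟩ := huc (e / 2) (by linarith)
  filter_upwards [hh.eventually_lt_const hδ] with i hi
  rw [Real.dist_eq, sub_zero, abs_of_nonneg (modulus_nonneg _ _)]
  refine lt_of_le_of_lt (modulus_le (by linarith) fun s hs t ht hst => ?_) (half_lt_self he)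
  have := H s hs t ht (by rw [Real.dist_eq]; exact hst.trans hi)
  rw [dist_eq_norm] at this
  exact this.le

theorem tendsto_one_div_nat : Tendsto (fun k : ℕ => 1 / (k : ℝ)) atTop (𝓝 0) :=
  tendsto_const_div_atTop_nhds_zero_nat 1

theorem tendsto_eps (hγ : ContDiffOn ℝ 1 γ (Icc 0 1)) (L : ℝ) :
    Tendsto (fun k : ℕ => eps γ L k) atTop (𝓝 0) := by
  have h1 := (((tendsto_modulus hγ tendsto_one_div_nat).div_const L).sqrt).add
    tendsto_one_div_nat.sqrt
  simpa [eps] using h1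

theorem tendsto_eta (hγ : ContDiffOn ℝ 1 γ (Icc 0 1)) (L : ℝ) :
    Tendsto (fun k : ℕ => eta γ L k) atTop (𝓝 0) := by
  have := (tendsto_eps hγ L).const_mul 3
  rw [mul_zero] at this
  exact tendsto_modulus hγ this

theorem inv_sqrt_le_eps (γ : ℝ → Plane) (L : ℝ) (k : ℕ) : 1 / √(k : ℝ) ≤ eps γ L k := by
  rw [eps, Real.sqrt_div zero_le_one, Real.sqrt_one]
  linarith [Real.sqrt_nonneg (modulus γ (1 / (k : ℝ)) / L)]

theorem inv_le_eps (γ : ℝ → Plane) (L : ℝ) {k : ℕ} (hk : 1 ≤ k) : 1 / (k : ℝ) ≤ eps γ L k := by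
  have hk' : (1 : ℝ) ≤ k := by exact_mod_cast hk
  refine le_trans ?_ (inv_sqrt_le_eps γ L k)
  have : √(k : ℝ) ≤ k := by
    rw [Real.sqrt_le_left (by linarith)]
    nlinarith
  have : 0 < √(k : ℝ) := Real.sqrt_pos.2 (by linarith)
  gcongr

/-- The reason for the two square roots in `eps`: multiplied by k, this reads kδ_k/L + 1 ≤ kε_k²,
the condition `hxs` of `window_grid` for constant deficits x j = δ_k/L on [0, 1]. -/
theorem add_le_eps_sq (γ : ℝ → Plane) (hL : 0 < L) (k : ℕ) :
    modulus γ (1 / (k : ℝ)) / L + 1 / (k : ℝ) ≤ eps γ L k ^ 2 := by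
  have h1 := Real.sq_sqrt (div_nonneg (modulus_nonneg γ (1 / (k : ℝ))) hL.le)
  have h2 := Real.sq_sqrt (by positivity : (0 : ℝ) ≤ 1 / (k : ℝ))
  have h3 := Real.sqrt_nonneg (modulus γ (1 / (k : ℝ)) / L)
  have h4 := Real.sqrt_nonneg (1 / (k : ℝ))
  rw [eps]
  nlinarith [mul_nonneg h3 h4]

theorem eta_nonneg (γ : ℝ → Plane) (L : ℝ) (k : ℕ) : 0 ≤ eta γ L k := modulus_nonneg _ _

/-- Since ε_k ≥ 1/√k, at most 2√k steps shorter than 3ε_k join any two times, so a fixed difference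
of velocities is at most 2√k η_k. This lower bound lets η_k dominate the exponentially small terms
and serve as the width of the binomial tails. -/
theorem exists_le_eta (hspeed : ∀ u ∈ Icc (0 : ℝ) 1, ‖velocity γ u‖ = L)
    (hne : ∃ s ∈ Icc (0 : ℝ) 1, ∃ t ∈ Icc (0 : ℝ) 1, velocity γ s ≠ velocity γ t) :
    ∃ c, 0 < c ∧ ∀ k : ℕ, 1 ≤ k → c / √(k : ℝ) ≤ eta γ L k := by
  obtain ⟨s, hs, t, ht, hst⟩ := hne
  have hd : 0 < ‖velocity γ s - velocity γ t‖ := norm_pos_iff.2 (sub_ne_zero.2 hst)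
  refine ⟨‖velocity γ s - velocity γ t‖ / 2, by positivity, fun k hk => ?_⟩
  have hk' : (1 : ℝ) ≤ √(k : ℝ) := Real.one_le_sqrt.2 (by exact_mod_cast hk)
  set N := ⌈√(k : ℝ)⌉₊ with hN
  have hN1 : √(k : ℝ) ≤ N := Nat.le_ceil _
  have hN2 : (N : ℝ) < √(k : ℝ) + 1 := Nat.ceil_lt_add_one (by linarith)
  have h1 : |s - t| < N * (3 * eps γ L k) := by
    have h2 : |s - t| ≤ 1 := by
      rw [abs_le]
      constructor <;> linarith [hs.1, hs.2, ht.1, ht.2]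
    have h3 := inv_sqrt_le_eps γ L k
    have h4 : 1 ≤ N * eps γ L k := by
      have : √(k : ℝ) * (1 / √(k : ℝ)) = 1 := by field_simp
      rw [← this]
      exact mul_le_mul hN1 h3 (by positivity) (by positivity)
    linarith
  have h5 := norm_sub_le_nsmul_modulus hspeed N hs ht h1
  rw [div_le_iff₀ (by linarith)]
  have h6 : (N : ℝ) * eta γ L k ≤ 2 * √(k : ℝ) * eta γ L k :=
    mul_le_mul_of_nonneg_right (by linarith) (eta_nonneg _ _ _)
  have h7 : ‖velocity γ s - velocity γ t‖ ≤ N * eta γ L k := h5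
  linarith

theorem eta_eq_zero (hconst : ∀ s ∈ Icc (0 : ℝ) 1, ∀ t ∈ Icc (0 : ℝ) 1,
    velocity γ s = velocity γ t) (k : ℕ) : eta γ L k = 0 := by
  refine le_antisymm (modulus_le le_rfl fun s hs t ht _ => ?_) (eta_nonneg _ _ _)
  rw [hconst s hs t ht, sub_self, norm_zero]

/-! ### Windows from local oscillation bounds -/

variable {v : ℝ → Plane} {Λ : ℝ}

/-- The velocity on a block is compared with its value at the midpoint of the block. For knots in
the box a block may be slightly longer than T/(m+1), but its points are closer than that to the
midpoint, so the oscillation at scale T/(m+1) suffices. -/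
theorem window_of_osc (hv : ConstSpeed v Λ) {T ε : ℝ} (hT : 0 < T) {m n : ℕ} (hm : 1 ≤ m)
    (hε : T / ((m : ℝ) + 1) ^ 3 ≤ ε) {x : Fin (m + 1) → ℝ} (hx0 : ∀ j, 0 ≤ x j)
    (hx1 : ∀ j, x j ≤ 1 / 2) (hxs : ∑ j, x j + 1 ≤ (m + 1) * ε ^ 2 / T ^ 2)
    (hosc : ∀ j : Fin (m + 1), ∀ s ∈ Icc 0 T, ∀ u ∈ Icc 0 T,
      |s - (j : ℕ) * T / ((m : ℝ) + 1)| ≤ 2 * (T / ((m : ℝ) + 1)) →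
      |u - (j : ℕ) * T / ((m : ℝ) + 1)| ≤ 2 * (T / ((m : ℝ) + 1)) →
      |s - u| < T / ((m : ℝ) + 1) → ‖v s - v u‖ ≤ Λ * x j) :
    Window v T n (gridWindow T ε m) (gridBox T (T / ((m : ℝ) + 1) ^ 3) m) (leak (m + 1) n) := by
  refine window_grid hv hT hm hε hx0 hx1 hxs fun t ht j => ?_
  have hk : (2 : ℝ) ≤ (m : ℝ) + 1 := by
    have : (1 : ℝ) ≤ m := by exact_mod_cast hm
    linarith
  have hδ : 0 < T / ((m : ℝ) + 1) := by positivity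
  have hr : T / ((m : ℝ) + 1) ^ 3 ≤ T / ((m : ℝ) + 1) / 4 := by
    rw [div_div]
    refine div_le_div_of_nonneg_left hT.le (by positivity) ?_
    nlinarith [mul_le_mul_of_nonneg_left (by nlinarith : (4 : ℝ) ≤ ((m : ℝ) + 1) ^ 2)
      (by linarith : (0 : ℝ) ≤ (m : ℝ) + 1)]
  have hr0 : 0 < T / ((m : ℝ) + 1) ^ 3 := by positivity
  have hts : t ∈ simplex m 0 T := gridBox_subset_simplex hT (by linarith) ht
  have hc := abs_le.1 (abs_cons_sub_le hr0.le (fun i => abs_sub_le_of_mem_gridBox ht i) j)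
  have hs := abs_le.1 (abs_snoc_sub_le hr0.le (fun i => abs_sub_le_of_mem_gridBox ht i) j)
  have h3 : (((j : ℕ) : ℝ) + 1) * T / (m + 1) = (j : ℕ) * T / (m + 1) + T / (m + 1) := by ring
  rw [h3] at hs
  obtain ⟨k1, k2, k3⟩ := knots_mem hT.le hts j
  set a := (Fin.cons 0 t : Fin (m + 1) → ℝ) j with ha
  set b := (Fin.snoc t T : Fin (m + 1) → ℝ) j with hb
  have hmid : (a + b) / 2 ∈ Icc a b := ⟨by linarith, by linarith⟩
  have hnear : ∀ s ∈ Icc a b, |s - (j : ℕ) * T / ((m : ℝ) + 1)| ≤ 2 * (T / ((m : ℝ) + 1)) := by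
    intro s hs'
    rw [abs_le]
    constructor <;> linarith [hs'.1, hs'.2, hc.1, hs.2]
  have hclose := dnorm_disp_sub_le hv (ConstSpeed.const (hv.speed ((a + b) / 2)) hv.pos) k2
    (η := Λ * x j) fun s hs' => hosc j s ⟨k1.trans hs'.1, hs'.2.trans k3⟩ _
      ⟨k1.trans hmid.1, hmid.2.trans k3⟩ (hnear s hs') (hnear _ hmid) (by
        rw [abs_lt]
        constructor <;> linarith [hs'.1, hs'.2, hc.1, hs.2])
  rw [disp_const, disp_const] at hclose
  have hgap : gap T t j = b - a := rfl
  have hincr : incr v 0 T t j = disp v a b := rfl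
  have hn := hv.speed ((a + b) / 2)
  rw [plane_norm] at hn
  set p := v ((a + b) / 2)
  have hba : 0 ≤ b - a := sub_nonneg.2 k2
  have e0 := abs_sub_abs_le_abs_sub ((b - a) * p 0) (disp v a b 0)
  have e1 := abs_sub_abs_le_abs_sub ((b - a) * p 1) (disp v a b 1)
  rw [abs_mul, abs_of_nonneg hba, abs_sub_comm] at e0 e1
  rw [hgap, hincr, dnorm]
  have e2 : Λ * (b - a) = (b - a) * |p 0| + (b - a) * |p 1| := by
    rw [← hn]
    ring
  have e3 : Λ * (b - a) * (1 - x j) = Λ * (b - a) - Λ * x j * (b - a) := by ring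
  rw [e3, e2]
  linarith

/-- The path itself satisfies the hypotheses of the accuracy theorem. -/
theorem eventually_regime (hγ : ContDiffOn ℝ 1 γ (Icc 0 1)) (hL : 0 < L)
    (hspeed : ∀ u ∈ Icc (0 : ℝ) 1, ‖velocity γ u‖ = L)
    (hne : ∃ s ∈ Icc (0 : ℝ) 1, ∃ t ∈ Icc (0 : ℝ) 1, velocity γ s ≠ velocity γ t) :
    ∀ᶠ k : ℕ in atTop, ∀ n : ℕ, |(n : ℝ) - (k : ℝ) ^ 2 * Real.log k| < 1 →
      ∀ m : ℕ, k = m + 1 → Regime (field γ) L 1 (eps γ L k) (eta γ L k) (leak k n) m n ∧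
        TailSmall m n (eta γ L k / (2 * L)) := by
  obtain ⟨c, hc, hceta⟩ := exists_le_eta hspeed hne
  have hc' : 0 < min c (c / (2 * L)) := lt_min hc (by positivity)
  have hδ := tendsto_modulus hγ tendsto_one_div_nat
  filter_upwards [eventually_negligible hL one_pos hc', eventually_ge_atTop 2,
    hδ.eventually_le_const (by linarith : 0 < L / 2),
    (tendsto_eta hγ L).eventually_le_const (by positivity : 0 < L / 32)]
    with k hneg hk hδk hηk n hn m hkm
  obtain ⟨hn0, hq1, hq2, htail⟩ := hneg n hn
  have hsq : 0 < √(k : ℝ) := Real.sqrt_pos.2 (by positivity)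
  have hηlow : min c (c / (2 * L)) / √(k : ℝ) ≤ eta γ L k := by
    refine le_trans ?_ (hceta k (by omega))
    gcongr
    exact min_le_left _ _
  have hηpos : 0 < eta γ L k := lt_of_lt_of_le (by positivity) hηlow
  have hkm' : (k : ℝ) = m + 1 := by
    rw [hkm]
    push_cast
    ring
  have hv := constSpeed_field hγ hL hspeed
  have hk1 : (1 : ℝ) ≤ k := by exact_mod_cast (by omega : 1 ≤ k)
  have hkpos : (0 : ℝ) < k := by linarith
  have hinv := inv_le_eps γ L (by omega : 1 ≤ k)
  constructor
  · refine ⟨hv, one_pos, by omega, hn0, ?_, ?_, ?_, hηpos, hηk, ?_, ?_⟩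
    · exact le_trans (by positivity) hinv
    · subst hkm
      refine window_of_osc hv one_pos (by omega) ?_ (x := fun _ =>
        modulus γ (1 / ((m + 1 : ℕ) : ℝ)) / L) (fun _ => div_nonneg (modulus_nonneg _ _) hL.le)
        (fun _ => ?_) ?_ ?_
      · refine le_trans ?_ hinv
        rw [hkm']
        rw [hkm'] at hk1
        refine div_le_div_of_nonneg_left zero_le_one (by positivity) ?_
        exact le_self_pow₀ hk1 (by norm_num)
      · rw [div_le_iff₀ hL]
        linarith
      · have h1 := add_le_eps_sq γ hL (m + 1)
        have h2 := mul_le_mul_of_nonneg_left h1 hkpos.le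
        simp only [Finset.sum_const, Finset.card_univ, Fintype.card_fin, nsmul_eq_mul]
        rw [one_pow, div_one, ← hkm']
        refine le_trans (le_of_eq ?_) h2
        field_simp
      · intro j s hs u hu _ _ hsu
        rw [field_of_mem hs, field_of_mem hu, mul_div_cancel₀ _ hL.ne']
        refine le_modulus hspeed hs hu ?_
        rw [hkm']
        exact hsu
    · intro s hs u hu hsu
      rw [field_of_mem hs, field_of_mem hu]
      refine le_modulus hspeed hs hu ?_
      rw [← hkm'] at hsu
      have : 0 < eps γ L k := lt_of_lt_of_le (by positivity) hinv
      linarith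
    · rw [← hkm]
      exact hq1
    · rw [← hkm, ← hkm']
      exact hq2 _ hηlow
  · have := htail (eta γ L k / (2 * L)) (by
      have h1 := hceta k (by omega)
      calc min c (c / (2 * L)) / √(k : ℝ) ≤ (c / (2 * L)) / √(k : ℝ) := by
            gcongr
            exact min_le_right _ _
        _ = (c / √(k : ℝ)) / (2 * L) := by ring
        _ ≤ _ := by gcongr)
    rw [TailSmall, ← hkm]
    exact this

end

section

/-! ### The path with a segment of length one appended -/

variable {γ : ℝ → Plane} {L : ℝ}

/-- The velocity of `γ`, followed by a segment in direction `d` at the same speed. -/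
def extField (γ : ℝ → Plane) (L : ℝ) (d : Plane) (u : ℝ) : Plane :=
  if u ≤ 1 then field γ u else L • d

/-- The duration of the extended path. -/
def extTime (L : ℝ) : ℝ := 1 + 1 / L

theorem one_lt_extTime (hL : 0 < L) : 1 < extTime L := by
  have : 0 < 1 / L := by positivity
  unfold extTime
  linarith

theorem constSpeed_ite {v v' : ℝ → Plane} {Λ : ℝ} (hv : ConstSpeed v Λ) (hv' : ConstSpeed v' Λ) :
    ConstSpeed (fun u => if u ≤ 1 then v u else v' u) Λ := by
  obtain ⟨S, hS, hc⟩ := hv.cont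
  obtain ⟨S', hS', hc'⟩ := hv'.cont
  refine ⟨fun a => ?_, ⟨S ∪ S' ∪ {1}, (hS.union hS').union (countable_singleton 1), ?_⟩, ?_, hv.pos⟩
  · have : (fun u => (if u ≤ 1 then v u else v' u) a) =
        fun u => if u ≤ 1 then v u a else v' u a := by
      ext u
      split_ifs <;> rfl
    rw [this]
    exact Measurable.ite measurableSet_Iic (hv.meas a) (hv'.meas a)
  · intro u hu
    simp only [mem_union, mem_singleton_iff, not_or] at hu
    rcases lt_or_gt_of_ne hu.2 with h | h
    · refine (hc u hu.1.1).congr ?_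
      filter_upwards [Iio_mem_nhds h] with s hs
      exact (if_pos hs.le).symm
    · refine (hc' u hu.1.2).congr ?_
      filter_upwards [Ioi_mem_nhds h] with s hs
      exact (if_neg (not_le.2 hs)).symm
  · intro u
    split_ifs
    · exact hv.speed u
    · exact hv'.speed u

theorem constSpeed_extField (hv : ConstSpeed (field γ) L) {d : Plane} (hd : ‖d‖ = 1) :
    ConstSpeed (extField γ L d) L :=
  constSpeed_ite hv (ConstSpeed.const (by
    rw [norm_smul, hd, mul_one, Real.norm_of_nonneg hv.pos.le]) hv.pos)

/-- Chen's identity at time 1. A segment of length one run at speed L lasts 1/L, hence `extTime`; on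
it the powers of L and 1/L cancel and leave the tensor exponential. -/
theorem tensorMul_tensorExp (hv : ConstSpeed (field γ) L) {d : Plane} (hd : ‖d‖ = 1) :
    tensorMul (pathSig (field γ) 1) (tensorExp d) = pathSig (extField γ L d) (extTime L) := by
  have hL := hv.pos
  ext w
  rw [pathSig, iterInt_chen (constSpeed_extField hv hd) zero_le_one (one_lt_extTime hL).le]
  refine Finset.sum_congr rfl fun i _ => ?_
  congr 1
  · refine iterInt_congr (fun u hu => ?_) _
    rw [extField, if_pos hu.2.le]
  · have hc := iterInt_const (v := extField γ L d) (one_lt_extTime hL).le (b := L • d)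
      (fun u hu => if_neg (not_le.2 hu.1)) (w.drop i)
    rw [hc]
    have h : ∀ l : Word, (l.map fun i => (L • d) i).prod = L ^ l.length * (l.map fun i => d i).prod := by
      intro l
      induction l with
      | nil => simp
      | cons a l ih =>
        rw [List.map_cons, List.prod_cons, ih, List.length_cons, List.map_cons, List.prod_cons,
          PiLp.smul_apply, smul_eq_mul]
        ring
    rw [h, tensorExp, extTime]
    simp only [add_sub_cancel_left, one_div, inv_pow]
    field_simp

/-- The modulus of γ covers the part up to time 1, and the velocity is constant afterwards; the jump
J enters only when the junction separates the two times. -/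
theorem extField_osc (hspeed : ∀ u ∈ Icc (0 : ℝ) 1, ‖velocity γ u‖ = L) {d : Plane} {J h : ℝ}
    (hJ : ‖velocity γ 1 - L • d‖ ≤ J) (N : ℕ) {s u : ℝ} (hs : 0 ≤ s) (hu : 0 ≤ u)
    (hsu : |s - u| < N * h) :
    ‖extField γ L d s - extField γ L d u‖ ≤
      N * modulus γ h + if (s ≤ 1 ↔ u ≤ 1) then 0 else J := by
  have hm : 0 ≤ N * modulus γ h := mul_nonneg (Nat.cast_nonneg _) (modulus_nonneg _ _)
  have hone : (1 : ℝ) ∈ Icc (0 : ℝ) 1 := ⟨zero_le_one, le_rfl⟩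
  have key : ∀ {s u : ℝ}, 0 ≤ s → s ≤ 1 → 1 < u → |s - u| < N * h →
      ‖field γ s - L • d‖ ≤ N * modulus γ h + J := by
    intro s u hs h1 h2 hsu
    rw [field_of_mem ⟨hs, h1⟩]
    have h3 : |s - 1| < N * h := by
      refine lt_of_le_of_lt ?_ hsu
      rw [abs_of_nonpos (by linarith), abs_of_nonpos (by linarith)]
      linarith
    have := norm_sub_le_nsmul_modulus hspeed N ⟨hs, h1⟩ hone h3
    have h4 := norm_sub_le_norm_sub_add_norm_sub (velocity γ s) (velocity γ 1) (L • d)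
    linarith
  unfold extField
  by_cases h1 : s ≤ 1 <;> by_cases h2 : u ≤ 1
  · simp only [h1, h2, if_true, iff_self, add_zero]
    rw [field_of_mem ⟨hs, h1⟩, field_of_mem ⟨hu, h2⟩]
    exact norm_sub_le_nsmul_modulus hspeed N ⟨hs, h1⟩ ⟨hu, h2⟩ hsu
  · simp only [h1, h2, if_true, if_false, iff_false, not_true]
    exact key hs h1 (not_le.1 h2) hsu
  · simp only [h1, h2, if_true, if_false, iff_true]
    rw [norm_sub_rev]
    exact key hu h2 (not_le.1 h1) (by rwa [abs_sub_comm])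
  · simpa [h1, h2] using hm

theorem extField_osc_le (hspeed : ∀ u ∈ Icc (0 : ℝ) 1, ‖velocity γ u‖ = L) {d : Plane} {J h : ℝ}
    (hJ : ‖velocity γ 1 - L • d‖ ≤ J) (N : ℕ) {s u : ℝ} (hs : 0 ≤ s) (hu : 0 ≤ u)
    (hsu : |s - u| < N * h) :
    ‖extField γ L d s - extField γ L d u‖ ≤ N * modulus γ h + J := by
  refine (extField_osc hspeed hJ N hs hu hsu).trans (add_le_add le_rfl ?_)
  split_ifs
  · exact (norm_nonneg _).trans hJ
  · exact le_rfl

/-- At most five blocks are near the junction, so the total deficit caused by the jump stays bounded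
however large k is. -/
theorem sum_near_le (k j₀ : ℕ) {c : ℝ} (hc : 0 ≤ c) :
    ∑ j : Fin k, (if j₀ ≤ (j : ℕ) + 2 ∧ (j : ℕ) ≤ j₀ + 2 then c else 0) ≤ 5 * c := by
  rw [Fin.sum_univ_eq_sum_range (fun j => if j₀ ≤ j + 2 ∧ j ≤ j₀ + 2 then c else 0),
    ← Finset.sum_filter, Finset.sum_const, nsmul_eq_mul]
  refine mul_le_mul_of_nonneg_right ?_ hc
  have h1 : (Finset.range k).filter (fun j => j₀ ≤ j + 2 ∧ j ≤ j₀ + 2) ⊆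
      Finset.Icc (j₀ - 2) (j₀ + 2) := by
    intro j hj
    simp only [Finset.mem_filter, Finset.mem_Icc] at hj ⊢
    omega
  have h2 := Finset.card_le_card h1
  rw [Nat.card_Icc] at h2
  have h3 : ((Finset.range k).filter (fun j => j₀ ≤ j + 2 ∧ j ≤ j₀ + 2)).card ≤ 5 := by omega
  exact_mod_cast h3

/-- The factor by which the window is enlarged for the extended path. -/
def extScale (L : ℝ) : ℝ := extTime L * (⌈extTime L⌉₊ + 2)

/-- The number of scales `3 ε_k` that cover the enlarged window. -/
def extCount (L : ℝ) : ℕ := ⌈2 * extScale L + extTime L⌉₊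

theorem extTime_le_extScale (hL : 0 < L) : extTime L ≤ extScale L := by
  have h := one_lt_extTime hL
  refine le_mul_of_one_le_right (by linarith) ?_
  have : (0 : ℝ) ≤ ⌈extTime L⌉₊ := Nat.cast_nonneg _
  linarith

theorem one_le_extCount (hL : 0 < L) : (1 : ℝ) ≤ extCount L := by
  have h1 := one_lt_extTime hL
  have h2 := extTime_le_extScale hL
  exact le_trans (by linarith) (Nat.le_ceil (2 * extScale L + extTime L))

theorem extScale_lt (hL : 0 < L) {k : ℕ} (hk : 1 ≤ k) (γ : ℝ → Plane) :
    2 * (extScale L * eps γ L k) + extTime L / k < extCount L * (3 * eps γ L k) := by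
  have hinv := inv_le_eps γ L hk
  have hk0 : (0 : ℝ) < k := by exact_mod_cast hk
  have he : 0 < eps γ L k := lt_of_lt_of_le (by positivity) hinv
  have h1 := one_lt_extTime hL
  have h2 : extTime L / k ≤ extTime L * eps γ L k := by
    rw [div_eq_mul_one_div]
    gcongr
  have h3 : 2 * extScale L + extTime L ≤ extCount L := Nat.le_ceil _
  have h4 := mul_le_mul_of_nonneg_right h3 he.le
  have h5 := one_le_extCount hL
  nlinarith

/-- The total oscillation of the extended path is large only near the junction. -/
theorem window_extField (hγ : ContDiffOn ℝ 1 γ (Icc 0 1)) (hL : 0 < L)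
    (hspeed : ∀ u ∈ Icc (0 : ℝ) 1, ‖velocity γ u‖ = L) {d : Plane} (hd : ‖d‖ = 1) {J : ℝ}
    (hJ0 : 0 ≤ J) (hJ : ‖velocity γ 1 - L • d‖ ≤ J) {k m n : ℕ} (hm : 1 ≤ m) (hkm : k = m + 1)
    (hδk : ⌈extTime L⌉₊ * modulus γ (1 / (k : ℝ)) ≤ L / 4) (hJle : J ≤ L / 32) :
    Window (extField γ L d) (extTime L) n (gridWindow (extTime L) (extScale L * eps γ L k) m)
      (gridBox (extTime L) (extTime L / ((m : ℝ) + 1) ^ 3) m) (leak k n) := by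
  set T := extTime L with hT
  have hT1 : 1 < T := one_lt_extTime hL
  have hT0 : 0 < T := by linarith
  have hk1 : (1 : ℝ) ≤ k := by exact_mod_cast (by omega : 1 ≤ k)
  have hkpos : (0 : ℝ) < k := by linarith
  have hkm' : (k : ℝ) = m + 1 := by
    rw [hkm]
    push_cast
    ring
  have hv := constSpeed_field hγ hL hspeed
  have hinv := inv_le_eps γ L (by omega : 1 ≤ k)
  have he : 0 < eps γ L k := lt_of_lt_of_le (by positivity) hinv
  have hMT : T ≤ extScale L := extTime_le_extScale hL
  have hM0 : 0 < extScale L := hT0.trans_le hMT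
  -- Index of the grid block, of length T/k, that contains the junction time 1.
  set j₀ := ⌊(k : ℝ) / T⌋₊ with hj₀
  have hδ0 := modulus_nonneg γ (1 / (k : ℝ))
  have hlk : leak k n = leak (m + 1) n := by rw [hkm]
  rw [hlk]
  refine window_of_osc (constSpeed_extField hv hd) hT0 (by omega) ?_ (x := fun j =>
    (⌈T⌉₊ * modulus γ (1 / (k : ℝ))) / L +
      if j₀ ≤ (j : ℕ) + 2 ∧ (j : ℕ) ≤ j₀ + 2 then J / L else 0)
    (fun j => ?_) (fun j => ?_) ?_ ?_
  · rw [← hkm']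
    calc T / (k : ℝ) ^ 3 ≤ T / k := by
          refine div_le_div_of_nonneg_left hT0.le hkpos ?_
          exact le_self_pow₀ hk1 (by norm_num)
      _ = T * (1 / k) := by ring
      _ ≤ _ := by gcongr
  · have : 0 ≤ (⌈T⌉₊ * modulus γ (1 / (k : ℝ))) / L := by positivity
    split_ifs <;> positivity
  · have h1 : (⌈T⌉₊ * modulus γ (1 / (k : ℝ))) / L ≤ 1 / 4 := by
      rw [div_le_iff₀ hL]
      linarith
    have h2 : J / L ≤ 1 / 32 := by
      rw [div_le_iff₀ hL]
      linarith
    split_ifs <;> linarith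
  · rw [Finset.sum_add_distrib, ← hkm']
    have h1 := sum_near_le k j₀ (c := J / L) (by positivity)
    have h2 : 5 * (J / L) ≤ 1 := by
      rw [← mul_div_assoc, div_le_one hL]
      linarith
    have h3 := add_le_eps_sq γ hL k
    -- The factor T of `extScale` cancels T². The square of ⌈T⌉ + 2 pays for blocks spanning up to
    -- ⌈T⌉ scales 1/k and for the deficit at the junction, which is at most 1 in total.
    have h4 : (k : ℝ) * (extScale L * eps γ L k) ^ 2 / T ^ 2 =
        ((⌈T⌉₊ : ℝ) + 2) ^ 2 * (k * eps γ L k ^ 2) := by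
      rw [extScale, ← hT]
      field_simp
    have h5 : (k : ℝ) * (modulus γ (1 / (k : ℝ)) / L) + 1 ≤ k * eps γ L k ^ 2 := by
      refine le_trans (le_of_eq ?_) (mul_le_mul_of_nonneg_left h3 hkpos.le)
      field_simp
    have h6 : 0 ≤ (k : ℝ) * (modulus γ (1 / (k : ℝ)) / L) := by positivity
    have h7 : (0 : ℝ) ≤ ⌈T⌉₊ := Nat.cast_nonneg _
    rw [h4]
    simp only [Finset.sum_const, Finset.card_univ, Fintype.card_fin, nsmul_eq_mul]
    rw [← hkm]
    set y := (k : ℝ) * (modulus γ (1 / (k : ℝ)) / L) with hy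
    have h8 : (k : ℝ) * (⌈T⌉₊ * modulus γ (1 / (k : ℝ)) / L) = ⌈T⌉₊ * y := by
      rw [hy]
      ring
    rw [h8]
    have h9 : ((⌈T⌉₊ : ℝ) + 2) ^ 2 * (y + 1) ≤ ((⌈T⌉₊ : ℝ) + 2) ^ 2 * (k * eps γ L k ^ 2) :=
      mul_le_mul_of_nonneg_left h5 (sq_nonneg _)
    have h10 : (⌈T⌉₊ : ℝ) * y + 2 ≤ ((⌈T⌉₊ : ℝ) + 2) ^ 2 * (y + 1) := by
      nlinarith [mul_nonneg h7 h6, mul_nonneg (mul_nonneg h7 h7) h6, mul_nonneg h7 h7]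
    linarith
  · intro j s hs u hu hsj huj hsu
    rw [← hkm'] at hsj huj hsu
    have h1 : |s - u| < ⌈T⌉₊ * (1 / (k : ℝ)) := by
      refine hsu.trans_le ?_
      rw [div_eq_mul_one_div]
      gcongr
      exact Nat.le_ceil _
    refine (extField_osc hspeed hJ _ hs.1 hu.1 h1).trans ?_
    rw [mul_add, mul_div_cancel₀ _ hL.ne']
    refine add_le_add le_rfl ?_
    by_cases hiff : (s ≤ 1 ↔ u ≤ 1)
    · rw [if_pos hiff]
      split_ifs <;> positivity
    · rw [if_neg hiff, if_pos]
      · rw [mul_div_cancel₀ _ hL.ne']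
      have hkT : (k : ℝ) / T * (T / k) = 1 := by field_simp
      have hlow : ∀ s : ℝ, 1 < s → |s - (j : ℕ) * T / k| ≤ 2 * (T / k) →
          (k : ℝ) / T ≤ (j : ℕ) + 2 := by
        intro s hs hsj
        have := (abs_le.1 hsj).2
        rw [div_le_iff₀ hT0]
        have h2 : s ≤ ((j : ℕ) + 2) * T / k := by
          rw [add_mul, add_div]
          linarith [mul_div_assoc 2 T (k : ℝ)]
        rw [le_div_iff₀ hkpos] at h2
        nlinarith
      have hupp : ∀ s : ℝ, s ≤ 1 → |s - (j : ℕ) * T / k| ≤ 2 * (T / k) →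
          (((j : ℕ) : ℝ) - 2) ≤ k / T := by
        intro s hs hsj
        have := (abs_le.1 hsj).1
        rw [le_div_iff₀ hT0]
        have h2 : (((j : ℕ) : ℝ) - 2) * T / k ≤ s := by
          rw [sub_mul, sub_div]
          linarith [mul_div_assoc 2 T (k : ℝ)]
        rw [div_le_iff₀ hkpos] at h2
        nlinarith
      have hboth : (k : ℝ) / T ≤ (j : ℕ) + 2 ∧ (((j : ℕ) : ℝ) - 2) ≤ k / T := by
        by_cases hs1 : s ≤ 1
        · have hu1 : ¬u ≤ 1 := fun h => hiff ⟨fun _ => h, fun _ => hs1⟩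
          exact ⟨hlow u (not_le.1 hu1) huj, hupp s hs1 hsj⟩
        · have hu1 : u ≤ 1 := by
            by_contra h
            exact hiff ⟨fun h' => absurd h' hs1, fun h' => absurd h' h⟩
          exact ⟨hlow s (not_le.1 hs1) hsj, hupp u hu1 huj⟩
      constructor
      · have h2 : ((j₀ : ℕ) : ℝ) ≤ (j : ℕ) + 2 := (Nat.floor_le (by positivity)).trans hboth.1
        exact_mod_cast h2
      · have h2 := Nat.lt_floor_add_one ((k : ℝ) / T)
        have h3 : (((j : ℕ) : ℝ)) < j₀ + 3 := by linarith [hboth.2]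
        have h4 : (j : ℕ) < j₀ + 3 := by exact_mod_cast h3
        omega

/-- The enlarged window is covered by `extCount` scales 3ε_k, each contributing η_k, and the jump
adds at most K η_k. The oscillation thus remains a constant multiple of η_k. -/
theorem eventually_regime_ext (hγ : ContDiffOn ℝ 1 γ (Icc 0 1)) (hL : 0 < L)
    (hspeed : ∀ u ∈ Icc (0 : ℝ) 1, ‖velocity γ u‖ = L)
    (hne : ∃ s ∈ Icc (0 : ℝ) 1, ∃ t ∈ Icc (0 : ℝ) 1, velocity γ s ≠ velocity γ t)
    {K : ℝ} (hK : 0 ≤ K) :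
    ∀ᶠ k : ℕ in atTop, ∀ n : ℕ, |(n : ℝ) - (k : ℝ) ^ 2 * Real.log k| < 1 →
      ∀ m : ℕ, k = m + 1 → ∀ d : Plane, ‖d‖ = 1 → ‖velocity γ 1 - L • d‖ ≤ K * eta γ L k →
        Regime (extField γ L d) L (extTime L) (extScale L * eps γ L k)
          ((extCount L + K) * eta γ L k) (leak k n) m n ∧
        TailSmall m n ((extCount L + K) * eta γ L k / (2 * L)) := by
  obtain ⟨c, hc, hceta⟩ := exists_le_eta hspeed hne
  set T := extTime L with hT
  have hT1 : 1 < T := one_lt_extTime hL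
  have hT0 : 0 < T := by linarith
  have hc' : 0 < min c (c / (2 * L)) := lt_min hc (by positivity)
  have hδ := (tendsto_modulus hγ tendsto_one_div_nat).const_mul (⌈T⌉₊ : ℝ)
  rw [mul_zero] at hδ
  have hη := (tendsto_eta hγ L).const_mul (extCount L + K : ℝ)
  rw [mul_zero] at hη
  have hC1 := one_le_extCount hL
  filter_upwards [eventually_negligible hL hT0 hc', eventually_ge_atTop 2,
    hδ.eventually_le_const (by linarith : 0 < L / 4),
    hη.eventually_le_const (by positivity : 0 < L / 32)]
    with k hneg hk hδk hηk n hn m hkm d hd hJ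
  obtain ⟨hn0, hq1, hq2, htail⟩ := hneg n hn
  have hk1 : (1 : ℝ) ≤ k := by exact_mod_cast (by omega : 1 ≤ k)
  have hkpos : (0 : ℝ) < k := by linarith
  have hsq : 0 < √(k : ℝ) := Real.sqrt_pos.2 hkpos
  have hη0 := eta_nonneg γ L k
  have hηge : eta γ L k ≤ (extCount L + K) * eta γ L k := by nlinarith
  have hJle : K * eta γ L k ≤ L / 32 := by nlinarith
  have hJ0 : 0 ≤ K * eta γ L k := mul_nonneg hK hη0
  have hceta' := (hceta k (by omega)).trans hηge
  have hηlow : min c (c / (2 * L)) / √(k : ℝ) ≤ (extCount L + K) * eta γ L k := by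
    refine le_trans ?_ hceta'
    gcongr
    exact min_le_left _ _
  have hkm' : (k : ℝ) = m + 1 := by
    rw [hkm]
    push_cast
    ring
  have hv := constSpeed_field hγ hL hspeed
  have hinv := inv_le_eps γ L (by omega : 1 ≤ k)
  have he : 0 < eps γ L k := lt_of_lt_of_le (by positivity) hinv
  have hMT : T ≤ extScale L := extTime_le_extScale hL
  have hM0 : 0 < extScale L := hT0.trans_le hMT
  have hscale := extScale_lt hL (by omega : 1 ≤ k) γ
  have hw := window_extField (n := n) hγ hL hspeed hd hJ0 hJ (by omega) hkm hδk hJle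
  constructor
  · refine ⟨constSpeed_extField hv hd, hT0, by omega, hn0, by positivity, hw, ?_, ?_, hηk, ?_, ?_⟩
    · intro s hs u hu hsu
      rw [← hkm'] at hsu
      have h1 : |s - u| < extCount L * (3 * eps γ L k) := by
        have : 0 < extScale L * eps γ L k := by positivity
        linarith
      refine (extField_osc_le hspeed hJ _ hs.1 hu.1 h1).trans (le_of_eq ?_)
      rw [eta]
      ring
    · exact lt_of_lt_of_le (by positivity) hηlow
    · rw [← hkm]
      exact hq1
    · rw [← hkm, ← hkm']
      exact hq2 _ hηlow
  · have := htail ((extCount L + K) * eta γ L k / (2 * L)) (by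
      calc min c (c / (2 * L)) / √(k : ℝ) ≤ (c / (2 * L)) / √(k : ℝ) := by
            gcongr
            exact min_le_right _ _
        _ = (c / √(k : ℝ)) / (2 * L) := by ring
        _ ≤ _ := by gcongr)
    rw [TailSmall, ← hkm]
    exact this

end

section

/-! ### Directions for the extended path -/

variable {γ : ℝ → Plane} {L : ℝ}

/-- A displacement of a velocity field with coordinates of constant sign and nearly constant
unsigned direction has the same unsigned direction, also after a small perturbation. -/
theorem ratio_of_signs {v v' : ℝ → Plane} {Λ : ℝ} (hv : ConstSpeed v Λ) (hv' : ConstSpeed v' Λ)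
    {a b η : ℝ} (hab : a < b) (hη : η ≤ Λ / 3) (hclose : ∀ u ∈ Icc a b, ‖v u - v' u‖ ≤ η)
    {σ : Fin 2 → ℝ} (hσ : ∀ i, |σ i| = 1) (hsign : ∀ u i, 0 ≤ σ i * v' u i) {α β : ℝ}
    (hα : ∀ u, |σ 0 * v' u 0 - α * Λ| ≤ β * Λ) :
    0 < dnorm (disp v a b) ∧
      |(|disp v a b 0|) - α * dnorm (disp v a b)| ≤ (β + 3 / 2 * (η / Λ)) * dnorm (disp v a b) := by
  have hI := fun i => hv'.intervalIntegrable i a b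
  have habs : ∀ i, |disp v' a b i| = ∫ u in a..b, σ i * v' u i := by
    intro i
    rw [intervalIntegral.integral_const_mul]
    have h0 : 0 ≤ σ i * disp v' a b i := by
      rw [disp, ← intervalIntegral.integral_const_mul]
      exact intervalIntegral.integral_nonneg hab.le fun u _ => hsign u i
    have h1 := abs_of_nonneg h0
    rw [abs_mul, hσ, one_mul] at h1
    exact h1
  have hnorm : dnorm (disp v' a b) = Λ * (b - a) := by
    rw [dnorm, habs, habs, ← intervalIntegral.integral_add ((hI 0).const_mul _)
      ((hI 1).const_mul _)]
    have : ∀ u, σ 0 * v' u 0 + σ 1 * v' u 1 = Λ := by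
      intro u
      have h := hv'.speed u
      rw [plane_norm] at h
      have h2 : ∀ i, σ i * v' u i = |v' u i| := by
        intro i
        rw [← abs_of_nonneg (hsign u i), abs_mul, hσ, one_mul]
      rw [h2, h2, h]
    simp only [this, intervalIntegral.integral_const, smul_eq_mul]
    ring
  obtain ⟨h1, h2⟩ := abs_abs_sub_ratio_le (sub_pos.2 hab) hv.pos hη hnorm
    (dnorm_disp_sub_le hv hv' hab.le hclose)
  refine ⟨h1, h2 α β ?_⟩
  have e : |disp v' a b 0| - α * (Λ * (b - a)) = ∫ u in a..b, (σ 0 * v' u 0 - α * Λ) := by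
    rw [intervalIntegral.integral_sub ((hI 0).const_mul _) intervalIntegrable_const, ← habs,
      intervalIntegral.integral_const, smul_eq_mul]
    ring
  rw [hnorm, e]
  have h3 := intervalIntegral.norm_integral_le_of_norm_le_const (a := a) (b := b)
    (f := fun u => σ 0 * v' u 0 - α * Λ) (C := β * Λ) fun u _ => hα u
  rw [abs_of_pos (sub_pos.2 hab), Real.norm_eq_abs] at h3
  linarith

/-- The vector with the unsigned coordinates of `p` and the signs `σ`. -/
def withSigns (σ : Fin 2 → ℝ) (p : Plane) : Plane :=
  WithLp.toLp 1 ![σ 0 * |p 0|, σ 1 * |p 1|]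

theorem withSigns_apply (σ : Fin 2 → ℝ) (p : Plane) (i : Fin 2) :
    withSigns σ p i = σ i * |p i| := by
  fin_cases i <;> simp [withSigns]

theorem norm_withSigns {σ : Fin 2 → ℝ} (hσ : ∀ i, |σ i| = 1) (p : Plane) :
    ‖withSigns σ p‖ = ‖p‖ := by
  rw [plane_norm, plane_norm]
  simp [withSigns_apply, abs_mul, hσ]

theorem mul_self_of_abs_eq_one {x : ℝ} (hx : |x| = 1) : x * x = 1 := by
  rw [← abs_mul_abs_self, hx, mul_one]

/-- On every block the unsigned direction of the extended path is nearly constant. -/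
theorem exists_block_ratio (hv : ConstSpeed (field γ) L)
    (hspeed : ∀ u ∈ Icc (0 : ℝ) 1, ‖velocity γ u‖ = L) {d : Plane} (hd : ‖d‖ = 1)
    {σ : Fin 2 → ℝ} (hσ : ∀ i, |σ i| = 1) (hσd : ∀ i, 0 ≤ σ i * d i) {F ε h β : ℝ} {N m : ℕ}
    (hF : ‖withSigns σ (velocity γ 1) - velocity γ 1‖ ≤ F) (hε : 0 ≤ ε)
    (hN : 2 * ε + extTime L / ((m : ℝ) + 1) < N * h) (hE : N * modulus γ h + F ≤ L / 3)
    (hβ : |(|velocity γ 1 0|) - L * (|d 0|)| ≤ 2 * L * β) (j : Fin (m + 1)) :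
    ∃ α ∈ Icc (0 : ℝ) 1, ∀ t ∈ gridWindow (extTime L) ε m,
      0 < dnorm (incr (extField γ L d) 0 (extTime L) t j) ∧
      |(|incr (extField γ L d) 0 (extTime L) t j 0|) -
          α * dnorm (incr (extField γ L d) 0 (extTime L) t j)| ≤
        (β + 3 / 2 * ((N * modulus γ h + F) / L)) *
          dnorm (incr (extField γ L d) 0 (extTime L) t j) := by
  have hL := hv.pos
  set T := extTime L with hT
  have hT1 : 1 < T := one_lt_extTime hL
  have hT0 : 0 < T := by linarith
  have hext := constSpeed_extField hv hd
  have hF0 : 0 ≤ F := (norm_nonneg _).trans hF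
  have hk : (0 : ℝ) < (m : ℝ) + 1 := by positivity
  have hδ : 0 < T / ((m : ℝ) + 1) := by positivity
  have hsplit : (((j : ℕ) : ℝ) + 1) * T / (m + 1) = (j : ℕ) * T / (m + 1) + T / (m + 1) := by ring
  have hβ0 : 0 ≤ β := by
    by_contra hneg
    have : 2 * L * β < 0 := mul_neg_of_pos_of_neg (by linarith) (not_le.1 hneg)
    linarith [abs_nonneg ((|velocity γ 1 0|) - L * (|d 0|))]
  have hone : (1 : ℝ) ∈ Icc (0 : ℝ) 1 := ⟨zero_le_one, le_rfl⟩
  have hd0 : |d 0| ≤ 1 := (abs_coord_le d 0).trans hd.le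
  have hv0 : |velocity γ 1 0| ≤ L := (abs_coord_le _ 0).trans (hspeed 1 hone).le
  -- If the block ends before the junction for all knots in the window, the unsigned direction of γ
  -- at its left grid time serves as α.
  by_cases hcase : (((j : ℕ) : ℝ) + 1) * T / (m + 1) + ε ≤ 1
  · set u := ((j : ℕ) : ℝ) * T / (m + 1) with hu
    have hu0 : 0 ≤ u := by positivity
    have hu1 : u ∈ Icc (0 : ℝ) 1 := ⟨hu0, by linarith⟩
    choose τ hτ1 hτ2 using fun i => exists_sign (field γ u i)
    refine ⟨|field γ u 0| / L, ⟨by positivity, (div_le_one hL).2 (hv.abs_le u 0)⟩, fun t ht => ?_⟩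
    have hs := (abs_le.1 (abs_snoc_sub_le hε ht.2 j)).2
    have hc := (abs_le.1 (abs_cons_sub_le hε ht.2 j)).1
    obtain ⟨k1, k2, k3⟩ := knots_mem hT0.le ht.1 j
    refine ratio_of_signs hext (ConstSpeed.const (hv.speed u) hL) (knots_lt hT0 ht.1 j) hE
      (fun s hs' => ?_) (fun i => ?_) (σ := τ) (fun _ i => ?_) fun _ => ?_
    · have h1 : s ≤ 1 := by linarith [hs'.2]
      have h0 : 0 ≤ s := k1.trans hs'.1
      rw [extField, if_pos h1, field_of_mem ⟨h0, h1⟩, field_of_mem hu1]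
      have := norm_sub_le_nsmul_modulus hspeed N (h := h) (s := s) (t := u) ⟨h0, h1⟩ hu1 (by
        rw [abs_lt]
        constructor <;> linarith [hs'.1, hs'.2])
      linarith
    · rcases hτ1 i with h | h <;> simp [h]
    · rw [hτ2]
      exact abs_nonneg _
    · rw [hτ2, div_mul_cancel₀ _ hL.ne', sub_self, abs_zero]
      positivity
  -- The block may reach the junction. It is compared with a field taking two constant values, both
  -- with the signs σ, so nothing cancels in its displacement, whose unsigned direction is an
  -- average of the two.
  · have hflip : ∀ i, σ i * withSigns σ (velocity γ 1) i = |velocity γ 1 i| := by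
      intro i
      rw [withSigns_apply, ← mul_assoc, mul_self_of_abs_eq_one (hσ i), one_mul]
    have hσabs : ∀ i, σ i * d i = |d i| := by
      intro i
      rw [← abs_of_nonneg (hσd i), abs_mul, hσ, one_mul]
    have hmid : (|velocity γ 1 0| + L * |d 0|) / (2 * L) * L =
        (|velocity γ 1 0| + L * |d 0|) / 2 := by
      field_simp
    -- The midpoint halves the difference of the two unsigned directions. In the application that
    -- difference is bounded only by slightly more than the tolerance κη_k, so neither end would do.
    refine ⟨(|velocity γ 1 0| + L * |d 0|) / (2 * L), ⟨by positivity, ?_⟩, fun t ht => ?_⟩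
    · rw [div_le_one (by linarith)]
      nlinarith
    have hs := (abs_le.1 (abs_snoc_sub_le hε ht.2 j)).2
    have hc := (abs_le.1 (abs_cons_sub_le hε ht.2 j)).1
    obtain ⟨k1, k2, k3⟩ := knots_mem hT0.le ht.1 j
    refine ratio_of_signs hext (constSpeed_ite (ConstSpeed.const
      ((norm_withSigns hσ _).trans (hspeed 1 hone)) hL)
      (ConstSpeed.const (p := L • d) (by rw [norm_smul, hd, mul_one, Real.norm_of_nonneg hL.le])
        hL)) (knots_lt hT0 ht.1 j) hE (fun s hs' => ?_) hσ (fun s i => ?_) fun s => ?_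
    · have h0 : 0 ≤ s := k1.trans hs'.1
      unfold extField
      by_cases h1 : s ≤ 1
      · rw [if_pos h1, if_pos h1, field_of_mem ⟨h0, h1⟩]
        have h2 := norm_sub_le_nsmul_modulus hspeed N (h := h) (s := s) (t := 1) ⟨h0, h1⟩ hone (by
          rw [abs_lt]
          constructor <;> linarith [hs'.1, hs'.2, not_le.1 hcase])
        have h3 := norm_sub_le_norm_sub_add_norm_sub (velocity γ s) (velocity γ 1)
          (withSigns σ (velocity γ 1))
        rw [norm_sub_rev (velocity γ 1)] at h3
        linarith
      · rw [if_neg h1, if_neg h1, sub_self, norm_zero]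
        have := modulus_nonneg γ h
        positivity
    · split_ifs
      · rw [hflip]
        exact abs_nonneg _
      · rw [PiLp.smul_apply, smul_eq_mul, mul_left_comm]
        exact mul_nonneg hL.le (hσd i)
    · rw [hmid]
      obtain ⟨h1, h2⟩ := abs_le.1 hβ
      rw [abs_le]
      split_ifs
      · rw [hflip]
        constructor <;> linarith
      · rw [PiLp.smul_apply, smul_eq_mul, mul_left_comm, hσabs]
        constructor <;> linarith

theorem abs_sgn {k : ℕ} (X : Series) (n : ℕ) (ρ : Fin k → ℝ) (j : Fin k) (a : Fin 2) :
    |sgn X n ρ j a| = 1 := by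
  unfold sgn
  split_ifs <;> simp

theorem norm_direction {k : ℕ} (X : Series) (n : ℕ) {ρ : Fin k → ℝ} {j : Fin k}
    (hρ : ρ j ∈ Icc (0 : ℝ) 1) : ‖direction X n ρ j‖ = 1 := by
  rw [plane_norm]
  simp [direction, abs_mul, abs_sgn, abs_of_nonneg hρ.1, abs_of_nonneg (sub_nonneg.2 hρ.2)]

theorem extended_succ {m : ℕ} (X : Series) (n : ℕ) (ρ : Fin (m + 1) → ℝ) :
    extended X n ρ = tensorMul X (tensorExp (direction X n ρ (Fin.last m))) :=
  dif_pos m.succ_pos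

theorem one_mem_gridPiece_last (m : ℕ) : (1 : ℝ) ∈ gridPiece 1 (Fin.last m) := by
  have hm : (0 : ℝ) < m + 1 := by positivity
  constructor
  · rw [Fin.val_last, mul_one, div_le_one hm]
    linarith
  · rw [Fin.val_last, mul_one, div_self hm.ne']

/-- The sign corrections of the last velocity are of the order of its oscillation. -/
theorem Regime.norm_withSigns_sub_le {v : ℝ → Plane} {Λ T ε η q θ : ℝ} {m n : ℕ}
    (h : Regime v Λ T ε η q m n) (hμ : TailSmall m n (η / (2 * Λ))) (hθ : θ ≤ 1 / 16)
    {ρ : Fin (m + 1) → ℝ} (hρ : IsDirections (pathSig v T) n θ ρ) {j : Fin (m + 1)} {u : ℝ}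
    (hu : u ∈ gridPiece T j) :
    ‖withSigns (sgn (pathSig v T) n ρ j) (v u) - v u‖ ≤ 12 * η := by
  have key : ∀ a, |sgn (pathSig v T) n ρ j a * |v u a| - v u a| ≤ 6 * η := by
    intro a
    have hs := abs_sgn (pathSig v T) n ρ j a
    -- Only coordinates of size at most 3η can carry a wrong sign, and flipping one moves it by at
    -- most 6η. Unlike the error of the direction itself, this bound does not involve the tolerance.
    by_cases ha : 3 * η < |v u a|
    · rw [← h.sgn_eq_sign hμ hθ hρ hu ha, ← mul_assoc, mul_self_of_abs_eq_one hs, one_mul,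
        sub_self, abs_zero]
      linarith [h.η_pos]
    · refine (abs_sub _ _).trans ?_
      rw [abs_mul, hs, abs_abs]
      linarith
  rw [plane_norm]
  simp only [PiLp.sub_apply, withSigns_apply]
  linarith [key 0, key 1]

/-- The extended series is the signature of the extended path, for which the accuracy estimates
hold. -/
theorem eventually_extended (hγ : ContDiffOn ℝ 1 γ (Icc 0 1)) (hL : 0 < L)
    (hspeed : ∀ u ∈ Icc (0 : ℝ) 1, ‖velocity γ u‖ = L)
    (hne : ∃ s ∈ Icc (0 : ℝ) 1, ∃ t ∈ Icc (0 : ℝ) 1, velocity γ s ≠ velocity γ t)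
    {κ : ℝ} (hκ : 0 ≤ κ) :
    ∀ᶠ k : ℕ in atTop, ∀ n : ℕ, |(n : ℝ) - (k : ℝ) ^ 2 * Real.log k| < 1 →
      ∀ m : ℕ, k = m + 1 → ∀ ρ : Fin (m + 1) → ℝ,
        IsDirections (pathSig (field γ) 1) n (κ * eta γ L k) ρ →
        extended (pathSig (field γ) 1) n ρ = pathSig (extField γ L
          (direction (pathSig (field γ) 1) n ρ (Fin.last m))) (extTime L) ∧
        Regime (extField γ L (direction (pathSig (field γ) 1) n ρ (Fin.last m))) L (extTime L)
          (extScale L * eps γ L k) ((extCount L + (2 * L * κ + 16)) * eta γ L k) (leak k n) m n ∧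
        TailSmall m n ((extCount L + (2 * L * κ + 16)) * eta γ L k / (2 * L)) := by
  have hη := (tendsto_eta hγ L).const_mul κ
  rw [mul_zero] at hη
  filter_upwards [eventually_regime hγ hL hspeed hne,
    eventually_regime_ext hγ hL hspeed hne (K := 2 * L * κ + 16) (by positivity),
    hη.eventually_le_const (by norm_num : (0 : ℝ) < 1 / 16)] with k h1 h2 hθ n hn m hkm ρ hρ
  obtain ⟨hr, htail⟩ := h1 n hn m hkm
  have hd := norm_direction (pathSig (field γ) 1) n (hρ (Fin.last m)).1
  have hclose := hr.direction_close htail hθ hρ (one_mem_gridPiece_last m)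
  rw [field_of_mem ⟨zero_le_one, le_rfl⟩, norm_sub_rev] at hclose
  exact ⟨(extended_succ _ n ρ).trans (tensorMul_tensorExp hr.speed hd),
    h2 n hn m hkm _ hd (hclose.trans (le_of_eq (by ring)))⟩

/-- The error of the appended direction grows with κ, so a crude comparison would never fit into the
tolerance. Centring the block ratio at a midpoint uses only κη/2 of it, and the sign flips cost a
multiple of η free of κ. The remainder (1 + (3/2)(extCount + 12) + 1/2)η/L fits into the other half
exactly when κ ≥ (3 extCount + 39)/L. -/
theorem eventually_exists_extended_directions (hγ : ContDiffOn ℝ 1 γ (Icc 0 1)) (hL : 0 < L)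
    (hspeed : ∀ u ∈ Icc (0 : ℝ) 1, ‖velocity γ u‖ = L)
    (hne : ∃ s ∈ Icc (0 : ℝ) 1, ∃ t ∈ Icc (0 : ℝ) 1, velocity γ s ≠ velocity γ t)
    {κ : ℝ} (hκ : (3 * extCount L + 39) / L ≤ κ) :
    ∀ᶠ k : ℕ in atTop, ∀ n : ℕ, |(n : ℝ) - (k : ℝ) ^ 2 * Real.log k| < 1 →
      ∀ m : ℕ, k = m + 1 → ∀ ρ : Fin (m + 1) → ℝ,
        IsDirections (pathSig (field γ) 1) n (κ * eta γ L k) ρ →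
        ∃ ρ' : Fin (m + 1) → ℝ,
          IsDirections (extended (pathSig (field γ) 1) n ρ) n (κ * eta γ L k) ρ' := by
  have hκ0 : 0 ≤ κ := le_trans (by positivity) hκ
  have hη := (tendsto_eta hγ L).const_mul κ
  rw [mul_zero] at hη
  have hη' := (tendsto_eta hγ L).const_mul (extCount L + 12 : ℝ)
  rw [mul_zero] at hη'
  filter_upwards [eventually_regime hγ hL hspeed hne, eventually_extended hγ hL hspeed hne hκ0,
    hη.eventually_le_const (by norm_num : (0 : ℝ) < 1 / 16),
    hη'.eventually_le_const (by linarith : 0 < L / 3)] with k h1 h2 hθ hE n hn m hkm ρ hρ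
  obtain ⟨hr, htail⟩ := h1 n hn m hkm
  obtain ⟨hext, hr', -⟩ := h2 n hn m hkm ρ hρ
  have hone := one_mem_gridPiece_last m
  have hmem : (1 : ℝ) ∈ Icc (0 : ℝ) 1 := ⟨zero_le_one, le_rfl⟩
  have hF := hr.norm_withSigns_sub_le htail hθ hρ hone
  obtain ⟨hc, -⟩ := hr.coord_close htail hρ hone
  rw [field_of_mem hmem] at hF hc
  have hρl := (hρ (Fin.last m)).1
  set X := pathSig (field γ) 1 with hX
  set σ := sgn X n ρ (Fin.last m) with hσdef
  have hσ : ∀ i, |σ i| = 1 := abs_sgn X n ρ (Fin.last m)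
  set d := direction X n ρ (Fin.last m) with hd
  have hd0 : d 0 = σ 0 * ρ (Fin.last m) := by simp [hd, direction, hσdef]
  have hd1 : d 1 = σ 1 * (1 - ρ (Fin.last m)) := by simp [hd, direction, hσdef]
  have hσd : ∀ i, 0 ≤ σ i * d i := by
    intro i
    fin_cases i
    · simp only [Fin.zero_eta, Fin.isValue, hd0]
      rw [← mul_assoc, mul_self_of_abs_eq_one (hσ 0), one_mul]
      exact hρl.1
    · simp only [Fin.mk_one, Fin.isValue, hd1]
      rw [← mul_assoc, mul_self_of_abs_eq_one (hσ 1), one_mul]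
      linarith [hρl.2]
  have hη0 := hr.η_pos
  have hkm' : (k : ℝ) = m + 1 := by
    rw [hkm]
    push_cast
    ring
  have hN := extScale_lt hL (by omega : 1 ≤ k) γ
  rw [hkm'] at hN
  have hβ : |(|velocity γ 1 0|) - L * (|d 0|)| ≤ 2 * L * (κ * eta γ L k / 2 + eta γ L k / L) := by
    rw [hd0, abs_mul, hσ, one_mul, abs_of_nonneg hρl.1, abs_sub_comm]
    refine hc.trans (le_of_eq ?_)
    field_simp
  have hE' : extCount L * modulus γ (3 * eps γ L k) + 12 * eta γ L k ≤ L / 3 :=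
    le_trans (le_of_eq (by rw [eta]; ring)) hE
  choose α hα hwin using fun j : Fin (m + 1) => exists_block_ratio hr.speed hspeed
    (norm_direction X n hρl) hσ hσd hF hr'.ε_nonneg hN hE' hβ j
  refine ⟨α, fun j => ⟨hα j, ?_⟩⟩
  rw [hext]
  have hsum : κ * eta γ L k / 2 + eta γ L k / L + 3 / 2 *
      ((extCount L * modulus γ (3 * eps γ L k) + 12 * eta γ L k) / L) ≤
      κ * eta γ L k - eta γ L k / (2 * L) := by
    have h3 := mul_le_mul_of_nonneg_right hκ hη0.le
    have e : (3 * extCount L + 39) / L * eta γ L k = 2 * (eta γ L k / L + 3 / 2 *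
      ((extCount L * eta γ L k + 12 * eta γ L k) / L) + eta γ L k / (2 * L)) := by
      field_simp
      ring
    rw [e] at h3
    have h4 : modulus γ (3 * eps γ L k) = eta γ L k := rfl
    rw [h4]
    linarith
  have := hr'.half_lt j (α := α j) (β := κ * eta γ L k - eta γ L k / (2 * L))
    (μ := eta γ L k / (2 * L)) (by positivity) ?_ htail fun t ht => ?_
  · rw [sub_add_cancel] at this
    exact this
  · rw [div_le_iff₀ (by positivity)]
    linarith [hr.η_le]
  · obtain ⟨h3, h4⟩ := hwin j t ht
    exact ⟨h3, h4.trans (mul_le_mul_of_nonneg_right hsum h3.le)⟩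

end

section

/-! ### Polygonal paths -/

theorem polygonal_of_mem_piece {k : ℕ} (p : Plane) (v : Fin k → Plane) {j : Fin k} {u : ℝ}
    (hu : u ∈ piece j) :
    polygonal p v u = polygonal p v (((j : ℕ) : ℝ) / k) + (u - ((j : ℕ) : ℝ) / k) • v j := by
  have hk : (0 : ℝ) < k := by exact_mod_cast j.pos
  have hk' : 0 < 1 / (k : ℝ) := by positivity
  obtain ⟨h1, h2⟩ := hu
  rw [add_div] at h2
  have hsum : ∑ i : Fin k, ((max 0 (min (u - ((i : ℕ) : ℝ) / k) (1 / (k : ℝ)))) • v i -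
      (max 0 (min (((j : ℕ) : ℝ) / k - ((i : ℕ) : ℝ) / k) (1 / (k : ℝ)))) • v i) =
      (u - ((j : ℕ) : ℝ) / k) • v j := by
    rw [Finset.sum_eq_single j]
    · rw [sub_self, min_eq_left hk'.le, max_self, zero_smul, sub_zero, min_eq_left (by linarith),
        max_eq_right (by linarith)]
    · intro i _ hij
      rw [sub_eq_zero]
      congr 1
      rcases lt_or_gt_of_ne hij with h | h
      · have h3 : ((i : ℕ) : ℝ) / k + 1 / k ≤ ((j : ℕ) : ℝ) / k := by
          rw [← add_div]
          have : ((i : ℕ) : ℝ) + 1 ≤ (j : ℕ) := by exact_mod_cast h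
          gcongr
        rw [min_eq_right (by linarith), min_eq_right (by linarith)]
      · have h3 : ((j : ℕ) : ℝ) / k + 1 / k ≤ ((i : ℕ) : ℝ) / k := by
          rw [← add_div]
          have : ((j : ℕ) : ℝ) + 1 ≤ (i : ℕ) := by exact_mod_cast h
          gcongr
        rw [max_eq_left ((min_le_left _ _).trans (by linarith)),
          max_eq_left ((min_le_left _ _).trans (by linarith))]
    · simp
  rw [polygonal, polygonal, ← hsum, Finset.sum_sub_distrib]
  abel

theorem piece_lt {k : ℕ} (j : Fin k) :
    ((j : ℕ) : ℝ) / (k : ℝ) < (((j : ℕ) : ℝ) + 1) / (k : ℝ) := by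
  have hk : (0 : ℝ) < k := by exact_mod_cast j.pos
  gcongr
  linarith

theorem piece_subset {k : ℕ} (j : Fin k) : piece j ⊆ Icc 0 1 := by
  have hk : (0 : ℝ) < k := by exact_mod_cast j.pos
  refine Icc_subset_Icc (by positivity) ?_
  rw [div_le_one hk]
  exact_mod_cast j.2

theorem hasDerivWithinAt_polygonal {k : ℕ} (p : Plane) (v : Fin k → Plane) {j : Fin k} {u : ℝ}
    (hu : u ∈ piece j) : HasDerivWithinAt (polygonal p v) (v j) (piece j) u := by
  have h : HasDerivWithinAt (fun u => polygonal p v (((j : ℕ) : ℝ) / k) +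
      (u - ((j : ℕ) : ℝ) / k) • v j) (v j) (piece j) u := by
    have := (((hasDerivWithinAt_id u (piece j)).sub_const (((j : ℕ) : ℝ) / k)).smul_const
      (v j)).const_add (polygonal p v (((j : ℕ) : ℝ) / k))
    simpa using this
  exact h.congr (fun s hs => polygonal_of_mem_piece p v hs) (polygonal_of_mem_piece p v hu)

theorem derivWithin_polygonal {k : ℕ} (p : Plane) (v : Fin k → Plane) {j : Fin k} {u : ℝ}
    (hu : u ∈ piece j) : derivWithin (polygonal p v) (piece j) u = v j :=
  (hasDerivWithinAt_polygonal p v hu).derivWithin (uniqueDiffOn_Icc (piece_lt j) u hu)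

theorem polygonal_zero {k : ℕ} (p : Plane) (v : Fin k → Plane) : polygonal p v 0 = p := by
  rw [polygonal, add_eq_left]
  refine Finset.sum_eq_zero fun i _ => ?_
  have : (0 : ℝ) ≤ ((i : ℕ) : ℝ) / k := by positivity
  rw [max_eq_left ((min_le_left _ _).trans (by linarith)), zero_smul]

theorem exists_mem_piece {k : ℕ} (hk : 0 < k) {s : ℝ} (hs : s ∈ Icc (0 : ℝ) 1) :
    ∃ j : Fin k, s ∈ piece j := by
  have hk' : (0 : ℝ) < k := by exact_mod_cast hk
  rcases eq_or_lt_of_le hs.2 with rfl | h1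
  · refine ⟨⟨k - 1, by omega⟩, ?_, ?_⟩
    · rw [div_le_one hk']
      exact_mod_cast (by omega : k - 1 ≤ k)
    · rw [le_div_iff₀ hk', one_mul]
      exact_mod_cast (by omega : k ≤ k - 1 + 1)
  · have h2 := Nat.floor_le (mul_nonneg hs.1 hk'.le)
    have h3 := Nat.lt_floor_add_one (s * k)
    have h4 : s * k < k := by nlinarith
    refine ⟨⟨⌊s * k⌋₊, ?_⟩, ?_, ?_⟩
    · exact_mod_cast h2.trans_lt h4
    · rw [div_le_iff₀ hk']
      exact h2
    · rw [le_div_iff₀ hk']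
      exact h3.le

/-- A polygonal path whose velocities are close to those of `γ` stays close to `γ`. -/
theorem norm_polygonal_sub_le {γ g : ℝ → Plane} {k : ℕ} (hk : 0 < k) {v : Fin k → Plane} {B : ℝ}
    (hγ : ∀ u ∈ Icc (0 : ℝ) 1, HasDerivWithinAt γ (g u) (Icc 0 1) u)
    (hB : ∀ j, ∀ u ∈ piece j, ‖v j - g u‖ ≤ B) {s : ℝ} (hs : s ∈ Icc (0 : ℝ) 1) :
    ‖polygonal (γ 0) v s - γ s‖ ≤ B := by
  have hk' : (0 : ℝ) < k := by exact_mod_cast hk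
  set f : ℝ → Plane := fun u => polygonal (γ 0) v u - γ u with hf
  have hstep : ∀ j : Fin k, ∀ u ∈ piece j,
      ‖f u - f (((j : ℕ) : ℝ) / k)‖ ≤ B * (u - ((j : ℕ) : ℝ) / k) := by
    intro j u hu
    have hl : ((j : ℕ) : ℝ) / k ∈ piece j := ⟨le_rfl, (piece_lt j).le⟩
    have := (convex_Icc _ _).norm_image_sub_le_of_norm_hasDerivWithin_le (s := piece j)
      (fun x hx => (hasDerivWithinAt_polygonal (γ 0) v hx).sub
        ((hγ x (piece_subset j hx)).mono (piece_subset j))) (hB j) hl hu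
    rw [Real.norm_of_nonneg (sub_nonneg.2 hu.1)] at this
    exact this
  -- The two paths agree at time 0, and the error grows by at most B/k per piece.
  have hgrid : ∀ i ≤ k, ‖f ((i : ℝ) / k)‖ ≤ B * ((i : ℝ) / k) := by
    intro i
    induction i with
    | zero => simp [hf, polygonal_zero]
    | succ i ih =>
      intro hi
      have h1 := hstep ⟨i, hi⟩ (((i : ℝ) + 1) / k) ⟨(piece_lt ⟨i, hi⟩).le, le_rfl⟩
      have h2 := ih (by omega)
      have h3 := norm_le_norm_add_norm_sub' (f (((i : ℝ) + 1) / k)) (f ((i : ℝ) / k))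
      simp only at h1
      push_cast
      linarith
  have hB0 : 0 ≤ B :=
    (norm_nonneg _).trans (hB ⟨0, hk⟩ _ ⟨le_rfl, (piece_lt (⟨0, hk⟩ : Fin k)).le⟩)
  obtain ⟨j, hj⟩ := exists_mem_piece hk hs
  have h1 := hstep j s hj
  have h2 := hgrid j j.2.le
  have h3 := norm_le_norm_add_norm_sub' (f s) (f (((j : ℕ) : ℝ) / k))
  have h4 : B * s ≤ B := mul_le_of_le_one_right hB0 hs.2
  change ‖f s‖ ≤ B
  linarith

/-! ### Locality of the procedure -/

theorem length_eq_count (l : Word) : l.length = l.count 0 + l.count 1 := by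
  induction l with
  | nil => simp
  | cons a l ih => fin_cases a <;> simp [ih] <;> omega

theorem length_of_mem_blockWords {m : ℕ} {c : Fin (m + 1) → Fin 2 → ℕ} {e : Fin m → Fin 2}
    {w : Word} (hw : w ∈ blockWords (k := m + 1) c e) :
    w.length = ∑ j, (c j 0 + c j 1) + m := by
  obtain ⟨b, hb, rfl⟩ := hw
  rw [assemble, List.length_flatten, List.map_ofFn, List.sum_ofFn]
  simp only [Function.comp_apply, List.length_append, Finset.sum_add_distrib]
  congr 1
  · rw [← Finset.sum_add_distrib]
    exact Finset.sum_congr rfl fun j _ => by rw [length_eq_count, hb, hb]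
  · rw [Fin.sum_univ_castSucc]
    simp

variable {X X' : Series}

theorem blockSum_congr {m N : ℕ} (h : ∀ w : Word, w.length ≤ N → X w = X' w)
    {c : Fin (m + 1) → Fin 2 → ℕ} (hc : ∑ j, (c j 0 + c j 1) + m ≤ N) (e : Fin m → Fin 2) :
    blockSum (k := m + 1) X c e = blockSum (k := m + 1) X' c e :=
  finsum_mem_congr rfl fun w hw => h w ((length_of_mem_blockWords hw).trans_le hc)

theorem sum_evenCount {k n : ℕ} (l : Fin k → Fin (n + 1)) :
    ∑ j, (evenCount l j 0 + evenCount l j 1) = 2 * n * k := by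
  have h : ∀ j, evenCount l j 0 + evenCount l j 1 = 2 * n := by
    intro j
    have := (l j).2
    simp only [evenCount, Matrix.cons_val_zero, Matrix.cons_val_one]
    omega
  simp only [h, Finset.sum_const, Finset.card_univ, Fintype.card_fin, smul_eq_mul]
  ring

theorem symSig_congr {m n : ℕ}
    (h : ∀ w : Word, w.length ≤ 2 * n * (m + 1) + (m + 1) → X w = X' w)
    (w : Fin m → Fin 2) (l : Fin (m + 1) → Fin (n + 1)) :
    symSig (k := m + 1) X w l = symSig (k := m + 1) X' w l :=
  blockSum_congr h (by rw [sum_evenCount]; omega) w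

/-- Here the length bound is attained: 2nk letters in the blocks, k - 1 separators and the
additional letter, with k = m + 1. -/
theorem symSigExtra_congr {m n : ℕ}
    (h : ∀ w : Word, w.length ≤ 2 * n * (m + 1) + (m + 1) → X w = X' w) (i : Fin (m + 1))
    (a : Fin 2) (w : Fin m → Fin 2) (l : Fin (m + 1) → Fin (n + 1)) :
    symSigExtra (k := m + 1) X i a w l = symSigExtra (k := m + 1) X' i a w l := by
  refine blockSum_congr h ?_ w
  have e : ∀ j, (evenCount l j 0 + (if j = i ∧ (0 : Fin 2) = a then 1 else 0)) +
      (evenCount l j 1 + (if j = i ∧ (1 : Fin 2) = a then 1 else 0)) =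
      (evenCount l j 0 + evenCount l j 1) + if j = i then 1 else 0 := by
    intro j
    fin_cases a <;> simp <;> omega
  simp only [e]
  rw [Finset.sum_add_distrib, sum_evenCount]
  simp only [Finset.sum_ite_eq', Finset.mem_univ, if_true]
  omega

theorem sgn_congr {m n : ℕ}
    (h : ∀ w : Word, w.length ≤ 2 * n * (m + 1) + (m + 1) → X w = X' w)
    (ρ : Fin (m + 1) → ℝ) (i : Fin (m + 1)) (a : Fin 2) : sgn X n ρ i a = sgn X' n ρ i a := by
  unfold sgn
  simp only [symSig_congr h, symSigExtra_congr h]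

theorem direction_congr {m n : ℕ}
    (h : ∀ w : Word, w.length ≤ 2 * n * (m + 1) + (m + 1) → X w = X' w)
    (ρ : Fin (m + 1) → ℝ) (i : Fin (m + 1)) : direction X n ρ i = direction X' n ρ i := by
  simp only [direction, sgn_congr h]

theorem IsDirections.congr {m n : ℕ}
    (h : ∀ w : Word, w.length ≤ 2 * n * (m + 1) + (m + 1) → X w = X' w) {θ : ℝ}
    {ρ : Fin (m + 1) → ℝ} (hρ : IsDirections X n θ ρ) : IsDirections X' n θ ρ := by
  intro j
  have := hρ j
  simp only [symSig_congr h] at this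
  exact this

theorem levelOneNorm_congr {N : ℕ} (hN : 1 ≤ N) (h : ∀ w : Word, w.length ≤ N → X w = X' w) :
    levelOneNorm X = levelOneNorm X' := by
  rw [levelOneNorm, levelOneNorm, h [0] hN, h [1] hN]

theorem scaledLength_congr {m n : ℕ}
    (h : ∀ w : Word, w.length ≤ 2 * n * (m + 1) + (m + 1) → X w = X' w)
    (ρ : Fin (m + 1) → ℝ) : scaledLength X n ρ = scaledLength X' n ρ := by
  simp only [scaledLength, sgn_congr h, levelOneNorm_congr (by omega) h]

/-- The coefficient of a product at w involves the first factor only at prefixes of w, and the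
appended direction depends on the same coefficients. -/
theorem extended_congr {m n : ℕ}
    (h : ∀ w : Word, w.length ≤ 2 * n * (m + 1) + (m + 1) → X w = X' w)
    (ρ : Fin (m + 1) → ℝ) (w : Word) (hw : w.length ≤ 2 * n * (m + 1) + (m + 1)) :
    extended X n ρ w = extended X' n ρ w := by
  rw [extended_succ, extended_succ, direction_congr h]
  refine Finset.sum_congr rfl fun i _ => ?_
  rw [h _ ((List.length_take_le' _ _).trans hw)]

/-- The procedure only uses the coefficients of words of length at most `2 n k + k`. -/
theorem IsReconstruction.congr {m n : ℕ}
    (h : ∀ w : Word, w.length ≤ 2 * n * (m + 1) + (m + 1) → X w = X' w) {θ Lt : ℝ}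
    {ρ : Fin (m + 1) → ℝ} (hR : IsReconstruction X n θ ρ Lt) : IsReconstruction X' n θ ρ Lt := by
  obtain ⟨hρ, hlen⟩ := hR
  refine ⟨hρ.congr h, ?_⟩
  rcases hlen with ⟨hN, hLt⟩ | ⟨hN, ρ', hρ', hLt⟩
  · exact Or.inl ⟨levelOneNorm_congr (by omega) h ▸ hN, hLt.trans (scaledLength_congr h ρ)⟩
  · have hext := extended_congr h ρ
    refine Or.inr ⟨levelOneNorm_congr (by omega) h ▸ hN, ρ', hρ'.congr hext, ?_⟩
    rw [hLt, scaledLength_congr hext]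

end

section

/-! ### Accuracy of the reconstruction -/

variable {γ : ℝ → Plane} {L : ℝ}

theorem gridPiece_one {m : ℕ} (j : Fin (m + 1)) : gridPiece 1 j = piece j := by
  simp [gridPiece, piece]

theorem levelOneNorm_nonneg (X : Series) : 0 ≤ levelOneNorm X :=
  add_nonneg (abs_nonneg _) (abs_nonneg _)

/-- The extended path has total displacement of norm one if the path is closed. -/
theorem levelOneNorm_extField (hv : ConstSpeed (field γ) L)
    (h0 : levelOneNorm (pathSig (field γ) 1) = 0) {d : Plane} (hd : ‖d‖ = 1) :
    levelOneNorm (pathSig (extField γ L d) (extTime L)) = 1 := by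
  have hL := hv.pos
  have hT := one_lt_extTime hL
  have hext := constSpeed_extField hv hd
  rw [levelOneNorm_pathSig _ zero_le_one, dnorm] at h0
  have hz : ∀ a, disp (field γ) 0 1 a = 0 := by
    have h1 := abs_nonneg (disp (field γ) 0 1 0)
    have h2 := abs_nonneg (disp (field γ) 0 1 1)
    refine Fin.forall_fin_two.2 ⟨abs_eq_zero.1 ?_, abs_eq_zero.1 ?_⟩ <;> linarith
  have key : ∀ a, disp (extField γ L d) 0 (extTime L) a = d a := by
    intro a
    have h1 : ∫ u in (0 : ℝ)..1, extField γ L d u a = disp (field γ) 0 1 a := by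
      refine intervalIntegral.integral_congr fun u hu => ?_
      rw [uIcc_of_le zero_le_one] at hu
      simp only [extField, if_pos hu.2]
    have h2 : ∫ u in (1 : ℝ)..extTime L, extField γ L d u a = d a := by
      have : ∫ u in (1 : ℝ)..extTime L, extField γ L d u a =
          ∫ _u in (1 : ℝ)..extTime L, L * d a := by
        refine intervalIntegral.integral_congr_ae (Eventually.of_forall fun u hu => ?_)
        rw [uIoc_of_le hT.le] at hu
        simp only [extField, if_neg (not_le.2 hu.1), PiLp.smul_apply, smul_eq_mul]
      rw [this, intervalIntegral.integral_const, smul_eq_mul, extTime]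
      field_simp
      ring
    rw [disp, ← intervalIntegral.integral_add_adjacent_intervals (hext.intervalIntegrable a 0 1)
      (hext.intervalIntegrable a 1 _), h1, h2, hz, zero_add]
  rw [levelOneNorm_pathSig _ (by linarith), dnorm, key, key, ← plane_norm, hd]

theorem eventually_direction_close (hγ : ContDiffOn ℝ 1 γ (Icc 0 1)) (hL : 0 < L)
    (hspeed : ∀ u ∈ Icc (0 : ℝ) 1, ‖velocity γ u‖ = L)
    (hne : ∃ s ∈ Icc (0 : ℝ) 1, ∃ t ∈ Icc (0 : ℝ) 1, velocity γ s ≠ velocity γ t) (κ : ℝ) :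
    ∀ᶠ k : ℕ in atTop, ∀ n : ℕ, |(n : ℝ) - (k : ℝ) ^ 2 * Real.log k| < 1 →
      ∀ m : ℕ, k = m + 1 → ∀ ρ : Fin (m + 1) → ℝ,
        IsDirections (pathSig (field γ) 1) n (κ * eta γ L k) ρ →
        ∀ j : Fin (m + 1), ∀ u ∈ gridPiece 1 j,
          ‖L • direction (pathSig (field γ) 1) n ρ j - field γ u‖ ≤
            (2 * L * κ + 16) * eta γ L k := by
  have hη := (tendsto_eta hγ L).const_mul κ
  rw [mul_zero] at hη
  filter_upwards [eventually_regime hγ hL hspeed hne,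
    hη.eventually_le_const (by norm_num : (0 : ℝ) < 1 / 16)] with k h1 hθ n hn m hkm ρ hρ j u hu
  obtain ⟨hr, htail⟩ := h1 n hn m hkm
  exact (hr.direction_close htail hθ hρ hu).trans (le_of_eq (by ring))

/-- If the end points of γ differ, their distance N is a fixed positive number and the length
estimate applies directly. If they coincide, the extended path has displacement of norm 1 and length
L + 1, and the added 1 is removed again. -/
theorem exists_length_close (hγ : ContDiffOn ℝ 1 γ (Icc 0 1)) (hL : 0 < L)
    (hspeed : ∀ u ∈ Icc (0 : ℝ) 1, ‖velocity γ u‖ = L)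
    (hne : ∃ s ∈ Icc (0 : ℝ) 1, ∃ t ∈ Icc (0 : ℝ) 1, velocity γ s ≠ velocity γ t)
    {κ : ℝ} (hκ : 0 ≤ κ) :
    ∃ A : ℝ, 0 ≤ A ∧ ∀ᶠ k : ℕ in atTop, ∀ n : ℕ, |(n : ℝ) - (k : ℝ) ^ 2 * Real.log k| < 1 →
      ∀ m : ℕ, k = m + 1 → ∀ (ρ : Fin (m + 1) → ℝ) (Lt : ℝ),
        IsReconstruction (pathSig (field γ) 1) n (κ * eta γ L k) ρ Lt →
        |Lt - L| ≤ A * eta γ L k := by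
  have hv := constSpeed_field hγ hL hspeed
  set N := levelOneNorm (pathSig (field γ) 1) with hN
  have hN0 : 0 ≤ N := levelOneNorm_nonneg _
  rcases eq_or_lt_of_le hN0 with hN0 | hN0
  · have hT : 0 < extTime L := by linarith [one_lt_extTime hL]
    have hM := one_le_extCount hL
    -- The directions of the extended path have tolerance κη_k and oscillation (extCount + (2Lκ +
    -- 16))η_k, where 2Lκ + 16 bounds the jump at the junction.
    set K := 2 * L * κ + 16 * (extCount L + (2 * L * κ + 16)) with hK
    have hK0 : 0 ≤ K := by positivity
    have hη := (tendsto_eta hγ L).const_mul κ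
    have hη' := (tendsto_eta hγ L).const_mul (4 * extTime L * K)
    rw [mul_zero] at hη hη'
    refine ⟨4 * L * extTime L ^ 2 * K, by positivity, ?_⟩
    filter_upwards [eventually_extended hγ hL hspeed hne hκ,
      hη.eventually_le_const (by norm_num : (0 : ℝ) < 1 / 16),
      hη'.eventually_le_const zero_lt_one] with k h1 hθ hk n hn m hkm ρ Lt hR
    obtain ⟨hρ, ⟨h, -⟩ | ⟨-, ρ', hρ', hLt⟩⟩ := hR
    · exact absurd hN0.symm h
    obtain ⟨hext, hr, htail⟩ := h1 n hn m hkm ρ hρ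
    have hNY := levelOneNorm_extField hv hN0.symm
      (norm_direction (pathSig (field γ) 1) n (hρ (Fin.last m)).1)
    rw [hext] at hρ' hLt
    have := abs_scaledLength_sub_le hr.speed hT rfl (E := K * eta γ L k)
      (fun j u hu => (hr.direction_close htail hθ hρ' hu).trans (le_of_eq (by rw [hK]; ring)))
      (by rw [hNY]; exact zero_lt_one) (by rw [hNY]; linarith)
    rw [hNY, div_one] at this
    have e : L * extTime L = L + 1 := by
      rw [extTime]
      field_simp
    rw [e] at this
    rw [hLt]
    refine le_trans (le_of_eq ?_) (this.trans (le_of_eq (by ring)))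
    congr 1
    ring
  · set K := 2 * L * κ + 16 with hK
    have hK0 : 0 ≤ K := by positivity
    have hη := (tendsto_eta hγ L).const_mul (4 * K)
    rw [mul_zero] at hη
    refine ⟨4 * L * K / N, by positivity, ?_⟩
    filter_upwards [eventually_direction_close hγ hL hspeed hne κ,
      hη.eventually_le_const hN0] with k h1 hk n hn m hkm ρ Lt hR
    obtain ⟨hρ, ⟨-, hLt⟩ | ⟨h, -⟩⟩ := hR
    · have := abs_scaledLength_sub_le hv one_pos rfl (h1 n hn m hkm ρ hρ) hN0 (by linarith)
      rw [← hLt, mul_one] at this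
      exact this.trans (le_of_eq (by rw [← hN]; ring))
    · exact absurd h hN0.ne'

/-- The directions have norm 1, so replacing L by `Lt` costs |Lt - L|, a further multiple of η_k. -/
theorem exists_reconstruction_close (hγ : ContDiffOn ℝ 1 γ (Icc 0 1)) (hL : 0 < L)
    (hspeed : ∀ u ∈ Icc (0 : ℝ) 1, ‖velocity γ u‖ = L)
    (hne : ∃ s ∈ Icc (0 : ℝ) 1, ∃ t ∈ Icc (0 : ℝ) 1, velocity γ s ≠ velocity γ t)
    {κ : ℝ} (hκ : 0 ≤ κ) :
    ∃ G : ℝ, 0 ≤ G ∧ ∀ᶠ k : ℕ in atTop, 0 < eta γ L k ∧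
      ∀ n : ℕ, |(n : ℝ) - (k : ℝ) ^ 2 * Real.log k| < 1 →
      ∀ (ρ : Fin k → ℝ) (Lt : ℝ), IsReconstruction (signature γ) n (κ * eta γ L k) ρ Lt →
        0 < Lt ∧ (∀ j, ‖direction (signature γ) n ρ j‖ = 1) ∧
        ∀ j : Fin k, ∀ u ∈ piece j,
          ‖Lt • direction (signature γ) n ρ j - velocity γ u‖ ≤ G * eta γ L k := by
  obtain ⟨A, hA0, hA⟩ := exists_length_close hγ hL hspeed hne hκ
  obtain ⟨c, hc, hceta⟩ := exists_le_eta hspeed hne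
  have hη := (tendsto_eta hγ L).const_mul A
  rw [mul_zero] at hη
  refine ⟨A + (2 * L * κ + 16), by positivity, ?_⟩
  rw [signature_eq_pathSig hγ hL hspeed]
  filter_upwards [hA, eventually_direction_close hγ hL hspeed hne κ,
    hη.eventually_le_const (by linarith : 0 < L / 2), eventually_ge_atTop 1] with k h1 h2 hk hk1
  have hk0 : (0 : ℝ) < k := by exact_mod_cast hk1
  refine ⟨lt_of_lt_of_le (by positivity) (hceta k hk1), fun n hn ρ Lt hR => ?_⟩
  obtain ⟨m, rfl⟩ := Nat.exists_eq_add_of_le' hk1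
  have hlen := h1 n hn m rfl ρ Lt hR
  have hdir : ∀ j, ‖direction (pathSig (field γ) 1) n ρ j‖ = 1 := fun j =>
    norm_direction _ n (hR.1 j).1
  refine ⟨by linarith [(abs_le.1 hlen).1], hdir, fun j u hu => ?_⟩
  have h3 := h2 n hn m rfl ρ hR.1 j u (by rwa [gridPiece_one])
  rw [field_of_mem (piece_subset j hu)] at h3
  have h4 := norm_sub_le_norm_sub_add_norm_sub (Lt • direction (pathSig (field γ) 1) n ρ j)
    (L • direction (pathSig (field γ) 1) n ρ j) (velocity γ u)
  rw [← sub_smul, norm_smul, hdir, mul_one, Real.norm_eq_abs] at h4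
  rw [add_mul]
  linarith

theorem hasDerivWithinAt_velocity (hγ : ContDiffOn ℝ 1 γ (Icc 0 1)) {u : ℝ}
    (hu : u ∈ Icc (0 : ℝ) 1) : HasDerivWithinAt γ (velocity γ u) (Icc 0 1) u :=
  (hγ.differentiableOn one_ne_zero u hu).hasDerivWithinAt

/-- No index satisfies the strict inequality with a nonpositive tolerance, so the numerator is an
empty sum. This settles the straight line, for which η_k = 0. -/
theorem not_isDirections_zero {k : ℕ} (hk : 0 < k) (X : Series) (n : ℕ) {θ : ℝ} (hθ : θ ≤ 0)
    (ρ : Fin k → ℝ) : ¬IsDirections X n θ ρ := by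
  intro h
  have h1 := (h ⟨0, hk⟩).2
  rw [Finset.sum_eq_zero fun w _ => ?_] at h1
  · norm_num at h1
  · refine Finset.sum_eq_zero fun l hl => ?_
    exact absurd ((Finset.mem_filter.1 hl).2.trans_le hθ) (not_lt.2 (abs_nonneg _))

/-- The true unsigned direction at the left end of each piece is admissible: by `Regime.mass_near`
more than half of the mass lies within 2η_k/L of it, whence the bound 2/L on κ. -/
theorem eventually_exists_directions (hγ : ContDiffOn ℝ 1 γ (Icc 0 1)) (hL : 0 < L)
    (hspeed : ∀ u ∈ Icc (0 : ℝ) 1, ‖velocity γ u‖ = L)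
    (hne : ∃ s ∈ Icc (0 : ℝ) 1, ∃ t ∈ Icc (0 : ℝ) 1, velocity γ s ≠ velocity γ t)
    {κ : ℝ} (hκ : 2 / L ≤ κ) :
    ∀ᶠ k : ℕ in atTop, ∀ n : ℕ, |(n : ℝ) - (k : ℝ) ^ 2 * Real.log k| < 1 →
      ∃ ρ : Fin k → ℝ, IsDirections (signature γ) n (κ * eta γ L k) ρ := by
  rw [signature_eq_pathSig hγ hL hspeed]
  filter_upwards [eventually_regime hγ hL hspeed hne, eventually_ge_atTop 1] with k h1 hk n hn
  obtain ⟨m, rfl⟩ := Nat.exists_eq_add_of_le' hk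
  obtain ⟨hr, htail⟩ := h1 n hn m rfl
  refine ⟨fun j => |field γ (((j : ℕ) : ℝ) * 1 / ((m : ℝ) + 1)) 0| / L, fun j => ⟨⟨by positivity,
    (div_le_one hL).2 (hr.speed.abs_le _ 0)⟩, ?_⟩⟩
  refine (hr.mass_near htail (j := j) ⟨le_rfl, ?_⟩).trans_le ?_
  · gcongr
    linarith
  · refine div_le_div_of_nonneg_right (Finset.sum_le_sum fun w _ => ?_)
      (Finset.sum_nonneg fun _ _ => Finset.sum_nonneg fun _ _ => abs_nonneg _)
    refine Finset.sum_le_sum_of_subset_of_nonneg ?_ fun _ _ _ => abs_nonneg _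
    refine Finset.monotone_filter_right _ fun l _ hl => hl.trans_le ?_
    have := mul_le_mul_of_nonneg_right hκ hr.η_pos.le
    exact le_trans (le_of_eq (by ring)) this

end

end

end SigInv

/-! ### The reconstruction theorem -/

theorem mainTheorem1 (γ : ℝ → Plane) (L : ℝ) (hγ : ContDiffOn ℝ 1 γ (Icc 0 1)) (hL : 0 < L)
    (hspeed : ∀ u ∈ Icc (0 : ℝ) 1, ‖velocity γ u‖ = L) :
    -- the error scale tends to zero
    Tendsto (fun k : ℕ => eta γ L k) atTop (𝓝 0) ∧
    -- whatever the procedure returns is close to the path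
    (∀ κ : ℝ, 0 < κ → ∃ C : ℝ, 0 < C ∧ ∀ᶠ k : ℕ in atTop, ∀ n : ℕ,
      |(n : ℝ) - (k : ℝ) ^ 2 * Real.log k| < 1 →
      ∀ (ρ : Fin k → ℝ) (Lt : ℝ), IsReconstruction (signature γ) n (κ * eta γ L k) ρ Lt →
        0 < Lt ∧
        (∀ j : Fin k, ∀ u ∈ piece j,
          ‖Lt • direction (signature γ) n ρ j - velocity γ u‖ < C * eta γ L k) ∧
        (∀ j : Fin k, ∀ u ∈ piece j,
          ‖derivWithin (polygonal (γ 0) fun i => Lt • direction (signature γ) n ρ i)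
            (piece j) u‖ = Lt) ∧
        (∀ s ∈ Icc (0 : ℝ) 1, ∀ j : Fin k, ∀ u ∈ piece j,
          ‖polygonal (γ 0) (fun i => Lt • direction (signature γ) n ρ i) s - γ s‖ +
            ‖derivWithin (polygonal (γ 0) fun i => Lt • direction (signature γ) n ρ i)
              (piece j) u - velocity γ u‖ < C * eta γ L k)) ∧
    -- unless the path is a straight line, the procedure does return something
    ((∃ s ∈ Icc (0 : ℝ) 1, ∃ t ∈ Icc (0 : ℝ) 1, velocity γ s ≠ velocity γ t) →
      (∀ κ : ℝ, 2 / L ≤ κ → ∀ᶠ k : ℕ in atTop, ∀ n : ℕ,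
        |(n : ℝ) - (k : ℝ) ^ 2 * Real.log k| < 1 →
        ∃ ρ : Fin k → ℝ, IsDirections (signature γ) n (κ * eta γ L k) ρ) ∧
      (∃ κ₀ : ℝ, ∀ κ : ℝ, κ₀ ≤ κ → ∀ᶠ k : ℕ in atTop, ∀ n : ℕ,
        |(n : ℝ) - (k : ℝ) ^ 2 * Real.log k| < 1 →
        ∀ ρ : Fin k → ℝ, IsDirections (signature γ) n (κ * eta γ L k) ρ →
          ∃ Lt : ℝ, IsReconstruction (signature γ) n (κ * eta γ L k) ρ Lt)) ∧
    -- the procedure only uses the signature up to level `2 n k + k`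
    (∀ (k n : ℕ), 0 < k → ∀ X X' : Series,
      (∀ w : Word, w.length ≤ 2 * n * k + k → X w = X' w) →
      ∀ (θ : ℝ) (ρ : Fin k → ℝ) (Lt : ℝ), IsReconstruction X n θ ρ Lt →
        IsReconstruction X' n θ ρ Lt ∧ ∀ j, direction X' n ρ j = direction X n ρ j) := by
  refine ⟨tendsto_eta hγ L, fun κ hκ => ?_, fun hne => ⟨fun κ hκ =>
    eventually_exists_directions hγ hL hspeed hne hκ, (3 * extCount L + 39) / L, fun κ hκ => ?_⟩,
    fun k n hk X X' h θ ρ Lt hR => ?_⟩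
  · by_cases hne : ∃ s ∈ Icc (0 : ℝ) 1, ∃ t ∈ Icc (0 : ℝ) 1, velocity γ s ≠ velocity γ t
    · obtain ⟨G, hG, hev⟩ := exists_reconstruction_close hγ hL hspeed hne hκ.le
      -- One G bounds the positions and one the velocities; the summand 1, with η_k > 0, makes the
      -- inequality strict.
      refine ⟨2 * G + 1, by positivity, ?_⟩
      filter_upwards [hev, eventually_ge_atTop 1] with k hk hk1 n hn ρ Lt hR
      obtain ⟨hη, hk⟩ := hk
      obtain ⟨hLt, hdir, hclose⟩ := hk n hn ρ Lt hR
      have hGη : 0 ≤ G * eta γ L k := mul_nonneg hG hη.le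
      refine ⟨hLt, fun j u hu => ?_, fun j u hu => ?_, fun s hs j u hu => ?_⟩
      · linarith [hclose j u hu]
      · rw [derivWithin_polygonal _ _ hu, norm_smul, hdir, mul_one, Real.norm_of_nonneg hLt.le]
      · rw [derivWithin_polygonal _ _ hu]
        have h1 := norm_polygonal_sub_le hk1 (fun u hu => hasDerivWithinAt_velocity hγ hu)
          hclose hs
        linarith [hclose j u hu]
    · push Not at hne
      -- Straight line: the procedure has no output, so any constant works.
      refine ⟨1, one_pos, ?_⟩
      filter_upwards [eventually_ge_atTop 1] with k hk1 n _ ρ Lt hR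
      exact absurd hR.1 (not_isDirections_zero hk1 _ _ (by rw [eta_eq_zero hne, mul_zero]) ρ)
  · rw [signature_eq_pathSig hγ hL hspeed]
    filter_upwards [eventually_exists_extended_directions hγ hL hspeed hne hκ,
      eventually_ge_atTop 1] with k hk hk1 n hn ρ hρ
    obtain ⟨m, rfl⟩ := Nat.exists_eq_add_of_le' hk1
    by_cases hN : levelOneNorm (pathSig (field γ) 1) = 0
    · obtain ⟨ρ', hρ'⟩ := hk n hn m rfl ρ hρ
      exact ⟨_, hρ, Or.inr ⟨hN, ρ', hρ', rfl⟩⟩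
    · exact ⟨_, hρ, Or.inl ⟨hN, rfl⟩⟩
  · obtain ⟨m, rfl⟩ := Nat.exists_eq_add_of_le' hk
    exact ⟨hR.congr h, fun j => (direction_congr h ρ j).symm⟩
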